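/- Let $X$ be a complex Banach space and let $A(t)$, $t\in[-1,1]$, be densely defined closed operators in $X$ with a common domain $D$. Assume that there are $\theta\in(0,\pi/2)$, $M$, $\omega>0$, $\gamma\in[0,1)$ and $L_1,L_2$ such that for all $t,s\in[-1,1]$: * (strong positivity) $\|(zI-A(t))^{-1}\|\le \frac{M}{1+|z|}$ for $z=0$ and for all $z\in\mathbb C$ with $|\arg z|\ge\theta$; * $\|e^{-rA(t)}\|\le e^{-\omega r}$ for all $r\ge 0$; * $\|[A(t)-A(s)]A^{-\gamma}(t)\|\le L_1|t-s|$, where the operator has its natural domain $\{x: A^{-\gamma}(t)x\in D\}$, so that $[A(t)-A(s)]A^{-\gamma}(t)$ extends to a bounded operator on $X$ and $A(t)-A(s)$ extends to the domain of $A^\gamma(t)$; * $A^\gamma(t)A^{-\gamma}(s)$ is defined on all of $X$ and $\|A^\gamma(t)A^{-\gamma}(s)-I\|\le L_2|t-s|$. For $n\ge1$ let $t_k=\cos\frac{(n-k)\pi}{n}$, $k=0,\dots,n$, $\tau_k=t_k-t_{k-1}$, $A_k=A(t_k)$, and let $L_{j,n}$ be the fundamental Lagrange polynomials of these nodes. The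 problem $$v'(t)+A(t)v(t)=f(t),\quad t\in(-1,1),\qquad v(-1)+\alpha v(1)=\varphi ,$$ with $\alpha\in\mathbb R$, $f\in C([-1,1];X)$, is discretized by the system $$x_0+\alpha x_n=\varphi,\qquad x_k=e^{-A_k\tau_k}x_{k-1}+\sum_{j=0}^n\alpha_{kj}x_j+\phi_k,\quad k=1,\dots,n,$$ $$\alpha_{kj}=\int_{t_{k-1}}^{t_k}e^{-A_k(t_k-s)}[A_k-A(s)]L_{j,n}(s)\,ds,\qquad \phi_k=\int_{t_{k-1}}^{t_k}e^{-A_k(t_k-s)}f(s)\,ds$$ for $x_k$ in the domain of $A_k^\gamma$. Put $\tilde x=(A_k^\gamma x_k)_{k=0}^n$ and $\phi=(A_0^\gamma\varphi,A_1^\gamma\phi_1,\dots,A_n^\gamma\phi_n)$. Let $S$ be the block matrix with unit diagonal, subdiagonal entries $-\sigma_k$, $\sigma_k=e^{-A_k\tau_k}A_k^\gamma A_{k-1}^{-\gamma}$ in row $k=1,\dots,n$, entry $\alpha\sigma_0$, $\sigma_0=A_0^\gamma A_n^{-\gamma}$, in the last column of row $0$, and zeros elsewhere. Let $B$ be the block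 matrix with zero row $0$ and entries $A_k^\gamma\alpha_{kj}A_j^{-\gamma}$ in rows $k=1,\dots,n$. On $X^{n+1}$ use the norm $|\|y\||=\max_{0\le k\le n}\|y_k\|$. For $u\in C([-1,1];X)$ let $E_n(u)=\inf_p\max_{t\in[-1,1]}\|u(t)-p(t)\|$, the infimum being over the polynomials $p$ of degree at most $n$ with coefficients in $X$. Then there are $\alpha_0>0$, $c>0$ and $N$ such that for all $|\alpha|\le\alpha_0$ and all $n\ge N$ the following holds. 1. Let $f\in C([-1,1];X)$ and let $v$ be a (classical or mild) solution of the two-point problem such that $A_0^\gamma v$ is defined and continuous on $[-1,1]$. If $x$ solves the discrete system and $\tilde z=(A_k^\gamma(v(t_k)-x_k))_{k=0}^n$, then $$|\|\tilde z\||\le c\,n^{\gamma-1}\ln n\;E_n(A_0^\gamma v).$$ 2. $S$ has a bounded inverse, and there is $q\ge0$ with $q\le c\,n^{\gamma-1}\ln n<1$ such that the following holds for all $\varphi$ in the domain of $A_0^\gamma$ and all $f\in C([-1,1];X)$. The system $Sy=By+\phi$ is equivalent to $y=S^{-1}By+S^{-1}\phi$. The discrete system has exactly one solution $x$, and $S\tilde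 x=B\tilde x+\phi$. For every $\tilde x^{(0)}\in X^{n+1}$ the fixed-point iteration $\tilde x^{(k+1)}=S^{-1}B\tilde x^{(k)}+S^{-1}\phi$ satisfies $|\|\tilde x^{(k)}-\tilde x\||\le q^k\,|\|\tilde x^{(0)}-\tilde x\||$ for $k=0,1,\dots$. -/

import Mathlib

open scoped Topology

namespace NonlocalCGL

noncomputable section

/-! ### Unbounded operators: resolvent, semigroup, fractional powers -/

section Operators

variable {X : Type*} [NormedAddCommGroup X] [NormedSpace ℂ X]

/-- The value of a partially defined operator, extended by `0` outside its domain. -/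
def ev (P : X →ₗ.[ℂ] X) (x : X) : X :=
  open Classical in if h : x ∈ P.domain then P ⟨x, h⟩ else 0

/-- `R` is a bounded two-sided inverse of `z I - A`. -/
def IsResolventAt (A : X →ₗ.[ℂ] X) (z : ℂ) (R : X →L[ℂ] X) : Prop :=
  (∀ x : X, ∃ h : R x ∈ A.domain, z • R x - A ⟨R x, h⟩ = x) ∧
  (∀ x : A.domain, R (z • (x : X) - A x) = x)

/-- The resolvent `(z I - A)⁻¹` (and `0` if `z` belongs to the spectrum of `A`). -/
def resolventOp (A : X →ₗ.[ℂ] X) (z : ℂ) : X →L[ℂ] X :=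
  open Classical in if h : ∃ R : X →L[ℂ] X, IsResolventAt A z R then h.choose else 0

/-- The operator exponential `e^{-sA}`: the identity for `s = 0`, and for `s > 0` the
Dunford-Cauchy integral `(2πi)⁻¹ ∫_Γ e^{-zs} (zI - A)⁻¹ dz`, where `Γ` is the boundary of the
sector `|arg z| ≤ θ`, running from `∞ e^{iθ}` through `0` to `∞ e^{-iθ}`. -/
def expNeg (A : X →ₗ.[ℂ] X) (θ s : ℝ) : X →L[ℂ] X :=
  if s = 0 then 1 else
    (2 * (Real.pi : ℂ) * Complex.I)⁻¹ •
      ((∫ r in Set.Ioi (0 : ℝ),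
          (Complex.exp (-((r : ℂ) * Complex.exp (-((θ : ℂ) * Complex.I))) * (s : ℂ)) *
            Complex.exp (-((θ : ℂ) * Complex.I))) •
              resolventOp A ((r : ℂ) * Complex.exp (-((θ : ℂ) * Complex.I)))) -
        ∫ r in Set.Ioi (0 : ℝ),
          (Complex.exp (-((r : ℂ) * Complex.exp ((θ : ℂ) * Complex.I)) * (s : ℂ)) *
            Complex.exp ((θ : ℂ) * Complex.I)) •
              resolventOp A ((r : ℂ) * Complex.exp ((θ : ℂ) * Complex.I)))

/-- The negative fractional power `A^{-γ} = Γ(γ)⁻¹ ∫₀^∞ s^{γ-1} e^{-sA} ds` for `γ > 0`, and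
`A^{-0} = I`. -/
def negPow (A : X →ₗ.[ℂ] X) (θ γ : ℝ) : X →L[ℂ] X :=
  if γ = 0 then 1 else
    ((Real.Gamma γ)⁻¹ : ℂ) •
      ∫ s in Set.Ioi (0 : ℝ), ((s ^ (γ - 1) : ℝ) : ℂ) • expNeg A θ s

/-- The fractional power `A^γ`, `γ ≥ 0`: the inverse of `A^{-γ}`, with domain the range of
`A^{-γ}`. -/
def fracPow (A : X →ₗ.[ℂ] X) (θ γ : ℝ) : X →ₗ.[ℂ] X :=
  (((negPow A θ γ : X →L[ℂ] X) : X →ₗ[ℂ] X).toPMap ⊤).inverse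

/-- The map `F`, viewed as an element of the algebra of bounded operators (`0` if `F` is not
bounded and linear). -/
def boundedOf (F : X → X) : X →L[ℂ] X :=
  open Classical in if h : ∃ R : X →L[ℂ] X, ∀ x, R x = F x then h.choose else 0

/-- The bounded operator `[A(t) - A(s)] A^{-γ}(t)` on `X`: the bounded extension of the operator
that is given by this expression where both `A(t)` and `A(s)` are defined. -/
def relDiff (A : ℝ → X →ₗ.[ℂ] X) (θ γ t s : ℝ) : X →L[ℂ] X :=
  open Classical in
  if h : ∃ D : X →L[ℂ] X, ∀ (x : X) (hx : negPow (A t) θ γ x ∈ (A t - A s).domain),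
      D x = (A t - A s) ⟨negPow (A t) θ γ x, hx⟩
    then h.choose else 0

/-- `[A(t) - A(s)] y` for `y` in the domain of `A^γ(t)`; on the common domain of the operators
`A(t)` and `A(s)` this is `A(t) y - A(s) y`. -/
def diffApply (A : ℝ → X →ₗ.[ℂ] X) (θ γ t s : ℝ) (y : X) : X :=
  relDiff A θ γ t s (ev (fracPow (A t) θ γ) y)

/-- The standing assumptions on the operators `A(t)`, `t ∈ [-1,1]`, with exponent `γ`. -/
structure Assumptions (A : ℝ → X →ₗ.[ℂ] X) (θ M ω L₁ L₂ γ : ℝ) : Prop where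
  closed : ∀ t ∈ Set.Icc (-1 : ℝ) 1, (A t).IsClosed
  dense : ∀ t ∈ Set.Icc (-1 : ℝ) 1, Dense ((A t).domain : Set X)
  domain_eq : ∀ t ∈ Set.Icc (-1 : ℝ) 1, (A t).domain = (A (-1)).domain
  angle_pos : 0 < θ
  angle_lt : θ < Real.pi / 2
  /-- strong positivity: resolvent estimate on the rays and outside the sector -/
  resolvent : ∀ t ∈ Set.Icc (-1 : ℝ) 1, ∀ z : ℂ, (z = 0 ∨ θ ≤ |z.arg|) →
    ∃ R : X →L[ℂ] X, IsResolventAt (A t) z R ∧ ‖R‖ ≤ M / (1 + ‖z‖)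
  rate_pos : 0 < ω
  /-- exponential decay of the semigroups -/
  decay : ∀ t ∈ Set.Icc (-1 : ℝ) 1, ∀ s : ℝ, 0 ≤ s →
    ‖expNeg (A t) θ s‖ ≤ Real.exp (-(ω * s))
  exponent_nonneg : 0 ≤ γ
  exponent_lt : γ < 1
  /-- `‖[A(t) - A(s)] A^{-γ}(t)‖ ≤ L₁ |t - s|` -/
  lipschitz_diff : ∀ t ∈ Set.Icc (-1 : ℝ) 1, ∀ s ∈ Set.Icc (-1 : ℝ) 1,
    ∀ (x : X) (hx : negPow (A t) θ γ x ∈ (A t - A s).domain),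
      ‖(A t - A s) ⟨negPow (A t) θ γ x, hx⟩‖ ≤ L₁ * |t - s| * ‖x‖
  /-- `A^γ(t) A^{-γ}(s)` is defined on all of `X` and `‖A^γ(t) A^{-γ}(s) - I‖ ≤ L₂ |t - s|` -/
  lipschitz_pow : ∀ t ∈ Set.Icc (-1 : ℝ) 1, ∀ s ∈ Set.Icc (-1 : ℝ) 1, ∀ x : X,
    ∃ hx : negPow (A s) θ γ x ∈ (fracPow (A t) θ γ).domain,
      ‖fracPow (A t) θ γ ⟨negPow (A s) θ γ x, hx⟩ - x‖ ≤ L₂ * |t - s| * ‖x‖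

end Operators

/-! ### The two-point problem -/

section Problem

variable {X : Type*} [NormedAddCommGroup X] [NormedSpace ℂ X]

/-- The differential equation `v'(t) + A(t) v(t) = f(t)` holds pointwise on `(-1,1)`. -/
def SatisfiesODE (A : ℝ → X →ₗ.[ℂ] X) (f v : ℝ → X) : Prop :=
  ∀ t ∈ Set.Ioo (-1 : ℝ) 1, ∃ h : v t ∈ (A t).domain, HasDerivAt v (f t - A t ⟨v t, h⟩) t

/-- The equation `v' + A(t) v = f`, i.e. `v' + A(-1) v = [A(-1) - A(t)] v + f`, in the mild
sense on `[-1,1]`. -/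
def SatisfiesMild (A : ℝ → X →ₗ.[ℂ] X) (θ γ : ℝ) (f v : ℝ → X) : Prop :=
  ∀ t ∈ Set.Icc (-1 : ℝ) 1,
    v t = expNeg (A (-1)) θ (t + 1) (v (-1)) +
      ∫ s in (-1 : ℝ)..t, expNeg (A (-1)) θ (t - s) (diffApply A θ γ (-1) s (v s) + f s)

/-- `v` is a (classical or mild) solution of `v' + A(t) v = f`, `v(-1) + α v(1) = φ`, for which
the function `A₀^γ v`, with `A₀ = A(-1)`, is defined and continuous on `[-1,1]`. -/
structure IsSolution (A : ℝ → X →ₗ.[ℂ] X) (θ γ α : ℝ) (φ : X) (f v : ℝ → X) : Prop where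
  mem_domain : ∀ t ∈ Set.Icc (-1 : ℝ) 1, v t ∈ (fracPow (A (-1)) θ γ).domain
  continuousOn : ContinuousOn (fun t => ev (fracPow (A (-1)) θ γ) (v t)) (Set.Icc (-1) 1)
  equation : SatisfiesODE A f v ∨ SatisfiesMild A θ γ f v
  two_point : v (-1) + (α : ℂ) • v 1 = φ

/-- The error `E_n(u)` of the best uniform approximation of `u` on `[-1,1]` by polynomials of
degree at most `n` with coefficients in `X`. -/
def bestApprox (n : ℕ) (u : ℝ → X) : ℝ :=
  ⨅ p : Fin (n + 1) → X, ⨆ t : Set.Icc (-1 : ℝ) 1,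
    ‖u t - ∑ i : Fin (n + 1), (((t : ℝ) ^ (i : ℕ) : ℝ) : ℂ) • p i‖

end Problem

/-! ### The discretization -/

section Discretization

variable {X : Type*} [NormedAddCommGroup X] [NormedSpace ℂ X]

/-- The Chebyshev-Gauss-Lobatto nodes `t_k = cos ((n - k) π / n)`, `k = 0, …, n`. -/
def node (n : ℕ) (k : Fin (n + 1)) : ℝ :=
  Real.cos (((n : ℝ) - (k : ℕ)) / n * Real.pi)

/-- The fundamental Lagrange polynomials `L_{j,n}` of the nodes. -/
def lagr (n : ℕ) (j : Fin (n + 1)) (s : ℝ) : ℝ :=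
  (Lagrange.basis Finset.univ (node n) j).eval s

/-- `α_{kj} y = ∫_{t_{k-1}}^{t_k} e^{-A_k (t_k - s)} [A_k - A(s)] L_{j,n}(s) y ds` for the index
`k = i + 1` and `y` in the domain of `A_k^γ`. -/
def coefAlpha (A : ℝ → X →ₗ.[ℂ] X) (θ γ : ℝ) (n : ℕ) (i : Fin n) (j : Fin (n + 1)) (y : X) : X :=
  ∫ s in (node n i.castSucc)..(node n i.succ),
    (lagr n j s : ℂ) • expNeg (A (node n i.succ)) θ (node n i.succ - s)
      (diffApply A θ γ (node n i.succ) s y)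

/-- `φ_k = ∫_{t_{k-1}}^{t_k} e^{-A_k (t_k - s)} f(s) ds` for `k = i + 1`. -/
def coefPhi (A : ℝ → X →ₗ.[ℂ] X) (θ : ℝ) (n : ℕ) (f : ℝ → X) (i : Fin n) : X :=
  ∫ s in (node n i.castSucc)..(node n i.succ),
    expNeg (A (node n i.succ)) θ (node n i.succ - s) (f s)

/-- `x = (x_0, …, x_n)` solves the discrete system
`x_0 + α x_n = φ`, `x_k = e^{-A_k τ_k} x_{k-1} + ∑_j α_{kj} x_j + φ_k`, `k = 1, …, n`. -/
structure IsDiscreteSolution (A : ℝ → X →ₗ.[ℂ] X) (θ γ α : ℝ) (n : ℕ) (φ : X) (f : ℝ → X)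
    (x : Fin (n + 1) → X) : Prop where
  mem_domain : ∀ k, x k ∈ (fracPow (A (node n k)) θ γ).domain
  two_point : x 0 + (α : ℂ) • x (Fin.last n) = φ
  step : ∀ i : Fin n,
    x i.succ = expNeg (A (node n i.succ)) θ (node n i.succ - node n i.castSucc) (x i.castSucc) +
      ∑ j, coefAlpha A θ γ n i j (x j) + coefPhi A θ n f i

/-- The weighted vector `(A_0^γ x_0, …, A_n^γ x_n)`. Its norm as an element of
`Fin (n + 1) → X` is the maximum norm. -/
def weighted (A : ℝ → X →ₗ.[ℂ] X) (θ γ : ℝ) (n : ℕ) (x : Fin (n + 1) → X) : Fin (n + 1) → X :=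
  fun k => ev (fracPow (A (node n k)) θ γ) (x k)

/-- The bounded operator on `X^{n+1}` with block matrix `a`. -/
def blockOp {n : ℕ} (a : Fin (n + 1) → Fin (n + 1) → X →L[ℂ] X) :
    (Fin (n + 1) → X) →L[ℂ] (Fin (n + 1) → X) :=
  ContinuousLinearMap.pi fun k => ∑ j, (a k j).comp (ContinuousLinearMap.proj j)

/-- `σ_0 = A_0^γ A_n^{-γ}`. -/
def sigmaZero (A : ℝ → X →ₗ.[ℂ] X) (θ γ : ℝ) (n : ℕ) : X →L[ℂ] X :=
  boundedOf fun x => ev (fracPow (A (node n 0)) θ γ) (negPow (A (node n (Fin.last n))) θ γ x)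

/-- `σ_k = e^{-A_k τ_k} A_k^γ A_{k-1}^{-γ}` for `k = i + 1`. -/
def sigma (A : ℝ → X →ₗ.[ℂ] X) (θ γ : ℝ) (n : ℕ) (i : Fin n) : X →L[ℂ] X :=
  (expNeg (A (node n i.succ)) θ (node n i.succ - node n i.castSucc)).comp
    (boundedOf fun x =>
      ev (fracPow (A (node n i.succ)) θ γ) (negPow (A (node n i.castSucc)) θ γ x))

/-- The block matrix `S`: unit diagonal, `-σ_k` below the diagonal, and `α σ_0` in the upper right
corner. -/
def matS (A : ℝ → X →ₗ.[ℂ] X) (θ γ α : ℝ) (n : ℕ) :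
    (Fin (n + 1) → X) →L[ℂ] (Fin (n + 1) → X) :=
  blockOp (Fin.cases
    (fun j => (if j = 0 then 1 else 0) +
      (if j = Fin.last n then (α : ℂ) • sigmaZero A θ γ n else 0))
    (fun i j => (if j = i.succ then 1 else 0) - (if j = i.castSucc then sigma A θ γ n i else 0)))

/-- The block matrix `B` with zero first row and entries `A_k^γ α_{kj} A_j^{-γ}` for
`k = 1, …, n`. -/
def matB (A : ℝ → X →ₗ.[ℂ] X) (θ γ : ℝ) (n : ℕ) :
    (Fin (n + 1) → X) →L[ℂ] (Fin (n + 1) → X) :=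
  blockOp (Fin.cases (fun _ => 0)
    (fun i j => boundedOf fun x =>
      ev (fracPow (A (node n i.succ)) θ γ)
        (coefAlpha A θ γ n i j (negPow (A (node n j)) θ γ x))))

/-- The right-hand side `(A_0^γ φ, A_1^γ φ_1, …, A_n^γ φ_n)`. -/
def rhs (A : ℝ → X →ₗ.[ℂ] X) (θ γ : ℝ) (n : ℕ) (φ : X) (f : ℝ → X) : Fin (n + 1) → X :=
  weighted A θ γ n (Fin.cases φ (fun i => coefPhi A θ n f i))

end Discretization

end

end NonlocalCGL

/-!
The semigroups `e^{-rA}` are contour integrals of the resolvent over the boundary of a sector, and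
so are the operators `A e^{-rA}`, whence `‖A e^{-rA}‖ ≤ C / r`. Cauchy's theorem, proved in the
coordinate `log z` in which the region outside the sector is a strip (`contourInt_eq_zero`),
evaluates the integral of `(1 + z)⁻¹ (zI - A)⁻¹`; this gives strong continuity at `0`, and the
semigroup law follows since `e^{-(t-s)A} e^{-sA}` has derivative `0` in `s`. The representation
`A^γ e^{-rA} = Γ(1-γ)⁻¹ ∫₀^∞ u^{-γ} A e^{-(r+u)A} du` then yields `‖A^γ e^{-rA}‖ ≤ C r^{-γ}`
(`IsSectorial.norm_fracExp_le`), and Euler's Beta integral shows that `A^{-γ}` maps this operator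
to `e^{-rA}` (`IsSectorial.negPow_mul_fracExp`).

A classical or mild solution `v` satisfies on each step `[a, b] = [t_{k-1}, t_k]` the variation of
constants formula in which the operator is frozen at the right endpoint
(`Assumptions.mild_frozen`). For classical solutions the semigroup is differentiated along `v`; mild
solutions are first smoothed by `e^{-εA(-1)}`, which makes them right differentiable, and then
`ε → 0`. Since the discrete system is the same formula with `A_0^γ v` replaced by its interpolation
polynomial, the vector `z` with the entries `A_k^γ (v(t_k) - x_k)` satisfies `S z = B z + ψ`, where
`ψ` involves only the interpolation error (`Assumptions.exists_residual`).

Three bounds of different origin combine. The Lebesgue constant of the Chebyshev-Gauss-Lobatto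
nodes is `O(ln n)` (`sum_abs_lagr_le`), by comparison with Dirichlet kernels. In the integrals
defining `B` and `ψ` the Lipschitz factor `b - s` of `A(b) - A(s)` weakens the kernel `(b - s)^{-γ}`
to `(b - s)^{1-γ}`, so that one step, of length at most `π / n`, contributes `O(n^{γ-2})`
(`Assumptions.norm_frozenConv_step_le`). Finally `‖S⁻¹‖ = O(n)` by a discrete Gronwall
argument (`Assumptions.norm_le_matS`), where `α` is so small that the corner entry `α σ_0`
can be absorbed. Hence `‖S⁻¹ B‖` and `‖S⁻¹ ψ‖ / E_n(A_0^γ v)` are `O(n^{γ-1} ln n)`, and this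
tends to `0` because `γ < 1`. All assertions follow from the contraction property of `S⁻¹ B`.
-/

namespace NonlocalCGL

/-! ### The Lebesgue constant of the Chebyshev-Gauss-Lobatto nodes -/

/-- The angle `(n - k) π / n` whose cosine is the `k`-th Chebyshev-Gauss-Lobatto node. -/
noncomputable def nodeAngle (n : ℕ) (k : Fin (n + 1)) : ℝ :=
  ((n : ℝ) - (k : ℕ)) / n * Real.pi

lemma node_eq_cos (n : ℕ) (k : Fin (n + 1)) : node n k = Real.cos (nodeAngle n k) := rfl

lemma nodeAngle_nonneg (n : ℕ) (k : Fin (n + 1)) : 0 ≤ nodeAngle n k := by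
  have : ((k : ℕ) : ℝ) ≤ n := by exact_mod_cast Nat.lt_succ_iff.mp k.2
  unfold nodeAngle
  have := sub_nonneg.2 this
  positivity

lemma nodeAngle_le_pi (n : ℕ) (k : Fin (n + 1)) : nodeAngle n k ≤ Real.pi := by
  unfold nodeAngle
  have : ((n : ℝ) - (k : ℕ)) / n ≤ 1 := by
    apply div_le_one_of_le₀ _ (by positivity)
    have : (0 : ℝ) ≤ (k : ℕ) := by positivity
    linarith
  nlinarith [Real.pi_pos]

lemma node_zero {n : ℕ} (hn : 0 < n) : node n 0 = -1 := by
  have : (n : ℝ) ≠ 0 := by positivity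
  simp [node, this]

lemma node_last (n : ℕ) : node n (Fin.last n) = 1 := by
  simp [node]

lemma node_mem (n : ℕ) (k : Fin (n + 1)) : node n k ∈ Set.Icc (-1 : ℝ) 1 :=
  Real.cos_mem_Icc _

lemma node_strictMono {n : ℕ} (hn : 0 < n) : StrictMono (node n) := by
  intro i j hij
  apply Real.strictAntiOn_cos ⟨nodeAngle_nonneg n j, nodeAngle_le_pi n j⟩
    ⟨nodeAngle_nonneg n i, nodeAngle_le_pi n i⟩
  have h : ((i : ℕ) : ℝ) < (j : ℕ) := by exact_mod_cast hij
  have : (0 : ℝ) < n := by exact_mod_cast hn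
  have := Real.pi_pos
  change ((n : ℝ) - (j : ℕ)) / n * Real.pi < ((n : ℝ) - (i : ℕ)) / n * Real.pi
  gcongr

lemma node_step_le {n : ℕ} (hn : 0 < n) (i : Fin n) :
    node n i.succ - node n i.castSucc ≤ Real.pi / n := by
  have h0 : (0 : ℝ) < n := by exact_mod_cast hn
  refine (le_abs_self _).trans ((Real.abs_cos_sub_cos_le _ _).trans (le_of_eq ?_))
  have : ((n : ℝ) - ((i.succ : Fin (n + 1)) : ℕ)) / n * Real.pi
      - ((n : ℝ) - ((i.castSucc : Fin (n + 1)) : ℕ)) / n * Real.pi = -(Real.pi / n) := by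
    simp; field_simp; ring
  rw [this, abs_neg, abs_of_pos (by positivity)]

/-- The modified Dirichlet kernel `1/2 + cos u + … + cos ((n-1) u) + cos (n u) / 2`. -/
noncomputable def dirichletKernel (n : ℕ) (u : ℝ) : ℝ :=
  ∑ m ∈ Finset.range n, (Real.cos (m * u) + Real.cos ((m + 1 : ℕ) * u)) / 2

lemma abs_dirichletKernel_le (n : ℕ) (u : ℝ) : |dirichletKernel n u| ≤ n := by
  refine (Finset.abs_sum_le_sum_abs _ _).trans ?_
  calc _ ≤ ∑ m ∈ Finset.range n, (1 : ℝ) := by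
        refine Finset.sum_le_sum fun m _ => abs_le.2 ⟨?_, ?_⟩
        · linarith [Real.neg_one_le_cos (m * u), Real.neg_one_le_cos ((m + 1 : ℕ) * u)]
        · linarith [Real.cos_le_one (m * u), Real.cos_le_one ((m + 1 : ℕ) * u)]
    _ = n := by simp

lemma dirichletKernel_mul_sin (n : ℕ) (u : ℝ) :
    dirichletKernel n u * Real.sin (u / 2) = Real.cos (u / 2) * Real.sin (n * u) / 2 := by
  induction n with
  | zero => simp [dirichletKernel]
  | succ n ih =>
    have e : dirichletKernel (n + 1) u = dirichletKernel n u +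
        (Real.cos (n * u) + Real.cos ((n + 1 : ℕ) * u)) / 2 := by
      simp [dirichletKernel, Finset.sum_range_succ]
    rw [e, add_mul, ih]
    have h1 : (n : ℝ) * u = (n * u + u / 2) - u / 2 := by ring
    have h2 : ((n + 1 : ℕ) : ℝ) * u = (n * u + u / 2) + u / 2 := by push_cast; ring
    rw [h2]
    generalize (n : ℝ) * u + u / 2 = a at *
    rw [h1, Real.cos_sub, Real.cos_add, Real.sin_sub, Real.sin_add]
    ring

lemma dirichletKernel_zero (n : ℕ) : dirichletKernel n 0 = n := by
  simp [dirichletKernel]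

/-- A positive multiple of the fundamental polynomial of the node `cos ψ`: by the discrete
orthogonality of the Chebyshev polynomials it is a sum of two Dirichlet kernels. -/
noncomputable def lobattoPoly (n : ℕ) (ψ : ℝ) : Polynomial ℝ :=
  ∑ m ∈ Finset.range n,
    (Polynomial.C (Real.cos (m * ψ)) * Polynomial.Chebyshev.T ℝ m +
      Polynomial.C (Real.cos ((m + 1 : ℕ) * ψ)) * Polynomial.Chebyshev.T ℝ (m + 1 : ℕ))

lemma eval_lobattoPoly (n : ℕ) (ψ φ : ℝ) :
    (lobattoPoly n ψ).eval (Real.cos φ) =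
      dirichletKernel n (φ - ψ) + dirichletKernel n (φ + ψ) := by
  rw [lobattoPoly, Polynomial.eval_finsetSum, dirichletKernel, dirichletKernel,
    ← Finset.sum_add_distrib]
  refine Finset.sum_congr rfl fun m _ => ?_
  simp only [Polynomial.eval_add, Polynomial.eval_mul, Polynomial.eval_C,
    Polynomial.Chebyshev.T_real_cos, mul_sub, mul_add, Real.cos_sub, Real.cos_add]
  push_cast
  ring

lemma degree_lobattoPoly_lt (n : ℕ) (ψ : ℝ) : (lobattoPoly n ψ).degree < (n + 1 : ℕ) := by
  refine (Polynomial.degree_sum_le _ _).trans_lt ?_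
  rw [Finset.sup_lt_iff (WithBot.bot_lt_coe _)]
  intro m hm
  have hm := Finset.mem_range.1 hm
  refine (Polynomial.degree_add_le _ _).trans_lt (max_lt ?_ ?_)
  · refine lt_of_le_of_lt (Polynomial.degree_mul_le _ _)
      ((add_le_add Polynomial.degree_C_le le_rfl).trans_lt ?_)
    rw [Polynomial.Chebyshev.degree_T, zero_add]
    exact_mod_cast (by omega)
  · refine lt_of_le_of_lt (Polynomial.degree_mul_le _ _)
      ((add_le_add Polynomial.degree_C_le le_rfl).trans_lt ?_)
    rw [Polynomial.Chebyshev.degree_T, zero_add]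
    exact_mod_cast (by omega)

lemma sin_mul_nodeAngle {n : ℕ} (hn : 0 < n) (k : Fin (n + 1)) :
    Real.sin (n * nodeAngle n k) = 0 := by
  have h0 : (n : ℝ) ≠ 0 := by positivity
  have : (n : ℝ) * nodeAngle n k = ((n - k : ℕ) : ℝ) * Real.pi := by
    rw [Nat.cast_sub (Nat.lt_succ_iff.mp k.2)]; unfold nodeAngle; field_simp
  rw [this, Real.sin_nat_mul_pi]

lemma sin_half_add_sq_sub (a b : ℝ) :
    Real.sin ((a + b) / 2) ^ 2 - Real.sin ((a - b) / 2) ^ 2 = Real.sin a * Real.sin b := by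
  have ha : a = (a + b) / 2 + (a - b) / 2 := by ring
  have hb : b = (a + b) / 2 - (a - b) / 2 := by ring
  generalize (a + b) / 2 = x at *
  generalize (a - b) / 2 = y at *
  rw [ha, hb, Real.sin_add, Real.sin_sub]
  nlinarith [Real.sin_sq_add_cos_sq x, Real.sin_sq_add_cos_sq y]

/-- Decay in `a - b` of the kernel at `a - b` hence gives the same decay at `a + b`. -/
lemma abs_sin_half_sub_le {a b : ℝ} (ha : a ∈ Set.Icc 0 Real.pi) (hb : b ∈ Set.Icc 0 Real.pi) :
    |Real.sin ((a - b) / 2)| ≤ |Real.sin ((a + b) / 2)| := by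
  apply sq_le_sq.1
  have := sin_half_add_sq_sub a b
  have := mul_nonneg (Real.sin_nonneg_of_mem_Icc ha) (Real.sin_nonneg_of_mem_Icc hb)
  linarith

lemma abs_le_pi_mul_abs_sin_half {u : ℝ} (h : |u| ≤ Real.pi) :
    |u| ≤ Real.pi * |Real.sin (u / 2)| := by
  wlog h0 : 0 ≤ u generalizing u
  · have := this (u := -u) (by rwa [abs_neg]) (by linarith)
    rwa [abs_neg, neg_div, Real.sin_neg, abs_neg] at this
  rw [abs_of_nonneg h0] at *
  have := Real.mul_le_sin (x := u / 2) (by linarith) (by linarith)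
  have hp := Real.pi_pos
  rw [abs_of_nonneg (le_trans (by positivity) this)]
  calc u = Real.pi * (2 / Real.pi * (u / 2)) := by field_simp
    _ ≤ _ := by gcongr

/-- Decay of the kernel, in a form that does not divide by the distance. -/
lemma abs_dirichletKernel_mul_le {u d : ℝ} (n : ℕ) (h : d ≤ Real.pi * |Real.sin (u / 2)|) :
    |dirichletKernel n u| * d ≤ Real.pi / 2 := by
  calc |dirichletKernel n u| * d ≤ |dirichletKernel n u| * (Real.pi * |Real.sin (u / 2)|) := by
        gcongr
    _ = Real.pi * |dirichletKernel n u * Real.sin (u / 2)| := by rw [abs_mul]; ring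
    _ = Real.pi / 2 * (|Real.cos (u / 2)| * |Real.sin (n * u)|) := by
        rw [dirichletKernel_mul_sin, abs_div, abs_mul, abs_two]; ring
    _ ≤ Real.pi / 2 * (1 * 1) := by
        have := Real.pi_pos
        gcongr
        · exact Real.abs_cos_le_one _
        · exact Real.abs_sin_le_one _
    _ = _ := by ring

lemma dirichletKernel_eq_zero {n : ℕ} {u : ℝ} (h : Real.sin (n * u) = 0)
    (h' : Real.sin (u / 2) ≠ 0) : dirichletKernel n u = 0 := by
  have := dirichletKernel_mul_sin n u
  rw [h] at this
  simpa [h'] using this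

/-- The value is `2n` at the two endpoints and `n` at the interior nodes; the lower bound is all that
the estimate of the Lagrange polynomials uses. -/
lemma eval_lobattoPoly_self {n : ℕ} (hn : 0 < n) (k : Fin (n + 1)) :
    (n : ℝ) ≤ (lobattoPoly n (nodeAngle n k)).eval (node n k) := by
  rw [node_eq_cos, eval_lobattoPoly, sub_self, dirichletKernel_zero]
  suffices 0 ≤ dirichletKernel n (nodeAngle n k + nodeAngle n k) by linarith
  rw [← two_mul]
  by_cases h : Real.sin (nodeAngle n k) = 0
  · refine Finset.sum_nonneg fun m _ => ?_
    have h1 : Real.cos (nodeAngle n k) ^ 2 = 1 := by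
      have := Real.sin_sq_add_cos_sq (nodeAngle n k); rw [h] at this; linarith
    have h2 : Real.cos (2 * nodeAngle n k) = 1 := by rw [Real.cos_two_mul]; linarith
    obtain ⟨l, hl⟩ := (Real.cos_eq_one_iff _).1 h2
    have h3 : ∀ m : ℕ, Real.cos (m * (2 * nodeAngle n k)) = 1 := fun m => by
      rw [← hl, Real.cos_eq_one_iff]
      exact ⟨m * l, by push_cast; ring⟩
    rw [h3, h3]; norm_num
  · refine (dirichletKernel_eq_zero ?_ ?_).ge
    · rw [mul_left_comm, Real.sin_two_mul, sin_mul_nodeAngle hn]; ring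
    · rwa [mul_div_cancel_left₀ _ two_ne_zero]

lemma eval_lobattoPoly_of_ne {n : ℕ} (hn : 0 < n) {k j : Fin (n + 1)} (hkj : k ≠ j) :
    (lobattoPoly n (nodeAngle n k)).eval (node n j) = 0 := by
  have hne : nodeAngle n j ≠ nodeAngle n k := fun h =>
    hkj ((node_strictMono hn).injective (by rw [node_eq_cos, node_eq_cos, h]))
  have h1 : Real.sin ((nodeAngle n j - nodeAngle n k) / 2) ≠ 0 := by
    have hj := nodeAngle_nonneg n j
    have hj' := nodeAngle_le_pi n j
    have hk := nodeAngle_nonneg n k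
    have hk' := nodeAngle_le_pi n k
    intro h
    have := abs_le_pi_mul_abs_sin_half (u := nodeAngle n j - nodeAngle n k)
      (abs_le.2 ⟨by linarith, by linarith⟩)
    rw [h] at this
    simp only [abs_zero, mul_zero, abs_nonpos_iff, sub_eq_zero] at this
    exact hne this
  have h2 : Real.sin ((nodeAngle n j + nodeAngle n k) / 2) ≠ 0 := by
    have := abs_sin_half_sub_le ⟨nodeAngle_nonneg n j, nodeAngle_le_pi n j⟩
      ⟨nodeAngle_nonneg n k, nodeAngle_le_pi n k⟩
    exact abs_pos.1 ((abs_pos.2 h1).trans_le this)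
  rw [node_eq_cos, eval_lobattoPoly, dirichletKernel_eq_zero _ h1, dirichletKernel_eq_zero _ h2,
    add_zero]
  · rw [mul_add, Real.sin_add, sin_mul_nodeAngle hn, sin_mul_nodeAngle hn]; ring
  · rw [mul_sub, Real.sin_sub, sin_mul_nodeAngle hn, sin_mul_nodeAngle hn]; ring

lemma node_injOn {n : ℕ} (hn : 0 < n) (s : Set (Fin (n + 1))) : Set.InjOn (node n) s :=
  (node_strictMono hn).injective.injOn

lemma lobattoPoly_eq {n : ℕ} (hn : 0 < n) (j : Fin (n + 1)) (s : ℝ) :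
    (lobattoPoly n (nodeAngle n j)).eval s =
      (lobattoPoly n (nodeAngle n j)).eval (node n j) * lagr n j s := by
  have key := Lagrange.eq_interpolate_of_eval_eq (s := Finset.univ) (v := node n)
    (fun i => (lobattoPoly n (nodeAngle n j)).eval (node n i)) (node_injOn hn _)
    (f := lobattoPoly n (nodeAngle n j))
    (by simpa using degree_lobattoPoly_lt n (nodeAngle n j)) (fun i _ => rfl)
  conv_lhs => rw [key]
  rw [Lagrange.interpolate_apply, Polynomial.eval_finsetSum, Finset.sum_eq_single j]
  · simp [lagr]
  · intro i _ hi
    simp [eval_lobattoPoly_of_ne hn hi.symm]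
  · simp

/-- The Lagrange polynomials of the nodes are bounded by `2` and decay like the inverse distance
between the angles, measured in units of the angular mesh size `π / n`. -/
lemma abs_lagr_cos_le {n : ℕ} (hn : 0 < n) (j : Fin (n + 1)) {φ : ℝ}
    (hφ : φ ∈ Set.Icc 0 Real.pi) :
    |lagr n j (Real.cos φ)| ≤ 2 ∧
      |lagr n j (Real.cos φ)| * (n * |φ - nodeAngle n j|) ≤ Real.pi := by
  have h0 : (0 : ℝ) < n := by exact_mod_cast hn
  have hj : nodeAngle n j ∈ Set.Icc 0 Real.pi := ⟨nodeAngle_nonneg n j, nodeAngle_le_pi n j⟩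
  have hn' := eval_lobattoPoly_self hn j
  have key : n * |lagr n j (Real.cos φ)| ≤
      |dirichletKernel n (φ - nodeAngle n j)| + |dirichletKernel n (φ + nodeAngle n j)| := by
    calc n * |lagr n j (Real.cos φ)|
        ≤ (lobattoPoly n (nodeAngle n j)).eval (node n j) * |lagr n j (Real.cos φ)| := by gcongr
      _ = |(lobattoPoly n (nodeAngle n j)).eval (Real.cos φ)| := by
        rw [lobattoPoly_eq hn j (Real.cos φ), abs_mul, abs_of_nonneg (h0.le.trans hn')]
      _ ≤ _ := by rw [eval_lobattoPoly]; exact abs_add_le _ _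
  constructor
  · have h1 := abs_dirichletKernel_le n (φ - nodeAngle n j)
    have h2 := abs_dirichletKernel_le n (φ + nodeAngle n j)
    have : n * |lagr n j (Real.cos φ)| ≤ n * 2 := by linarith
    exact le_of_mul_le_mul_left this h0
  · have hs : |φ - nodeAngle n j| ≤ Real.pi * |Real.sin ((φ - nodeAngle n j) / 2)| :=
      abs_le_pi_mul_abs_sin_half
        (abs_le.2 ⟨by linarith [hφ.1, hj.2], by linarith [hφ.2, hj.1]⟩)
    have h1 := abs_dirichletKernel_mul_le n hs
    have h2 := abs_dirichletKernel_mul_le (u := φ + nodeAngle n j) n (hs.trans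
      (mul_le_mul_of_nonneg_left (abs_sin_half_sub_le hφ hj) Real.pi_pos.le))
    nlinarith [mul_le_mul_of_nonneg_right key (abs_nonneg (φ - nodeAngle n j))]

/-- Summing `min 2 (1 / |y - i|)` over the integers `0 ≤ i ≤ n` gives at most a harmonic sum on
each side of `y`. -/
lemma sum_le_of_inverse_distance {n : ℕ} (f : ℕ → ℝ) {y : ℝ} (hy0 : 0 ≤ y) (hyn : y ≤ n)
    (hf : ∀ i, i ≤ n → f i ≤ 2) (hf' : ∀ i, i ≤ n → f i * |y - i| ≤ 1)
    (hf0 : ∀ i, i ≤ n → 0 ≤ f i) :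
    ∑ i ∈ Finset.range (n + 1), f i ≤ 6 + 2 * Real.log n := by
  set g : ℕ → ℝ := fun m => if m = 0 then 2 else (m : ℝ)⁻¹ with hg
  have hg0 : ∀ m, 0 ≤ g m := fun m => by simp only [hg]; split_ifs <;> positivity
  have hfg : ∀ i m : ℕ, i ≤ n → (m : ℝ) ≤ |y - i| → f i ≤ g m := by
    intro i m hi hm
    simp only [hg]
    split_ifs with h
    · exact hf i hi
    · have hm0 : (0 : ℝ) < m := by positivity
      rw [← one_div, le_div_iff₀ hm0]
      exact (mul_le_mul_of_nonneg_left hm (hf0 i hi)).trans (hf' i hi)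
  have hG : ∑ m ∈ Finset.range (n + 1), g m ≤ 3 + Real.log n := by
    rw [Finset.sum_range_succ']
    have : ∑ k ∈ Finset.range n, g (k + 1) = (harmonic n : ℝ) := by
      simp [hg, harmonic]
    rw [this]
    have := harmonic_le_one_add_log n
    simp only [hg, if_true]
    linarith
  set p := ⌊y⌋₊
  have hp : (p : ℝ) ≤ y := Nat.floor_le hy0
  have hp' : y < p + 1 := Nat.lt_floor_add_one y
  have hpn : p ≤ n := by exact_mod_cast hp.trans hyn
  rw [← Finset.sum_range_add_sum_Ico f (show p + 1 ≤ n + 1 by omega)]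
  have h1 : ∑ i ∈ Finset.range (p + 1), f i ≤ ∑ m ∈ Finset.range (n + 1), g m := by
    rw [← Finset.sum_range_reflect]
    calc _ ≤ ∑ m ∈ Finset.range (p + 1), g m := by
          refine Finset.sum_le_sum fun m hm => hfg _ _ (by omega) ?_
          have hm' : m ≤ p := by simpa [Nat.lt_succ_iff] using hm
          rw [show p + 1 - 1 - m = p - m by omega, Nat.cast_sub hm']
          exact le_trans (by linarith) (le_abs_self _)
      _ ≤ _ := Finset.sum_le_sum_of_subset_of_nonneg
        (Finset.range_subset_range.2 (by omega)) fun _ _ _ => hg0 _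
  have h2 : ∑ i ∈ Finset.Ico (p + 1) (n + 1), f i ≤ ∑ m ∈ Finset.range (n + 1), g m := by
    rw [Finset.sum_Ico_eq_sum_range]
    calc _ ≤ ∑ m ∈ Finset.range (n + 1 - (p + 1)), g m := by
          refine Finset.sum_le_sum fun m hm => hfg _ _ ?_ ?_
          · have := Finset.mem_range.1 hm; omega
          · push_cast
            rw [abs_sub_comm]
            exact le_trans (by linarith) (le_abs_self _)
      _ ≤ _ := Finset.sum_le_sum_of_subset_of_nonneg
        (Finset.range_subset_range.2 (by omega)) fun _ _ _ => hg0 _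
  linarith

lemma one_le_log {n : ℕ} (hn : 3 ≤ n) : 1 ≤ Real.log n := by
  have h3 : (3 : ℝ) ≤ n := by exact_mod_cast hn
  rw [Real.le_log_iff_exp_le (by linarith)]
  have := Real.exp_one_lt_d9
  linarith

/-- The Lebesgue constant of the Chebyshev-Gauss-Lobatto nodes grows at most logarithmically. -/
theorem sum_abs_lagr_le {n : ℕ} (hn : 3 ≤ n) {s : ℝ} (hs : s ∈ Set.Icc (-1 : ℝ) 1) :
    ∑ j, |lagr n j s| ≤ 8 * Real.log n := by
  have hn0 : 0 < n := by omega
  have h0 : (0 : ℝ) < n := by exact_mod_cast hn0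
  set φ := Real.arccos s
  have hφ : φ ∈ Set.Icc 0 Real.pi := ⟨Real.arccos_nonneg s, Real.arccos_le_pi s⟩
  have hsφ : s = Real.cos φ := (Real.cos_arccos hs.1 hs.2).symm
  set y := n * (1 - φ / Real.pi) with hy
  have hq0 : 0 ≤ φ / Real.pi := div_nonneg hφ.1 Real.pi_pos.le
  have hq1 : φ / Real.pi ≤ 1 := div_le_one_of_le₀ hφ.2 Real.pi_pos.le
  set f : ℕ → ℝ := fun i => if h : i < n + 1 then |lagr n ⟨i, h⟩ s| else 0 with hf
  have hsum : ∑ j, |lagr n j s| = ∑ i ∈ Finset.range (n + 1), f i := by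
    rw [← Fin.sum_univ_eq_sum_range]
    refine Finset.sum_congr rfl fun j _ => ?_
    simp only [hf, j.2, dif_pos]
  rw [hsum]
  have := sum_le_of_inverse_distance (n := n) f (y := y) (mul_nonneg h0.le (by linarith))
    (by nlinarith) ?_ ?_ ?_
  · linarith [one_le_log hn]
  · intro i hi
    have hi' : i < n + 1 := by omega
    simp only [hf, hi', dif_pos, hsφ]
    exact (abs_lagr_cos_le hn0 _ hφ).1
  · intro i hi
    have hi' : i < n + 1 := by omega
    simp only [hf, hi', dif_pos]
    have h2 := (abs_lagr_cos_le hn0 ⟨i, hi'⟩ hφ).2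
    rw [← hsφ] at h2
    have e : Real.pi * |y - i| = n * |φ - nodeAngle n ⟨i, hi'⟩| := by
      have h1 : Real.pi * |y - i| = |Real.pi * (y - i)| := by
        rw [abs_mul, abs_of_pos Real.pi_pos]
      have h2 : n * |φ - nodeAngle n ⟨i, hi'⟩| = |n * (φ - nodeAngle n ⟨i, hi'⟩)| := by
        rw [abs_mul, abs_of_pos h0]
      rw [h1, h2, ← abs_neg]
      congr 1
      have := Real.pi_pos.ne'
      simp only [hy, nodeAngle]
      field_simp
      ring
    have hp := Real.pi_pos
    rw [← e] at h2
    nlinarith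
  · intro i hi
    simp only [hf]
    split_ifs <;> positivity

/-- Lagrange interpolation reproduces the polynomials of degree at most `n` with vector
coefficients. -/
lemma sum_lagr_smul_eq {X : Type*} [NormedAddCommGroup X] [NormedSpace ℂ X] {n : ℕ} (hn : 0 < n)
    (p : Fin (n + 1) → X) (s : ℝ) :
    ∑ j, (lagr n j s : ℂ) • ∑ i : Fin (n + 1), (((node n j) ^ (i : ℕ) : ℝ) : ℂ) • p i =
      ∑ i : Fin (n + 1), ((s ^ (i : ℕ) : ℝ) : ℂ) • p i := by
  simp_rw [Finset.smul_sum]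
  rw [Finset.sum_comm]
  refine Finset.sum_congr rfl fun i _ => ?_
  simp_rw [smul_smul, ← Finset.sum_smul, ← Complex.ofReal_mul, ← Complex.ofReal_sum]
  congr 2
  have key := Lagrange.eq_interpolate_of_eval_eq (s := Finset.univ) (v := node n)
    (fun j => node n j ^ (i : ℕ)) (node_injOn hn _)
    (f := Polynomial.X ^ (i : ℕ))
    (by rw [Polynomial.degree_X_pow]; simp; exact_mod_cast i.2) (fun j _ => by simp)
  have := congrArg (Polynomial.eval s) key
  rw [Lagrange.interpolate_apply, Polynomial.eval_finsetSum] at this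
  simp only [Polynomial.eval_pow, Polynomial.eval_X, Polynomial.eval_mul, Polynomial.eval_C]
    at this
  rw [this]
  exact Finset.sum_congr rfl fun j _ => mul_comm _ _

lemma continuous_lagr (n : ℕ) (j : Fin (n + 1)) : Continuous (lagr n j) :=
  Polynomial.continuous _

open MeasureTheory Set Filter

/-! ### Integrals along the boundary of a sector -/

section Contour

variable {E : Type*} [NormedAddCommGroup E] [NormedSpace ℂ E]

/-- The closed complement of the sector `|arg z| < θ`, together with the vertex. -/
def sectorCompl (θ : ℝ) : Set ℂ := {z | z = 0 ∨ θ ≤ |z.arg|}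

/-- `e` is the direction of one of the two rays that bound the sector. -/
def IsRay (θ : ℝ) (e : ℂ) : Prop :=
  e = Complex.exp (-((θ : ℂ) * Complex.I)) ∨ e = Complex.exp ((θ : ℂ) * Complex.I)

/-- The integral of `F` along the ray from `0` to `∞` in the direction `e`. -/
noncomputable def rayInt (e : ℂ) (F : ℂ → E) : E := ∫ r in Ioi (0 : ℝ), e • F ((r : ℂ) * e)

/-- The integral of `F` along the boundary of the sector, from `∞ e^{iθ}` through `0` to
`∞ e^{-iθ}`. -/
noncomputable def contourInt (θ : ℝ) (F : ℂ → E) : E :=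
  rayInt (Complex.exp (-((θ : ℂ) * Complex.I))) F - rayInt (Complex.exp ((θ : ℂ) * Complex.I)) F

/-- Integrability along both boundary rays. -/
def RaysIntegrable (θ : ℝ) (F : ℂ → E) : Prop :=
  ∀ e, IsRay θ e → IntegrableOn (fun r : ℝ => F ((r : ℂ) * e)) (Ioi 0)

/-- The boundary of the sector: the two closed rays. -/
def boundaryRays (θ : ℝ) : Set ℂ := {z | ∃ e, IsRay θ e ∧ ∃ r : ℝ, 0 ≤ r ∧ z = (r : ℂ) * e}

lemma mem_sectorCompl_iff {θ : ℝ} (h0 : 0 < θ) (h1 : θ < Real.pi / 2) (z : ℂ) :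
    z ∈ sectorCompl θ ↔ z.re ≤ ‖z‖ * Real.cos θ := by
  by_cases hz : z = 0
  · simp [hz, sectorCompl]
  have hn : 0 < ‖z‖ := norm_pos_iff.2 hz
  have hc : z.re = ‖z‖ * Real.cos |z.arg| := by
    rw [Real.cos_abs, Complex.cos_arg hz]; field_simp
  rw [hc, mul_le_mul_iff_right₀ hn]
  have ha : |z.arg| ∈ Icc 0 Real.pi := ⟨abs_nonneg _, Complex.abs_arg_le_pi z⟩
  have hθ : θ ∈ Icc 0 Real.pi := ⟨h0.le, by linarith [Real.pi_pos]⟩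
  simp only [sectorCompl, mem_ofPred_eq, hz, false_or]
  exact (Real.strictAntiOn_cos.le_iff_ge ha hθ).symm

lemma IsRay.norm_eq {θ : ℝ} {e : ℂ} (he : IsRay θ e) : ‖e‖ = 1 := by
  rcases he with rfl | rfl
  · rw [Complex.norm_exp]; simp
  · rw [Complex.norm_exp_ofReal_mul_I]

lemma IsRay.re_eq {θ : ℝ} {e : ℂ} (he : IsRay θ e) : e.re = Real.cos θ := by
  rcases he with rfl | rfl
  · rw [Complex.exp_re]; simp
  · rw [Complex.exp_re]; simp

lemma IsRay.ne_zero {θ : ℝ} {e : ℂ} (he : IsRay θ e) : e ≠ 0 := by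
  rcases he with rfl | rfl <;> exact Complex.exp_ne_zero _

lemma IsRay.norm_point {θ : ℝ} {e : ℂ} (he : IsRay θ e) {r : ℝ} (hr : 0 ≤ r) :
    ‖(r : ℂ) * e‖ = r := by
  rw [norm_mul, he.norm_eq, mul_one, Complex.norm_real, Real.norm_of_nonneg hr]

lemma IsRay.re_point {θ : ℝ} {e : ℂ} (he : IsRay θ e) (r : ℝ) :
    ((r : ℂ) * e).re = r * Real.cos θ := by
  rw [Complex.re_ofReal_mul, he.re_eq]

lemma IsRay.mem {θ : ℝ} (h0 : 0 < θ) (h1 : θ < Real.pi / 2) {e : ℂ} (he : IsRay θ e) {r : ℝ}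
    (hr : 0 ≤ r) : (r : ℂ) * e ∈ sectorCompl θ := by
  rw [mem_sectorCompl_iff h0 h1, he.re_point, he.norm_point hr]

lemma IsRay.mem_boundaryRays {θ : ℝ} {e : ℂ} (he : IsRay θ e) {r : ℝ} (hr : 0 ≤ r) :
    (r : ℂ) * e ∈ boundaryRays θ := ⟨e, he, r, hr, rfl⟩

lemma boundaryRays_subset {θ : ℝ} (h0 : 0 < θ) (h1 : θ < Real.pi / 2) :
    boundaryRays θ ⊆ sectorCompl θ := by
  rintro z ⟨e, he, r, hr, rfl⟩
  exact he.mem h0 h1 hr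

lemma neg_one_mem_sectorCompl {θ : ℝ} (h1 : θ < Real.pi / 2) : (-1 : ℂ) ∈ sectorCompl θ := by
  right
  rw [Complex.arg_neg_one, abs_of_pos Real.pi_pos]
  linarith [Real.pi_pos]

lemma zero_mem_sectorCompl (θ : ℝ) : (0 : ℂ) ∈ sectorCompl θ := Or.inl rfl

lemma RaysIntegrable.of_le {E' : Type*} [NormedAddCommGroup E'] {θ : ℝ} {F : ℂ → E'}
    (hF : ContinuousOn F (boundaryRays θ)) {g : ℝ → ℝ} (hg : IntegrableOn g (Ioi 0))
    (hle : ∀ e, IsRay θ e → ∀ r : ℝ, 0 < r → ‖F ((r : ℂ) * e)‖ ≤ g r) : RaysIntegrable θ F := by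
  intro e he
  refine Integrable.mono' hg ?_ ?_
  · refine ContinuousOn.aestronglyMeasurable ?_ measurableSet_Ioi
    refine hF.comp (Continuous.continuousOn (by fun_prop)) fun r hr => he.mem_boundaryRays (le_of_lt hr)
  · exact (ae_restrict_iff' measurableSet_Ioi).2 (ae_of_all _ fun r hr => hle e he r hr)

lemma isRay_neg (θ : ℝ) : IsRay θ (Complex.exp (-((θ : ℂ) * Complex.I))) := Or.inl rfl

lemma isRay_pos (θ : ℝ) : IsRay θ (Complex.exp ((θ : ℂ) * Complex.I)) := Or.inr rfl

lemma rayInt_congr {θ : ℝ} {e : ℂ} {F G : ℂ → E}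
    (he : IsRay θ e) (h : EqOn F G (boundaryRays θ)) : rayInt e F = rayInt e G :=
  setIntegral_congr_fun measurableSet_Ioi fun r hr => by
    simp only [h (he.mem_boundaryRays (le_of_lt hr))]

lemma contourInt_congr {θ : ℝ} {F G : ℂ → E}
    (h : EqOn F G (boundaryRays θ)) : contourInt θ F = contourInt θ G := by
  rw [contourInt, contourInt, rayInt_congr (isRay_neg θ) h,
    rayInt_congr (isRay_pos θ) h]

lemma contourInt_sub {θ : ℝ} {F G : ℂ → E} (hF : RaysIntegrable θ F) (hG : RaysIntegrable θ G) :
    contourInt θ (fun z => F z - G z) = contourInt θ F - contourInt θ G := by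
  have key : ∀ e, IsRay θ e → rayInt e (fun z => F z - G z) = rayInt e F - rayInt e G := by
    intro e he
    simp only [rayInt, smul_sub]
    exact integral_sub ((hF e he).smul e) ((hG e he).smul e)
  rw [contourInt, key _ (isRay_neg θ), key _ (isRay_pos θ), contourInt, contourInt]
  abel

lemma contourInt_clm {F' : Type*} [NormedAddCommGroup F'] [NormedSpace ℂ F'] [CompleteSpace E]
    [CompleteSpace F'] {θ : ℝ} (L : E →L[ℂ] F') {F : ℂ → E} (hF : RaysIntegrable θ F) :
    contourInt θ (fun z => L (F z)) = L (contourInt θ F) := by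
  have key : ∀ e, IsRay θ e → rayInt e (fun z => L (F z)) = L (rayInt e F) := by
    intro e he
    simp only [rayInt, ← map_smul]
    exact L.integral_comp_comm ((hF e he).smul e)
  rw [contourInt, key _ (isRay_neg θ), key _ (isRay_pos θ), contourInt, map_sub]

lemma norm_contourInt_le {θ : ℝ} {F : ℂ → E} {g : ℝ → ℝ} (hg : IntegrableOn g (Ioi 0))
    (hle : ∀ e, IsRay θ e → ∀ r : ℝ, 0 < r → ‖F ((r : ℂ) * e)‖ ≤ g r) :
    ‖contourInt θ F‖ ≤ 2 * ∫ r in Ioi (0 : ℝ), g r := by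
  have key : ∀ e, IsRay θ e → ‖rayInt e F‖ ≤ ∫ r in Ioi (0 : ℝ), g r := by
    intro e he
    refine norm_integral_le_of_norm_le hg
      ((ae_restrict_iff' measurableSet_Ioi).2 (ae_of_all _ fun r hr => ?_))
    rw [norm_smul, he.norm_eq, one_mul]
    exact hle e he r hr
  rw [contourInt]
  refine (norm_sub_le _ _).trans ?_
  linarith [key _ (isRay_neg θ), key _ (isRay_pos θ)]

lemma cos_angle_pos {θ : ℝ} (h0 : 0 < θ) (h1 : θ < Real.pi / 2) : 0 < Real.cos θ :=
  Real.cos_pos_of_mem_Ioo ⟨by linarith, h1⟩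

lemma cos_angle_lt_one {θ : ℝ} (h0 : 0 < θ) (h1 : θ < Real.pi / 2) : Real.cos θ < 1 := by
  have := Real.cos_lt_cos_of_nonneg_of_le_pi le_rfl (by linarith [Real.pi_pos]) h0
  rwa [Real.cos_zero] at this

lemma norm_exp_ray {θ : ℝ} {e : ℂ} (he : IsRay θ e) (r s : ℝ) :
    ‖Complex.exp (-((r : ℂ) * e) * s)‖ = Real.exp (-(Real.cos θ * s) * r) := by
  rw [Complex.norm_exp, neg_mul, Complex.neg_re, Complex.re_mul_ofReal, he.re_point]
  ring_nf

lemma integrableOn_exp_decay {κ s : ℝ} (hκ : 0 < κ) (hs : 0 < s) (C : ℝ) :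
    IntegrableOn (fun r : ℝ => C * Real.exp (-(κ * s) * r)) (Ioi 0) :=
  (integrableOn_exp_mul_Ioi (by have := mul_pos hκ hs; linarith) 0).const_mul C

lemma integral_exp_decay {κ s : ℝ} (hκ : 0 < κ) (hs : 0 < s) (C : ℝ) :
    ∫ r in Ioi (0 : ℝ), C * Real.exp (-(κ * s) * r) = C / (κ * s) := by
  have := mul_pos hκ hs
  rw [integral_const_mul, integral_exp_mul_Ioi (by linarith)]
  simp
  ring

lemma integrableOn_inv_one_add_sq (C : ℝ) :
    IntegrableOn (fun r : ℝ => C / (1 + r ^ 2)) (Ioi 0) := by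
  simp_rw [div_eq_mul_inv]
  exact (integrable_inv_one_add_sq.const_mul C).integrableOn

lemma mul_div_one_add_le {M r : ℝ} (hM : 0 ≤ M) (hr : 0 ≤ r) : M / (1 + r) ≤ M ∧
    r * (M / (1 + r)) ≤ M := by
  constructor
  · exact div_le_self hM (by linarith)
  · rw [mul_div_assoc', div_le_iff₀ (by linarith)]; nlinarith

/-- The Laplace-type integrals `∫ e^{-zs} F(z) dz` and `∫ z e^{-zs} F(z) dz` converge if
`F(z) = O(1 / (1 + |z|))`. -/
lemma raysIntegrable_exp_smul {θ M : ℝ} (h0 : 0 < θ) (h1 : θ < Real.pi / 2) {F : ℂ → E}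
    (hF : ContinuousOn F (boundaryRays θ)) (hM : 0 ≤ M)
    (hb : ∀ z ∈ boundaryRays θ, ‖F z‖ ≤ M / (1 + ‖z‖)) {s : ℝ} (hs : 0 < s) :
    RaysIntegrable θ (fun z => Complex.exp (-z * s) • F z) := by
  refine RaysIntegrable.of_le (ContinuousOn.smul (by fun_prop) hF)
    (integrableOn_exp_decay (cos_angle_pos h0 h1) hs M) fun e he r hr => ?_
  rw [norm_smul, norm_exp_ray he, mul_comm]
  have := hb _ (he.mem_boundaryRays hr.le)
  rw [he.norm_point hr.le] at this
  gcongr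
  exact this.trans (mul_div_one_add_le hM hr.le).1

lemma norm_mul_exp_smul_le {θ M : ℝ} {F : ℂ → E} (hM : 0 ≤ M)
    (hb : ∀ z ∈ boundaryRays θ, ‖F z‖ ≤ M / (1 + ‖z‖)) (s : ℝ) {e : ℂ} (he : IsRay θ e) {r : ℝ}
    (hr : 0 ≤ r) :
    ‖(((r : ℂ) * e) * Complex.exp (-((r : ℂ) * e) * s)) • F ((r : ℂ) * e)‖ ≤
      M * Real.exp (-(Real.cos θ * s) * r) := by
  rw [norm_smul, norm_mul, norm_exp_ray he, he.norm_point hr]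
  have := hb _ (he.mem_boundaryRays hr)
  rw [he.norm_point hr] at this
  calc _ = (r * ‖F ((r : ℂ) * e)‖) * Real.exp (-(Real.cos θ * s) * r) := by ring
    _ ≤ _ := by
      gcongr
      exact (mul_le_mul_of_nonneg_left this hr).trans (mul_div_one_add_le hM hr).2

lemma raysIntegrable_mul_exp_smul {θ M : ℝ} (h0 : 0 < θ) (h1 : θ < Real.pi / 2) {F : ℂ → E}
    (hF : ContinuousOn F (boundaryRays θ)) (hM : 0 ≤ M)
    (hb : ∀ z ∈ boundaryRays θ, ‖F z‖ ≤ M / (1 + ‖z‖)) {s : ℝ} (hs : 0 < s) :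
    RaysIntegrable θ (fun z => (z * Complex.exp (-z * s)) • F z) :=
  RaysIntegrable.of_le (ContinuousOn.smul (by fun_prop) hF)
    (integrableOn_exp_decay (cos_angle_pos h0 h1) hs M)
    fun _ he _ hr => norm_mul_exp_smul_le hM hb s he hr.le

lemma norm_mul_contourInt_exp_le {θ M : ℝ} (h0 : 0 < θ) (h1 : θ < Real.pi / 2) {F : ℂ → E}
    (hM : 0 ≤ M) (hb : ∀ z ∈ boundaryRays θ, ‖F z‖ ≤ M / (1 + ‖z‖)) {s : ℝ} (hs : 0 < s) :
    ‖contourInt θ (fun z => (z * Complex.exp (-z * s)) • F z)‖ ≤ 2 * (M / (Real.cos θ * s)) := by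
  rw [← integral_exp_decay (cos_angle_pos h0 h1) hs]
  exact norm_contourInt_le (integrableOn_exp_decay (cos_angle_pos h0 h1) hs M)
    fun e he r hr => norm_mul_exp_smul_le hM hb s he hr.le

lemma norm_contourInt_exp_le {θ M : ℝ} (h0 : 0 < θ) (h1 : θ < Real.pi / 2) {F : ℂ → E}
    (hM : 0 ≤ M) (hb : ∀ z ∈ boundaryRays θ, ‖F z‖ ≤ M / (1 + ‖z‖)) {s : ℝ} (hs : 0 < s) :
    ‖contourInt θ (fun z => Complex.exp (-z * s) • F z)‖ ≤ 2 * (M / (Real.cos θ * s)) := by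
  rw [← integral_exp_decay (cos_angle_pos h0 h1) hs]
  refine norm_contourInt_le (integrableOn_exp_decay (cos_angle_pos h0 h1) hs M)
    fun e he r hr => ?_
  rw [norm_smul, norm_exp_ray he, mul_comm]
  have := hb _ (he.mem_boundaryRays hr.le)
  rw [he.norm_point hr.le] at this
  gcongr
  exact this.trans (mul_div_one_add_le hM hr.le).1

lemma tendsto_contourInt_exp_smul {θ C : ℝ} (h0 : 0 < θ) (h1 : θ < Real.pi / 2) {F : ℂ → E}
    (hF : ContinuousOn F (boundaryRays θ))
    (hb : ∀ z ∈ boundaryRays θ, ‖F z‖ ≤ C / (1 + ‖z‖ ^ 2)) :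
    Tendsto (fun s : ℝ => contourInt θ (fun z => Complex.exp (-z * s) • F z)) (𝓝[>] 0)
      (𝓝 (contourInt θ F)) := by
  have key : ∀ e, IsRay θ e →
      Tendsto (fun s : ℝ => rayInt e (fun z => Complex.exp (-z * s) • F z)) (𝓝[>] 0)
        (𝓝 (rayInt e F)) := by
    intro e he
    have hFray : ContinuousOn (fun r : ℝ => F ((r : ℂ) * e)) (Ioi 0) :=
      hF.comp (Continuous.continuousOn (by fun_prop)) fun r hr => he.mem_boundaryRays (le_of_lt hr)
    refine tendsto_integral_filter_of_dominated_convergence (fun r => C / (1 + r ^ 2)) ?_ ?_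
      (integrableOn_inv_one_add_sq C) ?_
    · exact Eventually.of_forall fun s => ContinuousOn.aestronglyMeasurable
        (ContinuousOn.const_smul (ContinuousOn.smul (by fun_prop) hFray) e) measurableSet_Ioi
    · filter_upwards [self_mem_nhdsWithin] with s hs
      refine (ae_restrict_iff' measurableSet_Ioi).2 (ae_of_all _ fun r hr => ?_)
      have hr : 0 < r := hr
      have hs : 0 < s := hs
      rw [norm_smul, he.norm_eq, one_mul, norm_smul, norm_exp_ray he]
      have hbr := hb _ (he.mem_boundaryRays hr.le)
      rw [he.norm_point hr.le] at hbr
      refine (mul_le_of_le_one_left (norm_nonneg _) ?_).trans hbr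
      have := mul_pos (mul_pos (cos_angle_pos h0 h1) hs) hr
      exact Real.exp_le_one_iff.2 (by linarith)
    · refine ae_of_all _ fun r => tendsto_nhdsWithin_of_tendsto_nhds ?_
      have : Continuous fun s : ℝ =>
          e • Complex.exp (-((r : ℂ) * e) * s) • F ((r : ℂ) * e) := by fun_prop
      simpa using this.tendsto 0
  exact (key _ (isRay_neg θ)).sub (key _ (isRay_pos θ))

/-- Differentiation of `∫ e^{-zs} F(z) dz` with respect to `s > 0` under the integral sign. -/
lemma hasDerivAt_contourInt_exp_smul {θ M : ℝ} (h0 : 0 < θ) (h1 : θ < Real.pi / 2) {F : ℂ → E}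
    (hF : ContinuousOn F (boundaryRays θ)) (hM : 0 ≤ M)
    (hb : ∀ z ∈ boundaryRays θ, ‖F z‖ ≤ M / (1 + ‖z‖)) {s : ℝ} (hs : 0 < s) :
    HasDerivAt (fun s : ℝ => contourInt θ (fun z => Complex.exp (-z * s) • F z))
      (-contourInt θ (fun z => (z * Complex.exp (-z * s)) • F z)) s := by
  have hκ := cos_angle_pos h0 h1
  have key : ∀ e, IsRay θ e →
      HasDerivAt (fun s : ℝ => rayInt e (fun z => Complex.exp (-z * s) • F z))
        (-rayInt e (fun z => (z * Complex.exp (-z * s)) • F z)) s := by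
    intro e he
    have hFray : ContinuousOn (fun r : ℝ => F ((r : ℂ) * e)) (Ioi 0) :=
      hF.comp (Continuous.continuousOn (by fun_prop)) fun r hr => he.mem_boundaryRays (le_of_lt hr)
    have := (hasDerivAt_integral_of_dominated_loc_of_deriv_le (μ := volume.restrict (Ioi (0 : ℝ)))
      (F := fun (s : ℝ) (r : ℝ) =>
        e • Complex.exp (-((r : ℂ) * e) * s) • F ((r : ℂ) * e))
      (F' := fun (s : ℝ) (r : ℝ) =>
        -(e • (((r : ℂ) * e) * Complex.exp (-((r : ℂ) * e) * s)) • F ((r : ℂ) * e)))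
      (x₀ := s) (s := Ioi (s / 2)) (bound := fun r => M * Real.exp (-(Real.cos θ * (s / 2)) * r))
      (Ioi_mem_nhds (by linarith)) ?_ ?_ ?_ ?_ ?_ ?_).2
    · rw [rayInt, ← integral_neg]; exact this
    · exact Eventually.of_forall fun x => ContinuousOn.aestronglyMeasurable
        (ContinuousOn.const_smul (ContinuousOn.smul (by fun_prop) hFray) e) measurableSet_Ioi
    · exact (raysIntegrable_exp_smul h0 h1 hF hM hb hs e he).smul e
    · exact ContinuousOn.aestronglyMeasurable
        (ContinuousOn.const_smul (ContinuousOn.smul (by fun_prop) hFray) e).neg measurableSet_Ioi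
    · refine (ae_restrict_iff' measurableSet_Ioi).2 (ae_of_all _ fun r hr x hx => ?_)
      have hr : 0 < r := hr
      have hx : s / 2 < x := hx
      rw [norm_neg, norm_smul, he.norm_eq, one_mul]
      refine (norm_mul_exp_smul_le hM hb x he hr.le).trans ?_
      gcongr
    · exact integrableOn_exp_decay hκ (by linarith) M
    · refine ae_of_all _ fun r x _ => ?_
      have h1 : HasDerivAt (fun x : ℝ => Complex.exp (-((r : ℂ) * e) * x))
          (Complex.exp (-((r : ℂ) * e) * x) * (-((r : ℂ) * e))) x := by
        have : HasDerivAt (fun x : ℝ => -((r : ℂ) * e) * (x : ℂ)) (-((r : ℂ) * e)) x := by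
          simpa using (Complex.ofRealCLM.hasDerivAt (x := x)).const_mul (-((r : ℂ) * e))
        exact this.cexp
      have h2 := (h1.smul_const (F ((r : ℂ) * e))).const_smul e
      refine HasDerivAt.congr_deriv h2 ?_
      rw [← smul_neg, ← neg_smul]
      congr 2
      ring
  have := (key _ (isRay_neg θ)).sub (key _ (isRay_pos θ))
  refine this.congr_deriv ?_
  rw [contourInt]; abel

lemma contourInt_exp {θ : ℝ} (h0 : 0 < θ) (h1 : θ < Real.pi / 2) {s : ℝ} (hs : 0 < s) :
    contourInt θ (fun z => Complex.exp (-z * s)) = 0 := by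
  have key : ∀ e, IsRay θ e → rayInt e (fun z => Complex.exp (-z * s)) = 1 / s := by
    intro e he
    have hre : (-(e * s)).re < 0 := by
      rw [Complex.neg_re, Complex.re_mul_ofReal, he.re_eq]
      have := mul_pos (cos_angle_pos h0 h1) hs
      linarith
    have h := integral_exp_mul_complex_Ioi hre 0
    simp only [rayInt, smul_eq_mul]
    rw [integral_const_mul]
    have : ∀ r : ℝ, Complex.exp (-((r : ℂ) * e) * s) = Complex.exp (-(e * s) * r) := fun r => by
      congr 1; ring
    simp_rw [this]
    rw [h]
    have := he.ne_zero
    have hs' : (s : ℂ) ≠ 0 := by exact_mod_cast hs.ne'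
    simp
    field_simp
  rw [contourInt, key _ (isRay_neg θ), key _ (isRay_pos θ), sub_self]

lemma integral_comp_exp (G : ℝ → E) :
    ∫ x : ℝ, Real.exp x • G (Real.exp x) = ∫ r in Ioi (0 : ℝ), G r := by
  have := integral_image_eq_integral_abs_deriv_smul (s := univ) MeasurableSet.univ
    (fun x _ => (Real.hasDerivAt_exp x).hasDerivWithinAt) Real.exp_injective.injOn G
  rw [image_univ, Real.range_exp] at this
  rw [this]
  simp [abs_of_pos (Real.exp_pos _)]

lemma integrable_comp_exp {G : ℝ → E} (hG : IntegrableOn G (Ioi 0)) :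
    Integrable (fun x : ℝ => Real.exp x • G (Real.exp x)) := by
  have := integrableOn_image_iff_integrableOn_abs_deriv_smul (s := univ) MeasurableSet.univ
    (fun x _ => (Real.hasDerivAt_exp x).hasDerivWithinAt) Real.exp_injective.injOn G
  rw [image_univ, Real.range_exp] at this
  have := this.1 hG
  simpa [abs_of_pos (Real.exp_pos _)] using this

/-- Cauchy's theorem for the complement of the sector, for functions that decay quadratically.
In the coordinate `w = log z` the region is a strip, and the claim follows from Cauchy's theorem
for long rectangles in this strip. -/
theorem contourInt_eq_zero {θ C : ℝ} (h0 : 0 < θ) (h1 : θ < Real.pi / 2) {F : ℂ → E}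
    (hF : ContinuousOn F (sectorCompl θ)) (hd : ∀ z, z.re < ‖z‖ * Real.cos θ →
      DifferentiableAt ℂ F z)
    (hb : ∀ z ∈ sectorCompl θ, ‖F z‖ ≤ C / (1 + ‖z‖ ^ 2)) : contourInt θ F = 0 := by
  have hC : 0 ≤ C := by
    have := (norm_nonneg _).trans (hb 0 (zero_mem_sectorCompl θ))
    simpa using this
  set H : ℂ → E := fun w => Complex.exp w • F (Complex.exp w) with hH
  have hpi := Real.pi_pos
  have hre : ∀ x y : ℝ, (Complex.exp (x + y * Complex.I)).re = Real.exp x * Real.cos y := by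
    intro x y; rw [Complex.exp_re]; simp
  have hnorm : ∀ x y : ℝ, ‖Complex.exp (x + y * Complex.I)‖ = Real.exp x := by
    intro x y; rw [Complex.norm_exp]; simp
  -- on `[θ, 2π - θ]` the cosine is at most `cos θ`
  have hcos : ∀ y ∈ Icc θ (2 * Real.pi - θ), Real.cos y ≤ Real.cos θ := by
    intro y hy
    rcases le_total y Real.pi with h | h
    · exact Real.cos_le_cos_of_nonneg_of_le_pi h0.le h hy.1
    · rw [← Real.cos_two_pi_sub]
      exact Real.cos_le_cos_of_nonneg_of_le_pi h0.le (by linarith) (by linarith [hy.2])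
  have hcos' : ∀ y ∈ Ioo θ (2 * Real.pi - θ), Real.cos y < Real.cos θ := by
    intro y hy
    rcases le_total y Real.pi with h | h
    · exact Real.cos_lt_cos_of_nonneg_of_le_pi h0.le h hy.1
    · rw [← Real.cos_two_pi_sub]
      exact Real.cos_lt_cos_of_nonneg_of_le_pi h0.le (by linarith) (by linarith [hy.2])
  have hmem : ∀ x : ℝ, ∀ y ∈ Icc θ (2 * Real.pi - θ),
      Complex.exp (x + y * Complex.I) ∈ sectorCompl θ := by
    intro x y hy
    rw [mem_sectorCompl_iff h0 h1, hre, hnorm]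
    exact mul_le_mul_of_nonneg_left (hcos y hy) (Real.exp_pos x).le
  have hHb : ∀ x : ℝ, ∀ y ∈ Icc θ (2 * Real.pi - θ),
      ‖H (x + y * Complex.I)‖ ≤ C * Real.exp (-|x|) := by
    intro x y hy
    rw [hH]
    simp only
    rw [norm_smul, hnorm]
    have := hb _ (hmem x y hy)
    rw [hnorm] at this
    have hx := Real.exp_pos x
    refine (mul_le_mul_of_nonneg_left this hx.le).trans ?_
    rw [mul_div_assoc', div_le_iff₀ (by positivity), mul_comm (Real.exp x), mul_assoc]
    refine mul_le_mul_of_nonneg_left ?_ hC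
    rcases abs_cases x with ⟨h, _⟩ | ⟨h, _⟩
    · rw [h, Real.exp_neg]
      have : (Real.exp x)⁻¹ * Real.exp x ^ 2 = Real.exp x := by field_simp
      have : 0 < (Real.exp x)⁻¹ := by positivity
      nlinarith
    · rw [h, neg_neg]
      nlinarith [pow_pos hx 2]
  have hrect : ∀ N : ℝ, 0 ≤ N →
      ‖(∫ x in (-N)..N, H (x + θ * Complex.I)) -
        ∫ x in (-N)..N, H (x + (2 * Real.pi - θ : ℝ) * Complex.I)‖ ≤
          4 * Real.pi * (C * Real.exp (-N)) := by
    intro N hN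
    have hab : θ ≤ 2 * Real.pi - θ := by linarith
    have cauchy := Complex.integral_boundary_rect_eq_zero_of_continuousOn_of_differentiableOn H
      ⟨-N, θ⟩ ⟨N, 2 * Real.pi - θ⟩ ?_ ?_
    · have hv : ∀ a : ℝ, |a| = N →
          ‖∫ y in θ..(2 * Real.pi - θ), H (a + y * Complex.I)‖ ≤
            2 * Real.pi * (C * Real.exp (-N)) := by
        intro a ha
        have := intervalIntegral.norm_integral_le_of_norm_le_const
          (a := θ) (b := 2 * Real.pi - θ) (C := C * Real.exp (-N))
          (f := fun y : ℝ => H (a + y * Complex.I)) ?_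
        · refine this.trans ?_
          rw [mul_comm, abs_of_nonneg (by linarith)]
          have : 0 ≤ C * Real.exp (-N) := by positivity
          nlinarith
        · intro y hy
          rw [uIoc_of_le hab] at hy
          rw [← ha]
          exact hHb a y ⟨hy.1.le, hy.2⟩
      have v1 := hv N (abs_of_nonneg hN)
      have v2 := hv (-N) (by rw [abs_neg, abs_of_nonneg hN])
      simp only at cauchy
      rw [add_sub_assoc, ← smul_sub, add_eq_zero_iff_eq_neg] at cauchy
      rw [cauchy, norm_neg, norm_smul, Complex.norm_I, one_mul]
      refine (norm_sub_le _ _).trans ?_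
      linarith
    · refine ContinuousOn.smul (by fun_prop) (hF.comp (by fun_prop) ?_)
      intro w hw
      rw [uIcc_of_le hab] at hw
      have := hmem w.re w.im hw.2
      rwa [Complex.re_add_im] at this
    · intro w hw
      simp only [min_eq_left hab, max_eq_right hab] at hw
      have hw2 := hcos' w.im hw.2
      have : DifferentiableAt ℂ F (Complex.exp w) := by
        apply hd
        have e1 := hre w.re w.im
        have e2 := hnorm w.re w.im
        rw [Complex.re_add_im] at e1 e2
        rw [e1, e2]
        exact mul_lt_mul_of_pos_left hw2 (Real.exp_pos _)
      exact (Complex.differentiableAt_exp.smul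
        (this.comp w Complex.differentiableAt_exp)).differentiableWithinAt
  have hint := integrableOn_inv_one_add_sq C
  have hrays : RaysIntegrable θ F := RaysIntegrable.of_le
    (hF.mono (boundaryRays_subset h0 h1)) hint fun e he r hr => by
    have := hb _ (he.mem h0 h1 hr.le)
    rwa [he.norm_point hr.le] at this
  have hline : ∀ y : ℝ, IsRay θ (Complex.exp (y * Complex.I)) →
      Integrable (fun x : ℝ => H (x + y * Complex.I)) ∧
      ∫ x : ℝ, H (x + y * Complex.I) = rayInt (Complex.exp (y * Complex.I)) F := by
    intro y he
    have e1 : ∀ x : ℝ, H (x + y * Complex.I) = Real.exp x •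
        (fun r : ℝ => Complex.exp (y * Complex.I) • F ((r : ℂ) * Complex.exp (y * Complex.I)))
          (Real.exp x) := by
      intro x
      simp only [hH, Complex.exp_add, Complex.ofReal_exp]
      rw [mul_smul, ← Complex.ofReal_exp, Complex.coe_smul]
    simp_rw [e1]
    exact ⟨integrable_comp_exp ((hrays _ he).smul (Complex.exp (y * Complex.I))),
      integral_comp_exp fun r : ℝ =>
        Complex.exp (y * Complex.I) • F ((r : ℂ) * Complex.exp (y * Complex.I))⟩
  have e2 : Complex.exp (((2 * Real.pi - θ : ℝ) : ℂ) * Complex.I) =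
      Complex.exp (-((θ : ℂ) * Complex.I)) := by
    have : ((2 * Real.pi - θ : ℝ) : ℂ) * Complex.I =
        -((θ : ℂ) * Complex.I) + 2 * Real.pi * Complex.I := by push_cast; ring
    rw [this, Complex.exp_add, Complex.exp_two_pi_mul_I, mul_one]
  obtain ⟨i1, j1⟩ := hline θ (isRay_pos θ)
  obtain ⟨i2, j2⟩ := hline (2 * Real.pi - θ) (by rw [e2]; exact isRay_neg θ)
  have lim := (intervalIntegral_tendsto_integral i1 tendsto_neg_atTop_atBot tendsto_id).sub
    (intervalIntegral_tendsto_integral i2 tendsto_neg_atTop_atBot tendsto_id)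
  have lim0 : Tendsto (fun N : ℝ => (∫ x in (-N)..N, H (x + θ * Complex.I)) -
        ∫ x in (-N)..N, H (x + (2 * Real.pi - θ : ℝ) * Complex.I)) atTop (𝓝 0) := by
    refine squeeze_zero_norm' ((eventually_ge_atTop 0).mono hrect) ?_
    have := (Real.tendsto_exp_neg_atTop_nhds_zero.const_mul C).const_mul (4 * Real.pi)
    simpa using this
  have := tendsto_nhds_unique lim lim0
  rw [j1, j2, e2] at this
  rw [contourInt, ← neg_sub, this, neg_zero]

end Contour

/-! ### Two scalar contour integrals -/

section Scalar

variable {θ : ℝ}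

/-- A constant `c > 0` with `c (1 + |z|) ≤ |1 - z|` outside the sector. -/
noncomputable def gapConst (θ : ℝ) : ℝ := Real.sqrt ((1 - Real.cos θ) / 2)

lemma gapConst_pos (h0 : 0 < θ) (h1 : θ < Real.pi / 2) : 0 < gapConst θ :=
  Real.sqrt_pos.2 (by linarith [cos_angle_lt_one h0 h1])

lemma gapConst_mul_le (h0 : 0 < θ) (h1 : θ < Real.pi / 2) {z : ℂ} (hz : z ∈ sectorCompl θ) :
    gapConst θ * (1 + ‖z‖) ≤ ‖1 - z‖ := by
  rw [mem_sectorCompl_iff h0 h1] at hz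
  have hκ := cos_angle_pos h0 h1
  have hκ1 := cos_angle_lt_one h0 h1
  refine le_of_sq_le_sq ?_ (norm_nonneg _)
  rw [mul_pow, gapConst, Real.sq_sqrt (by linarith)]
  have h2 : ‖1 - z‖ ^ 2 = 1 - 2 * z.re + ‖z‖ ^ 2 := by
    rw [← Complex.normSq_eq_norm_sq, ← Complex.normSq_eq_norm_sq, Complex.normSq_apply,
      Complex.normSq_apply]
    simp; ring
  rw [h2]
  nlinarith [norm_nonneg z, sq_nonneg (1 - ‖z‖)]

lemma one_add_le_norm (h0 : 0 < θ) (h1 : θ < Real.pi / 2) {z : ℂ} (hz : z ∈ boundaryRays θ) :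
    (1 + ‖z‖) / 2 ≤ ‖1 + z‖ := by
  obtain ⟨e, he, r, hr, rfl⟩ := hz
  have hre : 0 ≤ ((r : ℂ) * e).re := by
    rw [he.re_point]; exact mul_nonneg hr (cos_angle_pos h0 h1).le
  generalize (r : ℂ) * e = z at *
  refine le_of_sq_le_sq ?_ (norm_nonneg _)
  have h2 : ‖1 + z‖ ^ 2 = 1 + 2 * z.re + ‖z‖ ^ 2 := by
    rw [← Complex.normSq_eq_norm_sq, ← Complex.normSq_eq_norm_sq, Complex.normSq_apply,
      Complex.normSq_apply]
    simp; ring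
  rw [h2]
  nlinarith [norm_nonneg z, sq_nonneg (1 - ‖z‖)]

lemma one_add_ne_zero (h0 : 0 < θ) (h1 : θ < Real.pi / 2) {z : ℂ} (hz : z ∈ boundaryRays θ) :
    1 + z ≠ 0 := by
  have := one_add_le_norm h0 h1 hz
  exact norm_pos_iff.1 (lt_of_lt_of_le (by positivity) this)

lemma one_sub_ne_zero (h0 : 0 < θ) (h1 : θ < Real.pi / 2) {z : ℂ} (hz : z ∈ sectorCompl θ) :
    1 - z ≠ 0 := by
  have h := gapConst_mul_le h0 h1 hz
  have := gapConst_pos h0 h1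
  exact norm_pos_iff.1 (lt_of_lt_of_le (by positivity) h)

lemma norm_inv_one_add_le (h0 : 0 < θ) (h1 : θ < Real.pi / 2) {z : ℂ} (hz : z ∈ boundaryRays θ) :
    ‖(1 + z)⁻¹‖ ≤ 2 / (1 + ‖z‖) := by
  rw [norm_inv, inv_le_comm₀ (norm_pos_iff.2 (one_add_ne_zero h0 h1 hz)) (by positivity), inv_div]
  exact one_add_le_norm h0 h1 hz

lemma norm_inv_one_sub_le (h0 : 0 < θ) (h1 : θ < Real.pi / 2) {z : ℂ} (hz : z ∈ sectorCompl θ) :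
    ‖(1 - z)⁻¹‖ ≤ (gapConst θ)⁻¹ / (1 + ‖z‖) := by
  have := gapConst_pos h0 h1
  rw [norm_inv, inv_le_comm₀ (norm_pos_iff.2 (one_sub_ne_zero h0 h1 hz)) (by positivity), inv_div,
    div_inv_eq_mul, mul_comm]
  exact gapConst_mul_le h0 h1 hz

lemma mul_div_one_add_le_div_sq {a b x : ℝ} (ha : 0 ≤ a) (hb : 0 ≤ b) (hx : 0 ≤ x) :
    a / (1 + x) * (b / (1 + x)) ≤ a * b / (1 + x ^ 2) := by
  rw [div_mul_div_comm]
  have : 1 + x ^ 2 ≤ (1 + x) * (1 + x) := by nlinarith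
  gcongr

lemma continuousOn_inv_one_add (h0 : 0 < θ) (h1 : θ < Real.pi / 2) :
    ContinuousOn (fun z : ℂ => (1 + z)⁻¹) (boundaryRays θ) :=
  ContinuousOn.inv₀ (by fun_prop) fun _ hz => one_add_ne_zero h0 h1 hz

lemma continuousOn_inv_one_sub (h0 : 0 < θ) (h1 : θ < Real.pi / 2) :
    ContinuousOn (fun z : ℂ => (1 - z)⁻¹) (sectorCompl θ) :=
  ContinuousOn.inv₀ (by fun_prop) fun _ hz => one_sub_ne_zero h0 h1 hz

lemma norm_inv_one_sub_sq_le (h0 : 0 < θ) (h1 : θ < Real.pi / 2) {z : ℂ}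
    (hz : z ∈ boundaryRays θ) :
    ‖2 * ((1 + z)⁻¹ * (1 - z)⁻¹)‖ ≤ 2 * (2 * (gapConst θ)⁻¹) / (1 + ‖z‖ ^ 2) := by
  have hg := gapConst_pos h0 h1
  rw [norm_mul, norm_mul, mul_div_assoc, Complex.norm_ofNat]
  refine mul_le_mul_of_nonneg_left ?_ (by norm_num)
  exact (mul_le_mul (norm_inv_one_add_le h0 h1 hz)
    (norm_inv_one_sub_le h0 h1 (boundaryRays_subset h0 h1 hz)) (norm_nonneg _)
    (by positivity)).trans (mul_div_one_add_le_div_sq (by norm_num) (by positivity)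
      (norm_nonneg _))

lemma raysIntegrable_inv_one_sub_sq (h0 : 0 < θ) (h1 : θ < Real.pi / 2) :
    RaysIntegrable θ (fun z => 2 * ((1 + z)⁻¹ * (1 - z)⁻¹)) := by
  refine RaysIntegrable.of_le (continuousOn_const.mul ((continuousOn_inv_one_add h0 h1).mul
    ((continuousOn_inv_one_sub h0 h1).mono (boundaryRays_subset h0 h1))))
    (integrableOn_inv_one_add_sq (2 * (2 * (gapConst θ)⁻¹))) fun e he r hr => ?_
  have := norm_inv_one_sub_sq_le h0 h1 (he.mem_boundaryRays hr.le)
  rwa [he.norm_point hr.le] at this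

lemma cayley_im (z : ℂ) (hz : 1 - z ≠ 0) :
    ((1 + z) / (1 - z)).im = 2 * (z.im / Complex.normSq (1 - z)) := by
  have e1 : (1 + z) / (1 - z) = -1 + 2 * (1 - z)⁻¹ := by field_simp; ring
  rw [e1]
  simp [Complex.inv_im]

/-- Along a ray off the real axis, `2 / (1 - z²)` has the primitive `log ((1 + z) / (1 - z))`. -/
lemma rayInt_inv_one_sub_sq (h0 : 0 < θ) (h1 : θ < Real.pi / 2) {e : ℂ} (he : IsRay θ e)
    (him : e.im ≠ 0) {m : ℂ}
    (hm : Tendsto (fun r : ℝ => Complex.log ((1 + (r : ℂ) * e) / (1 - (r : ℂ) * e))) atTop (𝓝 m)) :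
    rayInt e (fun z => 2 * ((1 + z)⁻¹ * (1 - z)⁻¹)) = m := by
  have hder : ∀ r : ℝ, 0 ≤ r → HasDerivAt
      (fun r : ℝ => (1 + (r : ℂ) * e) / (1 - (r : ℂ) * e))
      ((e * (1 - (r : ℂ) * e) - (1 + (r : ℂ) * e) * (-e)) / (1 - (r : ℂ) * e) ^ 2) r := by
    intro r hr
    have hlin : HasDerivAt (fun r : ℝ => (r : ℂ) * e) e r := by
      simpa using (Complex.ofRealCLM.hasDerivAt (x := r)).mul_const e
    exact (hlin.const_add 1).div (hlin.const_sub 1) (one_sub_ne_zero h0 h1 (he.mem h0 h1 hr))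
  have hslit : ∀ r : ℝ, 0 ≤ r → (1 + (r : ℂ) * e) / (1 - (r : ℂ) * e) ∈ Complex.slitPlane := by
    intro r hr
    rcases hr.eq_or_lt with rfl | hr'
    · simp
    right
    have hne := one_sub_ne_zero h0 h1 (he.mem h0 h1 hr)
    rw [cayley_im _ hne, Complex.im_ofReal_mul]
    have := Complex.normSq_pos.2 hne
    positivity
  have key := integral_Ioi_of_hasDerivAt_of_tendsto
    (f := fun r : ℝ => Complex.log ((1 + (r : ℂ) * e) / (1 - (r : ℂ) * e)))
    (f' := fun r : ℝ => e • (2 * ((1 + (r : ℂ) * e)⁻¹ * (1 - (r : ℂ) * e)⁻¹))) (a := 0) (m := m)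
    ?_ ?_ ?_ hm
  · rw [rayInt, key]; simp
  · exact ((hder 0 le_rfl).clog_real (hslit 0 le_rfl)).continuousAt.continuousWithinAt
  · intro r hr
    have hr : 0 ≤ r := le_of_lt hr
    have hne := one_sub_ne_zero h0 h1 (he.mem h0 h1 hr)
    have hne' := one_add_ne_zero h0 h1 (he.mem_boundaryRays hr)
    refine ((hder r hr).clog_real (hslit r hr)).congr_deriv ?_
    rw [smul_eq_mul]
    field_simp
    ring
  · exact (raysIntegrable_inv_one_sub_sq h0 h1 e he).smul e

lemma tendsto_cayley (h0 : 0 < θ) (h1 : θ < Real.pi / 2) {e : ℂ} (he : IsRay θ e) :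
    Tendsto (fun r : ℝ => (1 + (r : ℂ) * e) / (1 - (r : ℂ) * e)) atTop (𝓝 (-1)) := by
  have hg := gapConst_pos h0 h1
  have : Tendsto (fun r : ℝ => -1 + 2 * (1 - (r : ℂ) * e)⁻¹) atTop (𝓝 (-1 + 2 * 0)) := by
    refine tendsto_const_nhds.add (tendsto_const_nhds.mul ?_)
    refine squeeze_zero_norm' (a := fun r : ℝ => (gapConst θ)⁻¹ / r) ?_
      (tendsto_const_nhds.div_atTop tendsto_id)
    filter_upwards [eventually_gt_atTop 0] with r hr
    refine (norm_inv_one_sub_le h0 h1 (he.mem h0 h1 hr.le)).trans ?_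
    rw [he.norm_point hr.le]
    gcongr
    linarith
  rw [mul_zero, add_zero] at this
  refine this.congr' ?_
  filter_upwards [eventually_gt_atTop 0] with r hr
  have hne := one_sub_ne_zero h0 h1 (he.mem h0 h1 hr.le)
  field_simp
  ring

lemma contourInt_inv_one_sub_sq (h0 : 0 < θ) (h1 : θ < Real.pi / 2) :
    contourInt θ (fun z => 2 * ((1 + z)⁻¹ * (1 - z)⁻¹)) = -(2 * (Real.pi : ℂ) * Complex.I) := by
  have hsin : 0 < Real.sin θ := Real.sin_pos_of_pos_of_lt_pi h0 (by linarith [Real.pi_pos])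
  have him1 : (Complex.exp (-((θ : ℂ) * Complex.I))).im = -Real.sin θ := by
    rw [Complex.exp_im]; simp
  have him2 : (Complex.exp ((θ : ℂ) * Complex.I)).im = Real.sin θ := by
    rw [Complex.exp_im]; simp
  have r1 : rayInt (Complex.exp (-((θ : ℂ) * Complex.I))) (fun z => 2 * ((1 + z)⁻¹ * (1 - z)⁻¹)) =
      -((Real.pi : ℂ) * Complex.I) := by
    refine rayInt_inv_one_sub_sq h0 h1 (isRay_neg θ) (by rw [him1]; linarith) ?_
    have := (Complex.tendsto_log_nhdsWithin_im_neg_of_re_neg_of_im_zero (z := -1) (by simp)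
      (by simp)).comp (tendsto_nhdsWithin_iff.2 ⟨tendsto_cayley h0 h1 (isRay_neg θ), ?_⟩)
    · simpa [Function.comp_def] using this
    · filter_upwards [eventually_gt_atTop 0] with r hr
      have hne := one_sub_ne_zero h0 h1 ((isRay_neg θ).mem h0 h1 hr.le)
      have h3 := Complex.normSq_pos.2 hne
      change Complex.im _ < 0
      rw [cayley_im _ hne, Complex.im_ofReal_mul, him1]
      have := div_pos (mul_pos hr hsin) h3
      have e1 : r * -Real.sin θ = -(r * Real.sin θ) := by ring
      rw [e1, neg_div]
      linarith
  have r2 : rayInt (Complex.exp ((θ : ℂ) * Complex.I)) (fun z => 2 * ((1 + z)⁻¹ * (1 - z)⁻¹)) =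
      (Real.pi : ℂ) * Complex.I := by
    refine rayInt_inv_one_sub_sq h0 h1 (isRay_pos θ) (by rw [him2]; exact hsin.ne') ?_
    have := (Complex.tendsto_log_nhdsWithin_im_nonneg_of_re_neg_of_im_zero (z := -1) (by simp)
      (by simp)).comp (tendsto_nhdsWithin_iff.2 ⟨tendsto_cayley h0 h1 (isRay_pos θ), ?_⟩)
    · simpa [Function.comp_def] using this
    · filter_upwards [eventually_gt_atTop 0] with r hr
      have hne := one_sub_ne_zero h0 h1 ((isRay_pos θ).mem h0 h1 hr.le)
      have h3 := Complex.normSq_pos.2 hne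
      change 0 ≤ Complex.im _
      rw [cayley_im _ hne, Complex.im_ofReal_mul, him2]
      positivity
  rw [contourInt, r1, r2]; ring

/-- By Jordan's lemma to the right this integral vanishes. Here it is seen to be a solution of
`g' = g` that tends to `0` at infinity. -/
lemma contourInt_exp_smul_inv_one_add (h0 : 0 < θ) (h1 : θ < Real.pi / 2) {s : ℝ} (hs : 0 < s) :
    contourInt θ (fun z => Complex.exp (-z * s) • (1 + z)⁻¹) = 0 := by
  have hc := continuousOn_inv_one_add h0 h1
  have hb : ∀ z ∈ boundaryRays θ, ‖(1 + z)⁻¹‖ ≤ 2 / (1 + ‖z‖) :=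
    fun z hz => norm_inv_one_add_le h0 h1 hz
  set g : ℝ → ℂ := fun s => contourInt θ (fun z => Complex.exp (-z * s) • (1 + z)⁻¹) with hg
  have hg' : ∀ s : ℝ, 0 < s → HasDerivAt g (g s) s := by
    intro s hs
    refine (hasDerivAt_contourInt_exp_smul h0 h1 hc (by norm_num) hb hs).congr_deriv ?_
    have e : EqOn (fun z => (z * Complex.exp (-z * s)) • (1 + z)⁻¹)
        (fun z => Complex.exp (-z * s) - Complex.exp (-z * s) • (1 + z)⁻¹) (boundaryRays θ) := by
      intro z hz
      have := one_add_ne_zero h0 h1 hz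
      simp only [smul_eq_mul]
      field_simp
      ring
    have hexp : RaysIntegrable θ (fun z => Complex.exp (-z * s)) :=
      RaysIntegrable.of_le (by fun_prop) (integrableOn_exp_decay (cos_angle_pos h0 h1) hs 1)
        fun e he r hr => by rw [norm_exp_ray he, one_mul]
    rw [contourInt_congr e, contourInt_sub hexp (raysIntegrable_exp_smul h0 h1 hc (by norm_num) hb
      hs), contourInt_exp h0 h1 hs]
    simp [hg]
  have hconst : ∀ t : ℝ, s ≤ t → g s * Complex.exp (-s) = g t * Complex.exp (-t) := by
    intro t ht
    have hd : ∀ x : ℝ, 0 < x → HasDerivAt (fun x : ℝ => g x * Complex.exp (-x)) 0 x := by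
      intro x hx
      have h2 : HasDerivAt (fun x : ℝ => Complex.exp (-(x : ℂ))) (Complex.exp (-x) * (-1)) x := by
        have : HasDerivAt (fun x : ℝ => -(x : ℂ)) (-1) x := by
          simpa using (Complex.ofRealCLM.hasDerivAt (x := x)).fun_neg
        exact this.cexp
      exact ((hg' x hx).mul h2).congr_deriv (by ring)
    exact ((convex_Ioi (0 : ℝ)).is_const_of_fderivWithin_eq_zero (𝕜 := ℝ)
      (fun x hx => (hd x hx).differentiableAt.differentiableWithinAt)
      (fun x hx => by
        rw [fderivWithin_of_isOpen isOpen_Ioi hx]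
        ext; simp [(hd x hx).deriv]) hs (hs.trans_le ht))
  have hlim : Tendsto (fun t : ℝ => g t * Complex.exp (-t)) atTop (𝓝 0) := by
    have hκ := cos_angle_pos h0 h1
    refine squeeze_zero_norm' (a := fun t : ℝ => 2 * (2 / (Real.cos θ * 1)) * Real.exp (-t)) ?_ ?_
    · filter_upwards [eventually_ge_atTop 1] with t ht
      have ht0 : 0 < t := by linarith
      have e1 : ‖Complex.exp (-(t : ℂ))‖ = Real.exp (-t) := by rw [Complex.norm_exp]; simp
      rw [norm_mul, e1]
      refine mul_le_mul_of_nonneg_right ?_ (Real.exp_pos _).le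
      refine (norm_contourInt_exp_le h0 h1 (by norm_num) hb ht0).trans ?_
      gcongr
    · simpa using Real.tendsto_exp_neg_atTop_nhds_zero.const_mul (2 * (2 / (Real.cos θ * 1)))
  have h2 : Tendsto (fun t : ℝ => g t * Complex.exp (-t)) atTop
      (𝓝 (g s * Complex.exp (-s))) :=
    tendsto_const_nhds.congr' ((eventually_ge_atTop s).mono fun t ht => hconst t ht)
  have := tendsto_nhds_unique h2 hlim
  exact (mul_eq_zero.1 this).resolve_right (Complex.exp_ne_zero _)

end Scalar

/-! ### Resolvents and the analytic semigroup -/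

section Semigroup

variable {X : Type*} [NormedAddCommGroup X] [NormedSpace ℂ X] {A : X →ₗ.[ℂ] X} {θ M ω : ℝ}

/-- A densely defined operator satisfying the resolvent estimate outside the sector of half-angle
`θ`, whose exponentials decay at the rate `ω`. -/
structure IsSectorial (A : X →ₗ.[ℂ] X) (θ M ω : ℝ) : Prop where
  dense : Dense (A.domain : Set X)
  angle_pos : 0 < θ
  angle_lt : θ < Real.pi / 2
  resolvent : ∀ z ∈ sectorCompl θ, ∃ R : X →L[ℂ] X, IsResolventAt A z R ∧ ‖R‖ ≤ M / (1 + ‖z‖)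
  rate_pos : 0 < ω
  decay : ∀ s : ℝ, 0 ≤ s → ‖expNeg A θ s‖ ≤ Real.exp (-(ω * s))

lemma IsResolventAt.unique {z : ℂ} {R R' : X →L[ℂ] X} (h : IsResolventAt A z R)
    (h' : IsResolventAt A z R') : R = R' := by
  ext x
  obtain ⟨hx, e⟩ := h'.1 x
  have := h.2 ⟨R' x, hx⟩
  rw [e] at this
  exact this

namespace IsSectorial

variable (hA : IsSectorial A θ M ω)
include hA

lemma isResolventAt {z : ℂ} (hz : z ∈ sectorCompl θ) : IsResolventAt A z (resolventOp A z) := by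
  obtain ⟨R, hR, -⟩ := hA.resolvent z hz
  have h : ∃ R : X →L[ℂ] X, IsResolventAt A z R := ⟨R, hR⟩
  rw [resolventOp, dif_pos h]
  exact h.choose_spec

lemma norm_resolventOp_le {z : ℂ} (hz : z ∈ sectorCompl θ) :
    ‖resolventOp A z‖ ≤ M / (1 + ‖z‖) := by
  obtain ⟨R, hR, hn⟩ := hA.resolvent z hz
  rwa [(hA.isResolventAt hz).unique hR]

lemma bound_nonneg : 0 ≤ M := by
  have := (norm_nonneg _).trans (hA.norm_resolventOp_le (zero_mem_sectorCompl θ))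
  simpa using this

lemma norm_resolventOp_le' {z : ℂ} (hz : z ∈ sectorCompl θ) : ‖resolventOp A z‖ ≤ M :=
  (hA.norm_resolventOp_le hz).trans (div_le_self hA.bound_nonneg (by linarith [norm_nonneg z]))

lemma resolventOp_sub {z w : ℂ} (hz : z ∈ sectorCompl θ) (hw : w ∈ sectorCompl θ) :
    resolventOp A z - resolventOp A w = (w - z) • (resolventOp A z * resolventOp A w) := by
  ext x
  obtain ⟨hx, e⟩ := (hA.isResolventAt hw).1 x
  have h2 := (hA.isResolventAt hz).2 ⟨resolventOp A w x, hx⟩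
  have e' : x = (z • resolventOp A w x - A ⟨resolventOp A w x, hx⟩) +
      (w - z) • resolventOp A w x := by
    nth_rewrite 1 [← e]
    rw [sub_smul]; abel
  have h3 := congrArg (resolventOp A z) e'
  rw [map_add, map_smul, h2] at h3
  change resolventOp A z x - resolventOp A w x = (w - z) • resolventOp A z (resolventOp A w x)
  rw [h3]; abel

lemma commute_resolventOp {z w : ℂ} (hz : z ∈ sectorCompl θ) (hw : w ∈ sectorCompl θ) :
    Commute (resolventOp A z) (resolventOp A w) := by
  by_cases h : z = w
  · subst h; exact Commute.refl _
  have h1 := hA.resolventOp_sub hz hw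
  have h2 := hA.resolventOp_sub hw hz
  have : (w - z) • (resolventOp A z * resolventOp A w) =
      (w - z) • (resolventOp A w * resolventOp A z) := by
    rw [← h1, ← neg_sub, h2, ← neg_smul, neg_sub]
  exact smul_right_injective _ (sub_ne_zero.2 (Ne.symm h)) this

lemma continuousOn_resolventOp : ContinuousOn (resolventOp A) (sectorCompl θ) := by
  have hM := hA.bound_nonneg
  refine (LipschitzOnWith.of_dist_le_mul (K := Real.toNNReal (M * M)) fun z hz w hw => ?_).continuousOn
  rw [Real.coe_toNNReal _ (mul_nonneg hM hM), dist_eq_norm, dist_eq_norm, hA.resolventOp_sub hz hw,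
    norm_smul, ← norm_sub_rev w z, mul_comm]
  gcongr
  exact (norm_mul_le _ _).trans
    (mul_le_mul (hA.norm_resolventOp_le' hz) (hA.norm_resolventOp_le' hw) (norm_nonneg _) hM)

lemma differentiableAt_resolventOp {z : ℂ} (hz : z.re < ‖z‖ * Real.cos θ) :
    DifferentiableAt ℂ (resolventOp A) z := by
  have hmem := mem_sectorCompl_iff hA.angle_pos hA.angle_lt
  have hev : ∀ᶠ w in 𝓝 z, w ∈ sectorCompl θ := by
    have hopen : IsOpen {w : ℂ | w.re < ‖w‖ * Real.cos θ} :=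
      isOpen_lt Complex.continuous_re (by fun_prop)
    filter_upwards [hopen.mem_nhds hz] with w hw
    exact (hmem w).2 (le_of_lt hw)
  have hz' : z ∈ sectorCompl θ := hev.self_of_nhds
  have hcont : ContinuousAt (resolventOp A) z := hA.continuousOn_resolventOp.continuousAt hev
  have : HasDerivAt (resolventOp A) (-(resolventOp A z * resolventOp A z)) z := by
    rw [hasDerivAt_iff_tendsto_slope]
    have h1 : Tendsto (fun w => -(resolventOp A w * resolventOp A z)) (𝓝[≠] z)
        (𝓝 (-(resolventOp A z * resolventOp A z))) :=
      ((hcont.tendsto.mul_const _).neg).mono_left nhdsWithin_le_nhds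
    refine h1.congr' ?_
    filter_upwards [self_mem_nhdsWithin, nhdsWithin_le_nhds hev] with w hw hw'
    have hne : w - z ≠ 0 := sub_ne_zero.2 hw
    rw [slope_def_module, hA.resolventOp_sub hw' hz', smul_smul, ← neg_sub w z, mul_neg,
      inv_mul_cancel₀ hne, neg_one_smul]
  exact this.differentiableAt

lemma norm_resolventOp_rays {z : ℂ} (hz : z ∈ boundaryRays θ) :
    ‖resolventOp A z‖ ≤ M / (1 + ‖z‖) :=
  hA.norm_resolventOp_le (boundaryRays_subset hA.angle_pos hA.angle_lt hz)

lemma continuousOn_resolventOp_rays : ContinuousOn (resolventOp A) (boundaryRays θ) :=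
  hA.continuousOn_resolventOp.mono (boundaryRays_subset hA.angle_pos hA.angle_lt)

omit hA in
lemma expNeg_eq {s : ℝ} (hs : 0 < s) : expNeg A θ s =
    (2 * (Real.pi : ℂ) * Complex.I)⁻¹ •
      contourInt θ (fun z => Complex.exp (-z * s) • resolventOp A z) := by
  rw [expNeg, if_neg hs.ne', contourInt, rayInt, rayInt]
  simp only [smul_smul, mul_comm]

omit hA in
lemma expNeg_zero : expNeg A θ 0 = 1 := by
  rw [expNeg, if_pos rfl]

/-- The bounded operator `A e^{-sA}`, `s > 0`, given by the contour integral of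
`z e^{-zs} (zI - A)⁻¹`. -/
noncomputable def _root_.NonlocalCGL.genExpNeg (A : X →ₗ.[ℂ] X) (θ s : ℝ) : X →L[ℂ] X :=
  (2 * (Real.pi : ℂ) * Complex.I)⁻¹ •
    contourInt θ (fun z => (z * Complex.exp (-z * s)) • resolventOp A z)

lemma hasDerivAt_expNeg {s : ℝ} (hs : 0 < s) :
    HasDerivAt (expNeg A θ) (-genExpNeg A θ s) s := by
  have := (hasDerivAt_contourInt_exp_smul hA.angle_pos hA.angle_lt hA.continuousOn_resolventOp_rays
    hA.bound_nonneg (fun z hz => hA.norm_resolventOp_rays hz) hs).const_smul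
      ((2 * (Real.pi : ℂ) * Complex.I)⁻¹)
  rw [smul_neg] at this
  refine HasDerivAt.congr_of_eventuallyEq this ?_
  filter_upwards [Ioi_mem_nhds hs] with t ht
  exact expNeg_eq ht

omit hA in
lemma norm_two_pi_I_inv : ‖(2 * (Real.pi : ℂ) * Complex.I)⁻¹‖ = (2 * Real.pi)⁻¹ := by
  simp [abs_of_pos Real.pi_pos]

/-- The constant of the estimate `‖A e^{-sA}‖ ≤ C / s`. -/
noncomputable def _root_.NonlocalCGL.genConst (θ M : ℝ) : ℝ := M / (Real.pi * Real.cos θ)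

lemma genConst_nonneg : 0 ≤ genConst θ M :=
  div_nonneg hA.bound_nonneg
    (mul_nonneg Real.pi_pos.le (cos_angle_pos hA.angle_pos hA.angle_lt).le)

lemma norm_genExpNeg_le {s : ℝ} (hs : 0 < s) : ‖genExpNeg A θ s‖ ≤ genConst θ M / s := by
  have hκ := cos_angle_pos hA.angle_pos hA.angle_lt
  rw [genExpNeg, norm_smul, norm_two_pi_I_inv]
  have := norm_mul_contourInt_exp_le hA.angle_pos hA.angle_lt hA.bound_nonneg
    (fun z hz => hA.norm_resolventOp_rays hz) hs
  have hp := Real.pi_pos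
  calc _ ≤ (2 * Real.pi)⁻¹ * (2 * (M / (Real.cos θ * s))) := by gcongr
    _ = _ := by rw [genConst]; field_simp

lemma norm_expNeg_le_one {s : ℝ} (hs : 0 ≤ s) : ‖expNeg A θ s‖ ≤ 1 :=
  (hA.decay s hs).trans (Real.exp_le_one_iff.2 (by
    have := mul_nonneg hA.rate_pos.le hs; linarith))

lemma continuousOn_expNeg : ContinuousOn (expNeg A θ) (Ioi 0) :=
  fun _ hs => (hA.hasDerivAt_expNeg hs).continuousAt.continuousWithinAt

section Complete

variable [CompleteSpace X]

lemma commute_expNeg {L : X →L[ℂ] X} (hL : ∀ z ∈ sectorCompl θ, Commute L (resolventOp A z))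
    {s : ℝ} (hs : 0 < s) : Commute L (expNeg A θ s) := by
  have hi := raysIntegrable_exp_smul hA.angle_pos hA.angle_lt hA.continuousOn_resolventOp_rays
    hA.bound_nonneg (fun z hz => hA.norm_resolventOp_rays hz) hs
  rw [expNeg_eq hs]
  refine Commute.smul_right ?_ _
  have h1 := contourInt_clm (ContinuousLinearMap.mul ℂ (X →L[ℂ] X) L) hi
  have h2 := contourInt_clm ((ContinuousLinearMap.mul ℂ (X →L[ℂ] X)).flip L) hi
  simp only [ContinuousLinearMap.mul_apply', ContinuousLinearMap.flip_apply] at h1 h2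
  rw [commute_iff_eq, ← h1, ← h2]
  refine contourInt_congr fun z hz => ?_
  have := hL z (boundaryRays_subset hA.angle_pos hA.angle_lt hz)
  simp only [mul_smul_comm, smul_mul_assoc, this.eq]

lemma commute_genExpNeg {L : X →L[ℂ] X} (hL : ∀ z ∈ sectorCompl θ, Commute L (resolventOp A z))
    {s : ℝ} (hs : 0 < s) : Commute L (genExpNeg A θ s) := by
  have hi := raysIntegrable_mul_exp_smul hA.angle_pos hA.angle_lt hA.continuousOn_resolventOp_rays
    hA.bound_nonneg (fun z hz => hA.norm_resolventOp_rays hz) hs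
  rw [genExpNeg]
  refine Commute.smul_right ?_ _
  have h1 := contourInt_clm (ContinuousLinearMap.mul ℂ (X →L[ℂ] X) L) hi
  have h2 := contourInt_clm ((ContinuousLinearMap.mul ℂ (X →L[ℂ] X)).flip L) hi
  simp only [ContinuousLinearMap.mul_apply', ContinuousLinearMap.flip_apply] at h1 h2
  rw [commute_iff_eq, ← h1, ← h2]
  refine contourInt_congr fun z hz => ?_
  have := hL z (boundaryRays_subset hA.angle_pos hA.angle_lt hz)
  simp only [mul_smul_comm, smul_mul_assoc, this.eq]

/-- `A⁻¹ (A e^{-sA}) = e^{-sA}`, where `A⁻¹ = -(0 - A)⁻¹`. -/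
lemma resolventOp_zero_mul_genExpNeg {s : ℝ} (hs : 0 < s) :
    resolventOp A 0 * genExpNeg A θ s = -expNeg A θ s := by
  have h0 := hA.angle_pos
  have h1 := hA.angle_lt
  have hi := raysIntegrable_mul_exp_smul h0 h1 hA.continuousOn_resolventOp_rays
    hA.bound_nonneg (fun z hz => hA.norm_resolventOp_rays hz) hs
  have hi' := raysIntegrable_exp_smul h0 h1 hA.continuousOn_resolventOp_rays
    hA.bound_nonneg (fun z hz => hA.norm_resolventOp_rays hz) hs
  have hexp : RaysIntegrable θ (fun z => Complex.exp (-z * s)) :=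
    RaysIntegrable.of_le (by fun_prop) (integrableOn_exp_decay (cos_angle_pos h0 h1) hs 1)
      fun e he r hr => by rw [norm_exp_ray he, one_mul]
  have hexp' : RaysIntegrable θ (fun z => Complex.exp (-z * s) • resolventOp A 0) :=
    fun e he => (hexp e he).smul_const _
  have e1 := contourInt_clm (ContinuousLinearMap.mul ℂ (X →L[ℂ] X) (resolventOp A 0)) hi
  have e2 := contourInt_clm ((ContinuousLinearMap.id ℂ ℂ).smulRight (resolventOp A 0)) hexp
  simp only [ContinuousLinearMap.mul_apply', ContinuousLinearMap.smulRight_apply,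
    ContinuousLinearMap.id_apply] at e1 e2
  rw [genExpNeg, expNeg_eq hs, mul_smul_comm, ← e1, ← smul_neg]
  congr 1
  have e3 : EqOn (fun z => resolventOp A 0 * (z * Complex.exp (-z * s)) • resolventOp A z)
      (fun z => Complex.exp (-z * s) • resolventOp A 0 - Complex.exp (-z * s) • resolventOp A z)
      (boundaryRays θ) := by
    intro z hz
    have h := hA.resolventOp_sub (zero_mem_sectorCompl θ) (boundaryRays_subset h0 h1 hz)
    simp only
    rw [← smul_sub, h, sub_zero, smul_smul, mul_smul_comm, mul_comm]
  rw [contourInt_congr e3, contourInt_sub hexp' hi', e2, contourInt_exp h0 h1 hs]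
  simp

lemma genExpNeg_mul_resolventOp_zero {s : ℝ} (hs : 0 < s) :
    genExpNeg A θ s * resolventOp A 0 = -expNeg A θ s := by
  rw [← hA.resolventOp_zero_mul_genExpNeg hs]
  exact (hA.commute_genExpNeg
    (fun z hz => hA.commute_resolventOp (zero_mem_sectorCompl θ) hz) hs).eq.symm

lemma exists_mem_domain_expNeg {s : ℝ} (hs : 0 < s) (x : X) :
    ∃ h : expNeg A θ s x ∈ A.domain, A ⟨expNeg A θ s x, h⟩ = genExpNeg A θ s x := by
  obtain ⟨h, e⟩ := (hA.isResolventAt (zero_mem_sectorCompl θ)).1 (-genExpNeg A θ s x)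
  have e2 : resolventOp A 0 (-genExpNeg A θ s x) = expNeg A θ s x := by
    have := congrArg (fun L : X →L[ℂ] X => L x) (hA.resolventOp_zero_mul_genExpNeg hs)
    simp only [mul_apply_eq_comp, neg_apply] at this
    rw [map_neg, this, neg_neg]
  simp only [e2, zero_smul, zero_sub, neg_inj] at e h
  exact ⟨h, e⟩

lemma genExpNeg_apply_of_mem {s : ℝ} (hs : 0 < s) (x : A.domain) :
    genExpNeg A θ s x = expNeg A θ s (A x) := by
  have h := (hA.isResolventAt (zero_mem_sectorCompl θ)).2 x
  rw [zero_smul, zero_sub, map_neg] at h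
  have := congrArg (fun L : X →L[ℂ] X => L (A x)) (hA.genExpNeg_mul_resolventOp_zero hs)
  simp only [mul_apply_eq_comp, neg_apply] at this
  rw [← h, map_neg, this, neg_neg]

/-- Cauchy's theorem enters here: closing the contour to the left gives the residue of
`(1 + z)⁻¹ (z - A)⁻¹` at `z = -1`. The pole is removed by splitting off a scalar multiple of
`(1 - z²)⁻¹`, whose other pole lies inside the sector. -/
lemma contourInt_inv_one_add_smul_resolventOp :
    contourInt θ (fun z => (1 + z)⁻¹ • resolventOp A z) =
      -(2 * (Real.pi : ℂ) * Complex.I) • resolventOp A (-1) := by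
  have h0 := hA.angle_pos
  have h1 := hA.angle_lt
  have hM := hA.bound_nonneg
  have hg := gapConst_pos h0 h1
  set Q : X →L[ℂ] X := (2 : ℂ) • resolventOp A (-1) + 1 with hQ
  have e1 : EqOn (fun z => (1 + z)⁻¹ • resolventOp A z)
      (fun z => (2 * ((1 + z)⁻¹ * (1 - z)⁻¹)) • resolventOp A (-1) -
        (1 - z)⁻¹ • (resolventOp A z * Q)) (boundaryRays θ) := by
    intro z hz
    have hz' := boundaryRays_subset h0 h1 hz
    have hne1 := one_add_ne_zero h0 h1 hz
    have hne2 := one_sub_ne_zero h0 h1 hz'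
    have h := hA.resolventOp_sub hz' (neg_one_mem_sectorCompl h1)
    have h2 : resolventOp A z * resolventOp A (-1) =
        (1 + z)⁻¹ • resolventOp A (-1) - (1 + z)⁻¹ • resolventOp A z := by
      have e : (-1 - z) = -(1 + z) := by ring
      rw [← smul_sub, eq_inv_smul_iff₀ hne1, ← neg_sub, h, e, neg_smul, neg_neg]
    simp only [hQ]
    rw [mul_add, mul_one, mul_smul_comm, h2]
    match_scalars
    · field_simp
      ring
    · field_simp
      ring
  have hF : ContinuousOn (fun z => (1 - z)⁻¹ • (resolventOp A z * Q)) (sectorCompl θ) :=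
    (continuousOn_inv_one_sub h0 h1).smul (hA.continuousOn_resolventOp.mul_const Q)
  have hb : ∀ z ∈ sectorCompl θ, ‖(1 - z)⁻¹ • (resolventOp A z * Q)‖ ≤
      ((gapConst θ)⁻¹ * (M * ‖Q‖)) / (1 + ‖z‖ ^ 2) := by
    intro z hz
    rw [norm_smul]
    refine le_trans ?_ (mul_div_one_add_le_div_sq (inv_nonneg.2 hg.le)
      (mul_nonneg hM (norm_nonneg Q)) (norm_nonneg z))
    refine mul_le_mul (norm_inv_one_sub_le h0 h1 hz) ?_ (norm_nonneg _) (by positivity)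
    refine (norm_mul_le _ _).trans ?_
    rw [mul_div_right_comm]
    exact mul_le_mul_of_nonneg_right (hA.norm_resolventOp_le hz) (norm_nonneg _)
  have hz0 := contourInt_eq_zero h0 h1 hF (fun z hz => ?_) hb
  · have hi : RaysIntegrable θ (fun z => (1 - z)⁻¹ • (resolventOp A z * Q)) := by
      refine RaysIntegrable.of_le (hF.mono (boundaryRays_subset h0 h1))
        (integrableOn_inv_one_add_sq ((gapConst θ)⁻¹ * (M * ‖Q‖))) fun e he r hr => ?_
      have := hb _ (he.mem h0 h1 hr.le)
      rwa [he.norm_point hr.le] at this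
    have hi' := raysIntegrable_inv_one_sub_sq h0 h1
    have hi2 : RaysIntegrable θ
        (fun z => (2 * ((1 + z)⁻¹ * (1 - z)⁻¹)) • resolventOp A (-1)) :=
      fun e he => (hi' e he).smul_const _
    have e2 := contourInt_clm ((ContinuousLinearMap.id ℂ ℂ).smulRight (resolventOp A (-1))) hi'
    simp only [ContinuousLinearMap.smulRight_apply, ContinuousLinearMap.id_apply] at e2
    rw [contourInt_congr e1, contourInt_sub hi2 hi, hz0, e2,
      contourInt_inv_one_sub_sq h0 h1, sub_zero]
  · have hz' : z ∈ sectorCompl θ := (mem_sectorCompl_iff h0 h1 z).2 hz.le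
    have hne := one_sub_ne_zero h0 h1 hz'
    exact (((differentiableAt_const 1).sub differentiableAt_id).inv hne).smul
      ((hA.differentiableAt_resolventOp hz).mul_const Q)

lemma expNeg_mul_resolventOp_neg_one {s : ℝ} (hs : 0 < s) :
    expNeg A θ s * resolventOp A (-1) = -((2 * (Real.pi : ℂ) * Complex.I)⁻¹ •
      contourInt θ (fun z => Complex.exp (-z * s) • (1 + z)⁻¹ • resolventOp A z)) := by
  have h0 := hA.angle_pos
  have h1 := hA.angle_lt
  have hM := hA.bound_nonneg
  have hi := raysIntegrable_exp_smul h0 h1 hA.continuousOn_resolventOp_rays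
    hM (fun z hz => hA.norm_resolventOp_rays hz) hs
  have hi1 := raysIntegrable_exp_smul h0 h1 (continuousOn_inv_one_add h0 h1) (M := 2) (by norm_num)
    (fun z hz => norm_inv_one_add_le h0 h1 hz) hs
  have hi2 : RaysIntegrable θ
      (fun z => Complex.exp (-z * s) • (1 + z)⁻¹ • resolventOp A z) := by
    refine raysIntegrable_exp_smul h0 h1 (F := fun z => (1 + z)⁻¹ • resolventOp A z)
      ((continuousOn_inv_one_add h0 h1).smul hA.continuousOn_resolventOp_rays) (M := 2 * M) (by positivity) (fun z hz => ?_) hs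
    rw [norm_smul, mul_div_right_comm]
    exact mul_le_mul (norm_inv_one_add_le h0 h1 hz)
      (hA.norm_resolventOp_le' (boundaryRays_subset h0 h1 hz)) (norm_nonneg _) (by positivity)
  have hi3 : RaysIntegrable θ
      (fun z => (Complex.exp (-z * s) • (1 + z)⁻¹) • resolventOp A (-1)) :=
    fun e he => (hi1 e he).smul_const _
  have e1 := contourInt_clm ((ContinuousLinearMap.mul ℂ (X →L[ℂ] X)).flip (resolventOp A (-1))) hi
  have e2 := contourInt_clm ((ContinuousLinearMap.id ℂ ℂ).smulRight (resolventOp A (-1))) hi1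
  simp only [ContinuousLinearMap.mul_apply', ContinuousLinearMap.flip_apply,
    ContinuousLinearMap.smulRight_apply, ContinuousLinearMap.id_apply] at e1 e2
  rw [expNeg_eq hs, smul_mul_assoc, ← e1, ← smul_neg]
  congr 1
  have e3 : EqOn (fun z => Complex.exp (-z * s) • resolventOp A z * resolventOp A (-1))
      (fun z => (Complex.exp (-z * s) • (1 + z)⁻¹) • resolventOp A (-1) -
        Complex.exp (-z * s) • (1 + z)⁻¹ • resolventOp A z) (boundaryRays θ) := by
    intro z hz
    have hne1 := one_add_ne_zero h0 h1 hz
    have h := hA.resolventOp_sub (boundaryRays_subset h0 h1 hz) (neg_one_mem_sectorCompl h1)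
    have h2 : resolventOp A z * resolventOp A (-1) =
        (1 + z)⁻¹ • resolventOp A (-1) - (1 + z)⁻¹ • resolventOp A z := by
      have e : (-1 - z) = -(1 + z) := by ring
      rw [← smul_sub, eq_inv_smul_iff₀ hne1, ← neg_sub, h, e, neg_smul, neg_neg]
    simp only
    rw [smul_mul_assoc, h2, smul_sub, smul_assoc]
  rw [contourInt_congr e3, contourInt_sub hi3 hi2, e2,
    contourInt_exp_smul_inv_one_add h0 h1 hs]
  simp

lemma tendsto_expNeg_mul_resolventOp :
    Tendsto (fun s => expNeg A θ s * resolventOp A (-1)) (𝓝[>] 0) (𝓝 (resolventOp A (-1))) := by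
  have h0 := hA.angle_pos
  have h1 := hA.angle_lt
  have hM := hA.bound_nonneg
  have hlim := tendsto_contourInt_exp_smul (C := 2 * M) h0 h1
    (F := fun z => (1 + z)⁻¹ • resolventOp A z) ((continuousOn_inv_one_add h0 h1).smul
    hA.continuousOn_resolventOp_rays) (fun z hz => by
      rw [norm_smul]
      exact (mul_le_mul (norm_inv_one_add_le h0 h1 hz) (hA.norm_resolventOp_rays hz)
        (norm_nonneg _) (by positivity)).trans
          (mul_div_one_add_le_div_sq (by norm_num) hM (norm_nonneg z)))
  have hne : (2 * (Real.pi : ℂ) * Complex.I) ≠ 0 := Complex.two_pi_I_ne_zero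
  have := (hlim.const_smul ((2 * (Real.pi : ℂ) * Complex.I)⁻¹)).neg
  rw [hA.contourInt_inv_one_add_smul_resolventOp, neg_smul, smul_neg, neg_neg,
    inv_smul_smul₀ hne] at this
  refine this.congr' ?_
  filter_upwards [self_mem_nhdsWithin] with s hs
  exact (hA.expNeg_mul_resolventOp_neg_one hs).symm

/-- Strong continuity of the semigroup at `0`. -/
theorem tendsto_expNeg_apply (x : X) :
    Tendsto (fun s => expNeg A θ s x) (𝓝[>] 0) (𝓝 x) := by
  rw [Metric.tendsto_nhds]
  intro ε hε
  obtain ⟨y, hy, hxy⟩ := Metric.dense_iff.1 hA.dense x (ε / 3) (by linarith)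
  have hyR := (hA.isResolventAt (neg_one_mem_sectorCompl hA.angle_lt)).2 ⟨y, hxy⟩
  set w := (-1 : ℂ) • y - A ⟨y, hxy⟩
  have hlim : Tendsto (fun s => expNeg A θ s y) (𝓝[>] 0) (𝓝 y) := by
    have := (ContinuousLinearMap.apply ℂ X w).continuous.continuousAt.tendsto.comp
      hA.tendsto_expNeg_mul_resolventOp
    simp only [ContinuousLinearMap.apply_apply] at this
    rw [hyR] at this
    refine this.congr fun s => ?_
    simp only [Function.comp_apply, ContinuousLinearMap.apply_apply,
      mul_apply_eq_comp]
    rw [hyR]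
  filter_upwards [self_mem_nhdsWithin, Metric.tendsto_nhds.1 hlim (ε / 3) (by linarith)]
    with s hs hsy
  have h1 : dist (expNeg A θ s x) (expNeg A θ s y) ≤ dist x y := by
    rw [dist_eq_norm, dist_eq_norm, ← map_sub]
    exact ((expNeg A θ s).le_opNorm _).trans
      (mul_le_of_le_one_left (norm_nonneg _) (hA.norm_expNeg_le_one (le_of_lt hs)))
  have h2 : dist x y < ε / 3 := by rw [dist_comm]; exact hy
  have h3 := dist_triangle (expNeg A θ s x) (expNeg A θ s y) x
  have h4 := dist_triangle (expNeg A θ s y) y x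
  rw [dist_comm y x] at h4
  linarith

/-- The two factors commute because `A⁻¹ (A e^{-sA}) = e^{-sA}`: both sides equal
`A e^{-tA} A⁻¹ A e^{-sA}`. -/
lemma expNeg_mul_genExpNeg {s t : ℝ} (hs : 0 < s) (ht : 0 < t) :
    expNeg A θ t * genExpNeg A θ s = genExpNeg A θ t * expNeg A θ s := by
  have h1 := hA.genExpNeg_mul_resolventOp_zero ht
  have h2 := hA.resolventOp_zero_mul_genExpNeg hs
  rw [← neg_eq_iff_eq_neg] at h1 h2
  rw [← h1, ← h2, neg_mul, mul_neg, mul_assoc]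

/-- The semigroup law: `s ↦ e^{-(t-s)A} e^{-sA}` has derivative `0`. -/
theorem expNeg_add {s t : ℝ} (hs : 0 ≤ s) (ht : 0 ≤ t) :
    expNeg A θ (s + t) = expNeg A θ s * expNeg A θ t := by
  rcases hs.eq_or_lt with rfl | hs
  · rw [zero_add, expNeg_zero, one_mul]
  rcases ht.eq_or_lt with rfl | ht
  · rw [add_zero, expNeg_zero, mul_one]
  set u := s + t with hu
  have hd : ∀ r ∈ Ioo 0 u,
      HasDerivAt (fun r => expNeg A θ (u - r) * expNeg A θ r) 0 r := by
    intro r hr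
    have hur : 0 < u - r := by linarith [hr.2]
    have h1 : HasDerivAt (fun r => expNeg A θ (u - r)) (genExpNeg A θ (u - r)) r := by
      have := HasDerivAt.scomp r (hA.hasDerivAt_expNeg hur) ((hasDerivAt_id r).const_sub u)
      rw [neg_one_smul, neg_neg] at this
      exact this
    refine (h1.mul (hA.hasDerivAt_expNeg hr.1)).congr_deriv ?_
    rw [mul_neg, hA.expNeg_mul_genExpNeg hr.1 hur]
    abel
  have hconst : ∀ r ∈ Ioo 0 u, expNeg A θ (u - r) * expNeg A θ r = expNeg A θ s * expNeg A θ t := by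
    intro r hr
    have := (convex_Ioo (0 : ℝ) u).is_const_of_fderivWithin_eq_zero (𝕜 := ℝ)
      (f := fun r => expNeg A θ (u - r) * expNeg A θ r)
      (fun x hx => (hd x hx).differentiableAt.differentiableWithinAt)
      (fun x hx => by
        rw [fderivWithin_of_isOpen isOpen_Ioo hx]
        ext; simp [(hd x hx).hasFDerivAt.fderiv]) hr (show t ∈ Ioo 0 u from ⟨ht, by linarith⟩)
    rw [this, hu, add_sub_cancel_right]
  -- `r → 0`, where `e^{-rA}` converges only strongly
  ext x
  have hu0 : 0 < u := by linarith
  have hl1 : Tendsto (fun r => expNeg A θ (u - r)) (𝓝[>] 0) (𝓝 (expNeg A θ u)) := by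
    have hc : ContinuousAt (fun r => expNeg A θ (u - r)) 0 := by
      refine ContinuousAt.comp (g := expNeg A θ) ?_ (by fun_prop)
      rw [sub_zero]
      exact (hA.hasDerivAt_expNeg hu0).continuousAt
    have := hc.tendsto
    rw [sub_zero] at this
    exact this.mono_left nhdsWithin_le_nhds
  have hl2 := ((isBoundedBilinearMap_apply (𝕜 := ℂ) (E := X) (F := X)).continuous.tendsto
    (expNeg A θ u, x)).comp (hl1.prodMk_nhds (hA.tendsto_expNeg_apply x))
  refine tendsto_nhds_unique hl2 (tendsto_const_nhds.congr' ?_)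
  filter_upwards [Ioo_mem_nhdsGT hu0] with r hr
  rw [← hconst r hr]
  rfl

lemma continuousOn_expNeg_apply {S : Set ℝ} {a : ℝ → ℝ} {g : ℝ → X} (ha : ContinuousOn a S)
    (ha0 : ∀ r ∈ S, 0 ≤ a r) (hg : ContinuousOn g S) :
    ContinuousOn (fun r => expNeg A θ (a r) (g r)) S := by
  have h1 : ∀ x : X, ContinuousOn (fun s => expNeg A θ s x) (Ici 0) := by
    intro x s hs
    rcases (mem_Ici.1 hs).eq_or_lt with rfl | hs
    · rw [← continuousWithinAt_Ioi_iff_Ici, ContinuousWithinAt, expNeg_zero]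
      exact hA.tendsto_expNeg_apply x
    · exact ((hA.hasDerivAt_expNeg hs).continuousAt.clm_apply
        continuousAt_const).continuousWithinAt
  intro r hr
  rw [ContinuousWithinAt, tendsto_iff_norm_sub_tendsto_zero]
  have h2 : Tendsto (fun r' => ‖g r' - g r‖ +
      ‖expNeg A θ (a r') (g r) - expNeg A θ (a r) (g r)‖) (𝓝[S] r) (𝓝 (0 + 0)) := by
    refine ((tendsto_iff_norm_sub_tendsto_zero.1 (hg r hr))).add
      (tendsto_iff_norm_sub_tendsto_zero.1 ?_)
    exact ((h1 (g r)).comp ha ha0) r hr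
  rw [add_zero] at h2
  refine squeeze_zero' (Eventually.of_forall fun _ => norm_nonneg _) ?_ h2
  filter_upwards [self_mem_nhdsWithin] with r' hr'
  have e : expNeg A θ (a r') (g r') - expNeg A θ (a r) (g r) =
      expNeg A θ (a r') (g r' - g r) + (expNeg A θ (a r') (g r) - expNeg A θ (a r) (g r)) := by
    rw [map_sub]; abel
  rw [e]
  refine (norm_add_le _ _).trans (add_le_add_left ?_ _)
  exact ((expNeg A θ (a r')).le_opNorm _).trans
    (mul_le_of_le_one_left (norm_nonneg _) (hA.norm_expNeg_le_one (ha0 r' hr')))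

end Complete

end IsSectorial

end Semigroup

/-! ### Fractional powers -/

section FractionalPowers

/-- `∫₀^∞ u^{-γ} / (1 + u) du`. -/
noncomputable def stieltjesConst (γ : ℝ) : ℝ := ∫ u in Ioi (0 : ℝ), u ^ (-γ) * (1 + u)⁻¹

lemma integrableOn_stieltjes {γ : ℝ} (h0 : 0 < γ) (h1 : γ < 1) :
    IntegrableOn (fun u : ℝ => u ^ (-γ) * (1 + u)⁻¹) (Ioi 0) := by
  have hmeas : ∀ S ⊆ Ioi (0 : ℝ), MeasurableSet S →
      AEStronglyMeasurable (fun u : ℝ => u ^ (-γ) * (1 + u)⁻¹) (volume.restrict S) := by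
    intro S hS hm
    refine ContinuousOn.aestronglyMeasurable (fun u hu => ?_) hm
    have hu : 0 < u := hS hu
    exact ((Real.continuousAt_rpow_const _ _ (Or.inl hu.ne')).mul
      ((by fun_prop : ContinuousAt (fun u : ℝ => 1 + u) u).inv₀
        (by linarith))).continuousWithinAt
  rw [← Ioc_union_Ioi_eq_Ioi (zero_le_one' ℝ)]
  refine IntegrableOn.union ?_ ?_
  · have hi : IntegrableOn (fun u : ℝ => u ^ (-γ)) (Ioc 0 1) := by
      rw [← intervalIntegrable_iff_integrableOn_Ioc_of_le zero_le_one]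
      exact intervalIntegral.intervalIntegrable_rpow' (by linarith)
    refine Integrable.mono' hi (hmeas _ Ioc_subset_Ioi_self measurableSet_Ioc) ?_
    refine (ae_restrict_iff' measurableSet_Ioc).2 (ae_of_all _ fun u hu => ?_)
    have hu0 : 0 < u := hu.1
    rw [Real.norm_of_nonneg (by positivity)]
    exact mul_le_of_le_one_right (by positivity) (inv_le_one_of_one_le₀ (by linarith))
  · refine Integrable.mono' (integrableOn_Ioi_rpow_of_lt (a := -γ - 1) (by linarith) one_pos)
      (hmeas _ (Ioi_subset_Ioi zero_le_one) measurableSet_Ioi) ?_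
    refine (ae_restrict_iff' measurableSet_Ioi).2 (ae_of_all _ fun u hu => ?_)
    have hu0 : 0 < u := lt_trans one_pos hu
    rw [Real.norm_of_nonneg (by positivity), Real.rpow_sub_one hu0.ne', div_eq_mul_inv]
    gcongr
    linarith

lemma rpow_scaling {γ r u : ℝ} (hr : 0 < r) (hu : 0 < u) :
    (r * u) ^ (-γ) * (r + r * u)⁻¹ = r ^ (-γ) * r⁻¹ * (u ^ (-γ) * (1 + u)⁻¹) := by
  rw [Real.mul_rpow hr.le hu.le]
  have : r + r * u = r * (1 + u) := by ring
  rw [this, mul_inv]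
  ring

lemma integrableOn_stieltjes_scaled {γ r : ℝ} (h0 : 0 < γ) (h1 : γ < 1) (hr : 0 < r) :
    IntegrableOn (fun u : ℝ => u ^ (-γ) * (r + u)⁻¹) (Ioi 0) := by
  have := (integrableOn_Ioi_comp_mul_left_iff (fun u : ℝ => u ^ (-γ) * (r + u)⁻¹) 0 hr).1 ?_
  · rwa [mul_zero] at this
  · refine IntegrableOn.congr_fun ((integrableOn_stieltjes h0 h1).const_mul (r ^ (-γ) * r⁻¹))
      (fun u hu => ?_) measurableSet_Ioi
    exact (rpow_scaling hr hu).symm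

lemma integral_stieltjes_scaled {γ r : ℝ} (hr : 0 < r) :
    ∫ u in Ioi (0 : ℝ), u ^ (-γ) * (r + u)⁻¹ = r ^ (-γ) * stieltjesConst γ := by
  have h := integral_comp_mul_left_Ioi (fun u : ℝ => u ^ (-γ) * (r + u)⁻¹) 0 hr
  rw [mul_zero, smul_eq_mul, inv_mul_eq_div, eq_div_iff hr.ne'] at h
  rw [← h, stieltjesConst, setIntegral_congr_fun measurableSet_Ioi
    (fun u hu => rpow_scaling (γ := γ) hr hu), integral_const_mul]
  field_simp

/-- The Beta integral `∫₀ˣ t^{γ-1} (x-t)^{-γ} dt = Γ(γ) Γ(1-γ)`. -/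
lemma integral_beta {γ x : ℝ} (h0 : 0 < γ) (h1 : γ < 1) (hx : 0 < x) :
    ∫ t in (0 : ℝ)..x, ((t ^ (γ - 1) : ℝ) : ℂ) * (((x - t) ^ (-γ) : ℝ) : ℂ) =
      (Real.Gamma γ : ℂ) * (Real.Gamma (1 - γ) : ℂ) := by
  have h := Complex.betaIntegral_scaled (γ : ℂ) ((1 - γ : ℝ) : ℂ) hx
  have hB := Complex.Gamma_mul_Gamma_eq_betaIntegral (s := (γ : ℂ)) (t := ((1 - γ : ℝ) : ℂ))
    (by simpa using h0) (by rw [Complex.ofReal_re]; linarith)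
  have e : (γ : ℂ) + ((1 - γ : ℝ) : ℂ) = 1 := by push_cast; ring
  rw [e, Complex.Gamma_one, one_mul, Complex.Gamma_ofReal, Complex.Gamma_ofReal] at hB
  rw [e, sub_self, Complex.cpow_zero, one_mul, ← hB] at h
  rw [← h]
  refine intervalIntegral.integral_congr_ae (ae_of_all _ fun t ht => ?_)
  rw [uIoc_of_le hx.le] at ht
  rw [Complex.ofReal_cpow ht.1.le, Complex.ofReal_cpow (by linarith [ht.2])]
  push_cast
  congr 2
  ring

lemma continuousOn_rpow_ofReal (a : ℝ) :
    ContinuousOn (fun s : ℝ => ((s ^ a : ℝ) : ℂ)) (Ioi 0) :=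
  Complex.continuous_ofReal.comp_continuousOn fun _ hs =>
    (Real.continuousAt_rpow_const _ _ (Or.inl (ne_of_gt hs))).continuousWithinAt

variable {X : Type*} [NormedAddCommGroup X] [NormedSpace ℂ X] {A : X →ₗ.[ℂ] X} {θ M ω γ : ℝ}

/-- The bounded operator `A^γ e^{-rA}`, `r > 0`, as
`Γ(1-γ)⁻¹ ∫₀^∞ u^{-γ} A e^{-(r+u)A} du` for `γ > 0`. -/
noncomputable def fracExp (A : X →ₗ.[ℂ] X) (θ γ r : ℝ) : X →L[ℂ] X :=
  if γ = 0 then expNeg A θ r else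
    ((Real.Gamma (1 - γ))⁻¹ : ℂ) •
      ∫ u in Ioi (0 : ℝ), ((u ^ (-γ) : ℝ) : ℂ) • genExpNeg A θ (r + u)

/-- A constant in the estimate `‖A^γ e^{-rA}‖ ≤ C r^{-γ}`. -/
noncomputable def fracConst (θ M γ : ℝ) : ℝ :=
  if γ = 0 then 1 else (Real.Gamma (1 - γ))⁻¹ * (genConst θ M * stieltjesConst γ)

lemma stieltjesConst_nonneg (γ : ℝ) : 0 ≤ stieltjesConst γ :=
  setIntegral_nonneg measurableSet_Ioi fun u hu => by
    have hu : 0 < u := hu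
    positivity

lemma mem_fracPow_domain {y : X} :
    y ∈ (fracPow A θ γ).domain ↔ ∃ x, negPow A θ γ x = y := by
  rw [fracPow, LinearPMap.inverse_domain, LinearMap.mem_range]
  constructor
  · rintro ⟨x, hx⟩
    exact ⟨x, hx⟩
  · rintro ⟨x, hx⟩
    exact ⟨⟨x, trivial⟩, hx⟩

lemma negPow_mem_fracPow_domain (x : X) : negPow A θ γ x ∈ (fracPow A θ γ).domain := by
  rw [fracPow, LinearPMap.inverse_domain, LinearMap.mem_range]
  exact ⟨⟨x, trivial⟩, rfl⟩

namespace IsSectorial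

variable (hA : IsSectorial A θ M ω)
include hA

lemma fracConst_nonneg (h1 : γ < 1) : 0 ≤ fracConst θ M γ := by
  rw [fracConst]
  split_ifs
  · exact zero_le_one
  · exact mul_nonneg (inv_nonneg.2 (Real.Gamma_pos_of_pos (by linarith)).le)
      (mul_nonneg hA.genConst_nonneg (stieltjesConst_nonneg γ))

lemma integrableOn_negPow (h0 : 0 < γ) :
    IntegrableOn (fun s : ℝ => ((s ^ (γ - 1) : ℝ) : ℂ) • expNeg A θ s) (Ioi 0) := by
  have hi := integrableOn_rpow_mul_exp_neg_mul_rpow (s := γ - 1) (p := 1) (b := ω) (by linarith)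
    one_pos hA.rate_pos
  refine Integrable.mono' hi ?_ ((ae_restrict_iff' measurableSet_Ioi).2 (ae_of_all _ fun s hs => ?_))
  · exact ((continuousOn_rpow_ofReal (γ - 1)).smul
      hA.continuousOn_expNeg).aestronglyMeasurable measurableSet_Ioi
  · have hs : 0 < s := hs
    rw [norm_smul, Complex.norm_real, Real.norm_of_nonneg (by positivity), Real.rpow_one]
    have := hA.decay s hs.le
    rw [← neg_mul] at this
    gcongr

variable [CompleteSpace X]

lemma expNeg_mul_genExpNeg_eq {s t : ℝ} (ht : 0 ≤ t) (hs : 0 < s) :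
    expNeg A θ t * genExpNeg A θ s = genExpNeg A θ (t + s) := by
  have h1 : HasDerivAt (fun s => expNeg A θ t * expNeg A θ s)
      (expNeg A θ t * -genExpNeg A θ s) s := (hA.hasDerivAt_expNeg hs).const_mul _
  have h2 : HasDerivAt (fun s => expNeg A θ (t + s)) (-genExpNeg A θ (t + s)) s := by
    have := HasDerivAt.scomp s (hA.hasDerivAt_expNeg (add_pos_of_nonneg_of_pos ht hs))
      ((hasDerivAt_id s).const_add t)
    rw [one_smul] at this
    exact this
  have h3 : (fun s => expNeg A θ (t + s)) =ᶠ[𝓝 s] fun s => expNeg A θ t * expNeg A θ s := by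
    filter_upwards [Ioi_mem_nhds hs] with r hr
    exact hA.expNeg_add ht (le_of_lt hr)
  have := h2.unique (h1.congr_of_eventuallyEq h3)
  rw [mul_neg, neg_inj] at this
  exact this.symm

omit hA [CompleteSpace X] in
lemma commute_of_hasDerivAt {F : ℝ → X →L[ℂ] X} {F' L : X →L[ℂ] X} {s : ℝ}
    (hF : HasDerivAt F F' s) (hL : ∀ᶠ r in 𝓝 s, Commute L (F r)) : Commute L F' := by
  have h1 : HasDerivAt (fun r => L * F r) (L * F') s := hF.const_mul _
  have h2 : HasDerivAt (fun r => F r * L) (F' * L) s := hF.mul_const _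
  exact h1.unique (h2.congr_of_eventuallyEq (hL.mono fun r hr => hr.eq))

omit [CompleteSpace X] in
lemma commute_genExpNeg_of_expNeg {L : X →L[ℂ] X} (hL : ∀ s, 0 < s → Commute L (expNeg A θ s))
    {s : ℝ} (hs : 0 < s) : Commute L (genExpNeg A θ s) := by
  have := commute_of_hasDerivAt (hA.hasDerivAt_expNeg hs) (L := L) (by
    filter_upwards [Ioi_mem_nhds hs] with r hr using hL r hr)
  rwa [Commute.neg_right_iff] at this

omit hA in
lemma commute_integral {L : X →L[ℂ] X} {F : ℝ → X →L[ℂ] X} {μ : Measure ℝ} (hF : Integrable F μ)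
    (hL : ∀ᵐ s ∂μ, Commute L (F s)) : Commute L (∫ s, F s ∂μ) := by
  have h1 := (ContinuousLinearMap.mul ℂ (X →L[ℂ] X) L).integral_comp_comm hF
  have h2 := ((ContinuousLinearMap.mul ℂ (X →L[ℂ] X)).flip L).integral_comp_comm hF
  simp only [ContinuousLinearMap.mul_apply', ContinuousLinearMap.flip_apply] at h1 h2
  rw [commute_iff_eq, ← h1, ← h2]
  exact integral_congr_ae (hL.mono fun s hs => hs.eq)

lemma commute_expNeg_expNeg {s t : ℝ} (hs : 0 ≤ s) (ht : 0 ≤ t) :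
    Commute (expNeg A θ s) (expNeg A θ t) := by
  rw [commute_iff_eq, ← hA.expNeg_add hs ht, ← hA.expNeg_add ht hs, add_comm]

lemma commute_negPow {L : X →L[ℂ] X} (h0 : 0 ≤ γ)
    (hL : ∀ s, 0 < s → Commute L (expNeg A θ s)) : Commute L (negPow A θ γ) := by
  rw [negPow]
  split_ifs with h
  · exact Commute.one_right _
  · have h0' : 0 < γ := lt_of_le_of_ne h0 (Ne.symm h)
    refine Commute.smul_right (commute_integral (hA.integrableOn_negPow h0') ?_) _
    exact (ae_restrict_iff' measurableSet_Ioi).2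
      (ae_of_all _ fun s hs => (hL s hs).smul_right _)

lemma continuousOn_genExpNeg : ContinuousOn (genExpNeg A θ) (Ioi 0) := by
  intro s hs
  have hs : 0 < s := hs
  have hc : ContinuousAt (fun r => expNeg A θ (r - s / 2) * genExpNeg A θ (s / 2)) s := by
    refine ContinuousAt.mul (ContinuousAt.comp (g := expNeg A θ) ?_ (by fun_prop))
      continuousAt_const
    exact (hA.hasDerivAt_expNeg (by linarith)).continuousAt
  refine (hc.congr ?_).continuousWithinAt
  filter_upwards [Ioi_mem_nhds (show s / 2 < s by linarith)] with r hr
  have hr : s / 2 < r := hr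
  rw [hA.expNeg_mul_genExpNeg_eq (by linarith) (by linarith)]
  congr 1
  ring

lemma integrableOn_fracExp (h0 : 0 < γ) (h1 : γ < 1) {r : ℝ} (hr : 0 < r) :
    IntegrableOn (fun u : ℝ => ((u ^ (-γ) : ℝ) : ℂ) • genExpNeg A θ (r + u)) (Ioi 0) := by
  have hi := (integrableOn_stieltjes_scaled h0 h1 hr).const_mul (genConst θ M)
  refine Integrable.mono' hi ?_ ((ae_restrict_iff' measurableSet_Ioi).2 (ae_of_all _ fun s hs => ?_))
  · have hc : ContinuousOn (fun u => genExpNeg A θ (r + u)) (Ioi 0) :=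
      hA.continuousOn_genExpNeg.comp (by fun_prop) fun u hu => add_pos hr hu
    exact ((continuousOn_rpow_ofReal (-γ)).smul hc).aestronglyMeasurable measurableSet_Ioi
  · have hs : 0 < s := hs
    rw [norm_smul, Complex.norm_real, Real.norm_of_nonneg (by positivity)]
    have := hA.norm_genExpNeg_le (add_pos hr hs)
    rw [div_eq_mul_inv] at this
    calc _ ≤ s ^ (-γ) * (genConst θ M * (r + s)⁻¹) := by gcongr
      _ = _ := by ring

omit [CompleteSpace X] in
lemma norm_fracExp_le (h0 : 0 ≤ γ) (h1 : γ < 1) {r : ℝ} (hr : 0 < r) :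
    ‖fracExp A θ γ r‖ ≤ fracConst θ M γ * r ^ (-γ) := by
  rw [fracExp, fracConst]
  split_ifs with h
  · rw [h, neg_zero, Real.rpow_zero, mul_one]
    exact hA.norm_expNeg_le_one hr.le
  · have h0' : 0 < γ := lt_of_le_of_ne h0 (Ne.symm h)
    have hG := Real.Gamma_pos_of_pos (show 0 < 1 - γ by linarith)
    have hn : ‖((Real.Gamma (1 - γ))⁻¹ : ℂ)‖ = (Real.Gamma (1 - γ))⁻¹ := by
      rw [norm_inv, Complex.norm_real, Real.norm_of_nonneg hG.le]
    rw [norm_smul, hn, mul_assoc]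
    refine mul_le_mul_of_nonneg_left ?_ (inv_nonneg.2 hG.le)
    have hi := (integrableOn_stieltjes_scaled h0' h1 hr).const_mul (genConst θ M)
    refine (norm_integral_le_of_norm_le hi
      ((ae_restrict_iff' measurableSet_Ioi).2 (ae_of_all _ fun s hs => ?_))).trans (le_of_eq ?_)
    · have hs : 0 < s := hs
      rw [norm_smul, Complex.norm_real, Real.norm_of_nonneg (by positivity)]
      have := hA.norm_genExpNeg_le (add_pos hr hs)
      rw [div_eq_mul_inv] at this
      calc _ ≤ s ^ (-γ) * (genConst θ M * (r + s)⁻¹) := by gcongr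
        _ = _ := by ring
    · rw [integral_const_mul, integral_stieltjes_scaled hr]
      ring

lemma commute_fracExp {L : X →L[ℂ] X} (h0 : 0 ≤ γ) (h1 : γ < 1)
    (hL : ∀ s, 0 < s → Commute L (expNeg A θ s)) {r : ℝ} (hr : 0 < r) :
    Commute L (fracExp A θ γ r) := by
  rw [fracExp]
  split_ifs with h
  · exact hL r hr
  · have h0' : 0 < γ := lt_of_le_of_ne h0 (Ne.symm h)
    refine Commute.smul_right (commute_integral (hA.integrableOn_fracExp h0' h1 hr) ?_) _
    exact (ae_restrict_iff' measurableSet_Ioi).2 (ae_of_all _ fun u hu =>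
      (hA.commute_genExpNeg_of_expNeg hL (add_pos hr hu)).smul_right _)

lemma integral_genExpNeg {r : ℝ} (hr : 0 < r) :
    ∫ u in Ioi (0 : ℝ), genExpNeg A θ (r + u) = expNeg A θ r := by
  have hC := hA.genConst_nonneg
  have hω := hA.rate_pos
  have hd : ∀ u : ℝ, 0 ≤ u →
      HasDerivAt (fun u => -expNeg A θ (r + u)) (genExpNeg A θ (r + u)) u := by
    intro u hu
    have := (HasDerivAt.scomp u (hA.hasDerivAt_expNeg (add_pos_of_pos_of_nonneg hr hu))
      ((hasDerivAt_id u).const_add r)).neg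
    rw [one_smul, neg_neg] at this
    exact this
  have hlim : Tendsto (fun u => -expNeg A θ (r + u)) atTop (𝓝 0) := by
    rw [← neg_zero]
    refine Tendsto.neg (squeeze_zero_norm' (a := fun u : ℝ => Real.exp (-(ω * (r + u)))) ?_ ?_)
    · filter_upwards [eventually_ge_atTop 0] with u hu
      exact hA.decay _ (by linarith)
    · refine Real.tendsto_exp_neg_atTop_nhds_zero.comp ?_
      exact (tendsto_atTop_add_const_left _ r tendsto_id).const_mul_atTop hω
  have hint : IntegrableOn (fun u => genExpNeg A θ (r + u)) (Ioi 0) := by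
    have hi := (integrableOn_exp_mul_Ioi (a := -ω) (by linarith) 0).const_mul (genConst θ M / r)
    refine Integrable.mono' hi ?_
      ((ae_restrict_iff' measurableSet_Ioi).2 (ae_of_all _ fun u hu => ?_))
    · exact (hA.continuousOn_genExpNeg.comp (by fun_prop)
        fun u hu => add_pos hr hu).aestronglyMeasurable measurableSet_Ioi
    · have hu : 0 < u := hu
      rw [add_comm r u, ← hA.expNeg_mul_genExpNeg_eq hu.le hr, mul_comm]
      refine (norm_mul_le _ _).trans ?_
      have h1 := hA.decay u hu.le
      rw [← neg_mul] at h1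
      exact mul_le_mul h1 (hA.norm_genExpNeg_le hr) (norm_nonneg _) (Real.exp_pos _).le
  rw [integral_Ioi_of_hasDerivAt_of_tendsto (hd 0 le_rfl).continuousAt.continuousWithinAt
    (fun u hu => hd u (le_of_lt hu)) hint hlim, add_zero, zero_sub, neg_neg]

/-- `A^{-γ} (A^γ e^{-rA}) = e^{-rA}`: the product of the two integrals is a convolution integral,
in which the scalar factors combine to a Beta integral. -/
theorem negPow_mul_fracExp (h0 : 0 ≤ γ) (h1 : γ < 1) {r : ℝ} (hr : 0 < r) :
    negPow A θ γ * fracExp A θ γ r = expNeg A θ r := by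
  rw [negPow, fracExp]
  split_ifs with h
  · rw [one_mul]
  have h0' : 0 < γ := lt_of_le_of_ne h0 (Ne.symm h)
  have hG := Real.Gamma_pos_of_pos h0'
  have hG' := Real.Gamma_pos_of_pos (show 0 < 1 - γ by linarith)
  have key := integral_posConvolution (hA.integrableOn_negPow h0')
    (hA.integrableOn_fracExp h0' h1 hr) (ContinuousLinearMap.mul ℝ (X →L[ℂ] X))
  simp only [ContinuousLinearMap.mul_apply'] at key
  rw [smul_mul_smul_comm, ← key]
  have inner : ∀ x ∈ Ioi (0 : ℝ),
      ∫ t in (0 : ℝ)..x, (((t ^ (γ - 1) : ℝ) : ℂ) • expNeg A θ t) *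
        ((((x - t) ^ (-γ) : ℝ) : ℂ) • genExpNeg A θ (r + (x - t))) =
      ((Real.Gamma γ : ℂ) * (Real.Gamma (1 - γ) : ℂ)) • genExpNeg A θ (r + x) := by
    intro x hx
    have e := intervalIntegral.integral_smul_const (μ := volume) (a := 0) (b := x)
      (fun t : ℝ => ((t ^ (γ - 1) : ℝ) : ℂ) * (((x - t) ^ (-γ) : ℝ) : ℂ)) (genExpNeg A θ (r + x))
    rw [integral_beta h0' h1 hx] at e
    refine Eq.trans ?_ e
    refine intervalIntegral.integral_congr_ae (ae_of_all _ fun t ht => ?_)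
    rw [uIoc_of_le (le_of_lt hx)] at ht
    rw [smul_mul_smul_comm, hA.expNeg_mul_genExpNeg_eq ht.1.le (by linarith [ht.2])]
    congr 2
    ring
  rw [setIntegral_congr_fun measurableSet_Ioi inner, integral_smul, hA.integral_genExpNeg hr,
    smul_smul]
  have e1 : (Real.Gamma γ : ℂ) ≠ 0 := by exact_mod_cast hG.ne'
  have e2 : (Real.Gamma (1 - γ) : ℂ) ≠ 0 := by exact_mod_cast hG'.ne'
  have : (Real.Gamma γ : ℂ)⁻¹ * (Real.Gamma (1 - γ) : ℂ)⁻¹ *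
      ((Real.Gamma γ : ℂ) * (Real.Gamma (1 - γ) : ℂ)) = 1 := by field_simp
  rw [this, one_smul]

lemma commute_expNeg_negPow (h0 : 0 ≤ γ) {s : ℝ} (hs : 0 ≤ s) :
    Commute (expNeg A θ s) (negPow A θ γ) :=
  hA.commute_negPow h0 fun _ ht => hA.commute_expNeg_expNeg hs ht.le

lemma commute_fracExp_negPow (h0 : 0 ≤ γ) (h1 : γ < 1) {r : ℝ} (hr : 0 < r) :
    Commute (fracExp A θ γ r) (negPow A θ γ) :=
  hA.commute_negPow h0 fun _ ht => (hA.commute_fracExp h0 h1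
    (fun _ hs => hA.commute_expNeg_expNeg ht.le hs.le) hr).symm

/-- If `A^{-γ} x = 0` then `e^{-rA} x = (A^γ e^{-rA}) A^{-γ} x = 0` for all `r > 0`, and `r → 0`. -/
lemma negPow_injective (h0 : 0 ≤ γ) (h1 : γ < 1) : Function.Injective (negPow A θ γ) := by
  rw [injective_iff_map_eq_zero]
  intro x hx
  refine tendsto_nhds_unique (hA.tendsto_expNeg_apply x) (tendsto_const_nhds.congr' ?_)
  filter_upwards [self_mem_nhdsWithin] with r hr
  rw [← hA.negPow_mul_fracExp h0 h1 hr, ← (hA.commute_fracExp_negPow h0 h1 hr).eq,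
    mul_apply_eq_comp, hx, map_zero]

lemma continuousOn_fracExp (h0 : 0 ≤ γ) (h1 : γ < 1) :
    ContinuousOn (fracExp A θ γ) (Ioi 0) := by
  intro s hs
  have hs : 0 < s := hs
  have hshift : ∀ t r : ℝ, 0 ≤ t → 0 < r →
      expNeg A θ t * fracExp A θ γ r = fracExp A θ γ (t + r) := by
    intro t r ht hr
    have hinj := hA.negPow_injective h0 h1
    ext x
    apply hinj
    rw [← mul_apply_eq_comp, ← mul_apply_eq_comp, ← mul_assoc,
      ← (hA.commute_expNeg_negPow h0 ht).eq, mul_assoc, hA.negPow_mul_fracExp h0 h1 hr,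
      hA.negPow_mul_fracExp h0 h1 (by linarith), hA.expNeg_add ht hr.le]
  have hc : ContinuousAt (fun r => expNeg A θ (r - s / 2) * fracExp A θ γ (s / 2)) s := by
    refine ContinuousAt.mul (ContinuousAt.comp (g := expNeg A θ) ?_ (by fun_prop))
      continuousAt_const
    exact (hA.hasDerivAt_expNeg (by linarith)).continuousAt
  refine (hc.congr ?_).continuousWithinAt
  filter_upwards [Ioi_mem_nhds (show s / 2 < s by linarith)] with r hr
  have hr : s / 2 < r := hr
  rw [hshift _ _ (by linarith) (by linarith)]
  congr 1
  ring

lemma fracPow_negPow (h0 : 0 ≤ γ) (h1 : γ < 1) {x y : X} (hxy : negPow A θ γ x = y)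
    (h : y ∈ (fracPow A θ γ).domain) : fracPow A θ γ ⟨y, h⟩ = x := by
  have hk : LinearMap.ker (((negPow A θ γ : X →L[ℂ] X) : X →ₗ[ℂ] X).toPMap ⊤).toFun = ⊥ := by
    rw [LinearMap.ker_eq_bot']
    intro x hx
    have : negPow A θ γ (x : X) = 0 := hx
    rw [← map_zero (negPow A θ γ)] at this
    exact Subtype.ext (hA.negPow_injective h0 h1 this)
  exact LinearPMap.inverse_apply_eq hk (x := ⟨x, trivial⟩) hxy

lemma ev_fracPow_negPow (h0 : 0 ≤ γ) (h1 : γ < 1) (x : X) :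
    ev (fracPow A θ γ) (negPow A θ γ x) = x := by
  rw [ev, dif_pos (negPow_mem_fracPow_domain x)]
  exact hA.fracPow_negPow h0 h1 rfl _

lemma negPow_ev_fracPow (h0 : 0 ≤ γ) (h1 : γ < 1) {y : X} (h : y ∈ (fracPow A θ γ).domain) :
    negPow A θ γ (ev (fracPow A θ γ) y) = y := by
  obtain ⟨x, rfl⟩ := mem_fracPow_domain.1 h
  rw [hA.ev_fracPow_negPow h0 h1]

end IsSectorial
end FractionalPowers

/-! ### The family of operators -/

section Family

variable {X : Type*} [NormedAddCommGroup X] [NormedSpace ℂ X] {A : ℝ → X →ₗ.[ℂ] X}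
  {θ M ω L₁ L₂ γ : ℝ}

/-- The bounded operator `A^γ(t) A^{-γ}(s)`. -/
noncomputable def transOp (A : ℝ → X →ₗ.[ℂ] X) (θ γ t s : ℝ) : X →L[ℂ] X :=
  boundedOf fun x => ev (fracPow (A t) θ γ) (negPow (A s) θ γ x)

lemma boundedOf_apply {F : X → X} {R : X →L[ℂ] X} (hR : ∀ x, R x = F x) (x : X) :
    boundedOf F x = F x := by
  have h : ∃ R : X →L[ℂ] X, ∀ x, R x = F x := ⟨R, hR⟩
  rw [boundedOf, dif_pos h]
  exact h.choose_spec x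

namespace Assumptions

variable (hA : Assumptions A θ M ω L₁ L₂ γ)
include hA

lemma isSectorial {t : ℝ} (ht : t ∈ Icc (-1 : ℝ) 1) : IsSectorial (A t) θ M ω where
  dense := hA.dense t ht
  angle_pos := hA.angle_pos
  angle_lt := hA.angle_lt
  resolvent := fun z hz => hA.resolvent t ht z hz
  rate_pos := hA.rate_pos
  decay := hA.decay t ht

lemma domain_eq' {t s : ℝ} (ht : t ∈ Icc (-1 : ℝ) 1) (hs : s ∈ Icc (-1 : ℝ) 1) :
    (A t).domain = (A s).domain := by
  rw [hA.domain_eq t ht, hA.domain_eq s hs]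

variable [CompleteSpace X]

lemma ev_negPow {t : ℝ} (ht : t ∈ Icc (-1 : ℝ) 1) (x : X) :
    ev (fracPow (A t) θ γ) (negPow (A t) θ γ x) = x :=
  (hA.isSectorial ht).ev_fracPow_negPow hA.exponent_nonneg hA.exponent_lt x

lemma negPow_ev {t : ℝ} (ht : t ∈ Icc (-1 : ℝ) 1) {y : X}
    (hy : y ∈ (fracPow (A t) θ γ).domain) :
    negPow (A t) θ γ (ev (fracPow (A t) θ γ) y) = y :=
  (hA.isSectorial ht).negPow_ev_fracPow hA.exponent_nonneg hA.exponent_lt hy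

lemma injective {t : ℝ} (ht : t ∈ Icc (-1 : ℝ) 1) : Function.Injective (negPow (A t) θ γ) :=
  (hA.isSectorial ht).negPow_injective hA.exponent_nonneg hA.exponent_lt

omit [CompleteSpace X] in
lemma negPow_mem_domain {t s : ℝ} (ht : t ∈ Icc (-1 : ℝ) 1) (hs : s ∈ Icc (-1 : ℝ) 1) (x : X) :
    negPow (A s) θ γ x ∈ (fracPow (A t) θ γ).domain :=
  (hA.lipschitz_pow t ht s hs x).1

omit [CompleteSpace X] in
lemma norm_ev_sub_le {t s : ℝ} (ht : t ∈ Icc (-1 : ℝ) 1) (hs : s ∈ Icc (-1 : ℝ) 1) (x : X) :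
    ‖ev (fracPow (A t) θ γ) (negPow (A s) θ γ x) - x‖ ≤ |L₂| * |t - s| * ‖x‖ := by
  obtain ⟨hx, h⟩ := hA.lipschitz_pow t ht s hs x
  rw [ev, dif_pos hx]
  refine h.trans ?_
  gcongr
  exact le_abs_self _

lemma transOp_apply {t s : ℝ} (ht : t ∈ Icc (-1 : ℝ) 1) (hs : s ∈ Icc (-1 : ℝ) 1) (x : X) :
    transOp A θ γ t s x = ev (fracPow (A t) θ γ) (negPow (A s) θ γ x) := by
  have hN : ∀ x, negPow (A t) θ γ (ev (fracPow (A t) θ γ) (negPow (A s) θ γ x)) =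
      negPow (A s) θ γ x := fun x => hA.negPow_ev ht (hA.negPow_mem_domain ht hs x)
  refine boundedOf_apply (R := LinearMap.mkContinuous
    { toFun := fun x => ev (fracPow (A t) θ γ) (negPow (A s) θ γ x)
      map_add' := fun x y => hA.injective ht (by rw [hN, map_add, map_add, hN, hN])
      map_smul' := fun c x => hA.injective ht (by
        rw [RingHom.id_apply, hN, map_smul, map_smul, hN]) }
    (|L₂| * |t - s| + 1) fun x => ?_) (fun x => rfl) x
  have h := hA.norm_ev_sub_le ht hs x
  calc ‖ev (fracPow (A t) θ γ) (negPow (A s) θ γ x)‖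
      = ‖(ev (fracPow (A t) θ γ) (negPow (A s) θ γ x) - x) + x‖ := by rw [sub_add_cancel]
    _ ≤ |L₂| * |t - s| * ‖x‖ + ‖x‖ := (norm_add_le _ _).trans (by gcongr)
    _ = _ := by ring

lemma negPow_transOp {t s : ℝ} (ht : t ∈ Icc (-1 : ℝ) 1) (hs : s ∈ Icc (-1 : ℝ) 1) (x : X) :
    negPow (A t) θ γ (transOp A θ γ t s x) = negPow (A s) θ γ x := by
  rw [hA.transOp_apply ht hs]
  exact hA.negPow_ev ht (hA.negPow_mem_domain ht hs x)

lemma transOp_comp {r t s : ℝ} (hr : r ∈ Icc (-1 : ℝ) 1) (ht : t ∈ Icc (-1 : ℝ) 1)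
    (hs : s ∈ Icc (-1 : ℝ) 1) (x : X) :
    transOp A θ γ r t (transOp A θ γ t s x) = transOp A θ γ r s x :=
  hA.injective hr (by rw [hA.negPow_transOp hr ht, hA.negPow_transOp ht hs,
    hA.negPow_transOp hr hs])

lemma transOp_self {t : ℝ} (ht : t ∈ Icc (-1 : ℝ) 1) (x : X) : transOp A θ γ t t x = x :=
  hA.injective ht (hA.negPow_transOp ht ht x)

lemma norm_transOp_le {t s : ℝ} (ht : t ∈ Icc (-1 : ℝ) 1) (hs : s ∈ Icc (-1 : ℝ) 1) :
    ‖transOp A θ γ t s‖ ≤ 1 + |L₂| * |t - s| := by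
  refine ContinuousLinearMap.opNorm_le_bound _ (by positivity) fun x => ?_
  have h := hA.norm_ev_sub_le ht hs x
  rw [← hA.transOp_apply ht hs] at h
  calc ‖transOp A θ γ t s x‖ = ‖(transOp A θ γ t s x - x) + x‖ := by rw [sub_add_cancel]
    _ ≤ |L₂| * |t - s| * ‖x‖ + ‖x‖ := (norm_add_le _ _).trans (by gcongr)
    _ = _ := by ring

lemma norm_transOp_le' {t s : ℝ} (ht : t ∈ Icc (-1 : ℝ) 1) (hs : s ∈ Icc (-1 : ℝ) 1) :
    ‖transOp A θ γ t s‖ ≤ 1 + 2 * |L₂| := by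
  refine (hA.norm_transOp_le ht hs).trans ?_
  have : |t - s| ≤ 2 := abs_le.2 ⟨by linarith [ht.1, hs.2], by linarith [ht.2, hs.1]⟩
  nlinarith [abs_nonneg L₂]

/-- The natural domain of `A(t) A^{-γ}(t)` contains the domain of `A(t)`, hence is dense. -/
lemma dense_preimage_domain {t : ℝ} (ht : t ∈ Icc (-1 : ℝ) 1) :
    Dense {x : X | negPow (A t) θ γ x ∈ (A t).domain} := by
  have hS := hA.isSectorial ht
  refine (hA.dense t ht).mono fun x hx => ?_
  have hR := hS.isResolventAt (zero_mem_sectorCompl θ)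
  have h := hR.2 ⟨x, hx⟩
  have hc := hS.commute_negPow (γ := γ) hA.exponent_nonneg (L := resolventOp (A t) 0)
    fun s hs => hS.commute_expNeg
      (fun z hz => hS.commute_resolventOp (zero_mem_sectorCompl θ) hz) hs
  change negPow (A t) θ γ x ∈ (A t).domain
  rw [show negPow (A t) θ γ x = negPow (A t) θ γ (resolventOp (A t) 0 _) from
    congrArg _ h.symm, ← mul_apply_eq_comp, ← hc.eq]
  exact (hR.1 _).1

/-- The operator `[A(t) - A(s)] A^{-γ}(t)` has a dense natural domain and is bounded on it. -/
lemma exists_relDiff {t s : ℝ} (ht : t ∈ Icc (-1 : ℝ) 1) (hs : s ∈ Icc (-1 : ℝ) 1) :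
    ∃ D : X →L[ℂ] X, ∀ (x : X) (hx : negPow (A t) θ γ x ∈ (A t - A s).domain),
      D x = (A t - A s) ⟨negPow (A t) θ γ x, hx⟩ := by
  set S : Submodule ℂ X := (A t - A s).domain.comap (negPow (A t) θ γ : X →ₗ[ℂ] X) with hS
  let N' : S →ₗ[ℂ] (A t - A s).domain :=
    ((negPow (A t) θ γ : X →ₗ[ℂ] X).comp S.subtype).codRestrict _ fun x => x.2
  let f : S →ₗ[ℂ] X := (A t - A s).toFun.comp N'
  have hdense : DenseRange (S.subtype : S → X) := by
    have : range (S.subtype : S → X) = {x : X | negPow (A t) θ γ x ∈ (A t).domain} := by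
      ext x
      simp only [Submodule.coe_subtype, Subtype.range_coe_subtype]
      change negPow (A t) θ γ x ∈ (A t).domain ⊓ (A s).domain ↔ negPow (A t) θ γ x ∈ (A t).domain
      rw [hA.domain_eq' hs ht, inf_idem]
    rw [DenseRange, this]
    exact hA.dense_preimage_domain ht
  refine ⟨LinearMap.extendOfNorm f S.subtype, fun x hx => ?_⟩
  exact LinearMap.extendOfNorm_eq (e := S.subtype) (f := f) hdense
    ⟨L₁ * |t - s|, fun y => hA.lipschitz_diff t ht s hs y y.2⟩ ⟨x, hx⟩

lemma relDiff_apply {t s : ℝ} (ht : t ∈ Icc (-1 : ℝ) 1) (hs : s ∈ Icc (-1 : ℝ) 1) {x y : X}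
    (hxy : negPow (A t) θ γ x = y) (hy : y ∈ (A t).domain) :
    relDiff A θ γ t s x = ev (A t) y - ev (A s) y := by
  subst hxy
  have h := hA.exists_relDiff ht hs
  have hys : negPow (A t) θ γ x ∈ (A s).domain := by rwa [hA.domain_eq' hs ht]
  rw [relDiff, dif_pos h, h.choose_spec x ⟨hy, hys⟩, LinearPMap.sub_apply, ev, ev, dif_pos hy,
    dif_pos hys]

lemma norm_relDiff_le {t s : ℝ} (ht : t ∈ Icc (-1 : ℝ) 1) (hs : s ∈ Icc (-1 : ℝ) 1) :
    ‖relDiff A θ γ t s‖ ≤ |L₁| * |t - s| := by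
  refine ContinuousLinearMap.opNorm_le_bound _ (by positivity) fun x => ?_
  have hcl : IsClosed {x : X | ‖relDiff A θ γ t s x‖ ≤ |L₁| * |t - s| * ‖x‖} :=
    isClosed_le (by fun_prop) (by fun_prop)
  refine hcl.closure_subset_iff.2 (fun y hy => ?_) (hA.dense_preimage_domain ht x)
  have hy' : negPow (A t) θ γ y ∈ (A t - A s).domain := by
    change _ ∈ (A t).domain ⊓ (A s).domain
    rw [hA.domain_eq' hs ht, inf_idem]
    exact hy
  have h := hA.exists_relDiff ht hs
  change ‖relDiff A θ γ t s y‖ ≤ _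
  rw [relDiff, dif_pos h, h.choose_spec y hy']
  refine (hA.lipschitz_diff t ht s hs y hy').trans ?_
  gcongr
  exact le_abs_self _

/-- `[A(t) - A(s)] - [A(t) - A(r)] = A(r) - A(s)`. -/
lemma relDiff_sub {t s r : ℝ} (ht : t ∈ Icc (-1 : ℝ) 1) (hs : s ∈ Icc (-1 : ℝ) 1)
    (hr : r ∈ Icc (-1 : ℝ) 1) :
    relDiff A θ γ t s - relDiff A θ γ t r = relDiff A θ γ r s * transOp A θ γ r t := by
  refine ContinuousLinearMap.coeFn_injective (Continuous.ext_on (hA.dense_preimage_domain ht)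
    (ContinuousLinearMap.continuous _) (ContinuousLinearMap.continuous _) fun x hx => ?_)
  have hx : negPow (A t) θ γ x ∈ (A t).domain := hx
  change relDiff A θ γ t s x - relDiff A θ γ t r x = relDiff A θ γ r s (transOp A θ γ r t x)
  rw [hA.relDiff_apply ht hs rfl hx, hA.relDiff_apply ht hr rfl hx,
    hA.relDiff_apply hr hs (hA.negPow_transOp hr ht x) (by rwa [hA.domain_eq' hr ht])]
  abel

/-- By `relDiff_sub` the operators `[A(t) - A(s)] A^{-γ}(t)` are Lipschitz continuous in `s`. -/
lemma continuousOn_relDiff {t : ℝ} (ht : t ∈ Icc (-1 : ℝ) 1) :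
    ContinuousOn (relDiff A θ γ t) (Icc (-1) 1) := by
  refine (LipschitzOnWith.of_dist_le_mul (K := Real.toNNReal (|L₁| * (1 + 2 * |L₂|)))
    fun s hs r hr => ?_).continuousOn
  rw [Real.coe_toNNReal _ (by positivity), dist_eq_norm, hA.relDiff_sub ht hs hr, Real.dist_eq,
    abs_sub_comm]
  refine (norm_mul_le _ _).trans ?_
  calc _ ≤ (|L₁| * |r - s|) * (1 + 2 * |L₂|) := mul_le_mul (hA.norm_relDiff_le hr hs)
        (hA.norm_transOp_le' hr ht) (norm_nonneg _) (by positivity)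
    _ = _ := by ring

lemma diffApply_negPow {t s r : ℝ} (ht : t ∈ Icc (-1 : ℝ) 1) (hr : r ∈ Icc (-1 : ℝ) 1) (x : X) :
    diffApply A θ γ t s (negPow (A r) θ γ x) = relDiff A θ γ t s (transOp A θ γ t r x) := by
  rw [diffApply, hA.transOp_apply ht hr]

omit [CompleteSpace X] in
lemma mem_fracPow_domain_of {t s : ℝ} (ht : t ∈ Icc (-1 : ℝ) 1) (hs : s ∈ Icc (-1 : ℝ) 1) {y : X}
    (hy : y ∈ (fracPow (A s) θ γ).domain) : y ∈ (fracPow (A t) θ γ).domain := by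
  obtain ⟨x, rfl⟩ := mem_fracPow_domain.1 hy
  exact hA.negPow_mem_domain ht hs x

end Assumptions
end Family

/-! ### The mild form of the equation with respect to a frozen operator -/

section Mild

variable {X : Type*} [NormedAddCommGroup X] [NormedSpace ℂ X] [CompleteSpace X]

namespace IsSectorial

variable {A : X →ₗ.[ℂ] X} {θ M ω : ℝ} (hA : IsSectorial A θ M ω)
include hA

lemma intervalIntegrable_expNeg_apply {a b c : ℝ} (hab : a ≤ b) (hbc : b ≤ c) {h : ℝ → X}
    (hh : ContinuousOn h (Icc a b)) :
    IntervalIntegrable (fun s => expNeg A θ (c - s) (h s)) volume a b := by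
  refine ContinuousOn.intervalIntegrable ?_
  rw [uIcc_of_le hab]
  exact hA.continuousOn_expNeg_apply (by fun_prop) (fun r hr => by linarith [hr.2]) hh

/-- Variation of constants: if `w` is continuous and right differentiable with `w' + A w = g`, then
`w` satisfies the integrated equation, as `s ↦ e^{-(b-s)A} w(s)` has right derivative
`e^{-(b-s)A} g(s)`. -/
theorem variation_of_constants {a b : ℝ} (hab : a ≤ b) {w w' g : ℝ → X}
    (hw : ContinuousOn w (Icc a b)) (hg : ContinuousOn g (Icc a b))
    (hw' : ∀ s ∈ Ioo a b, HasDerivWithinAt w (w' s) (Ioi s) s)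
    (hdom : ∀ s ∈ Ioo a b, w s ∈ A.domain)
    (heq : ∀ s ∈ Ioo a b, w' s + ev A (w s) = g s) :
    w b = expNeg A θ (b - a) (w a) + ∫ s in a..b, expNeg A θ (b - s) (g s) := by
  have key := intervalIntegral.integral_eq_sub_of_hasDeriv_right_of_le hab
    (f := fun s => expNeg A θ (b - s) (w s)) (f' := fun s => expNeg A θ (b - s) (g s))
    (hA.continuousOn_expNeg_apply (by fun_prop) (fun r hr => by linarith [hr.2]) hw) ?_
    (hA.intervalIntegrable_expNeg_apply hab le_rfl hg)
  · simp only [sub_self, IsSectorial.expNeg_zero, one_apply_eq_self] at key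
    rw [key]; abel
  · intro s hs
    have hbs : 0 < b - s := by linarith [hs.2]
    have h1 : HasDerivAt (fun s => expNeg A θ (b - s)) (genExpNeg A θ (b - s)) s := by
      have := HasDerivAt.scomp s (hA.hasDerivAt_expNeg hbs) ((hasDerivAt_id s).const_sub b)
      rw [neg_one_smul, neg_neg] at this
      exact this
    have h2 : HasDerivAt
        (fun s => ContinuousLinearMap.restrictScalarsL ℂ X X ℝ ℝ (expNeg A θ (b - s)))
        (ContinuousLinearMap.restrictScalarsL ℂ X X ℝ ℝ (genExpNeg A θ (b - s))) s :=
      (ContinuousLinearMap.restrictScalarsL ℂ X X ℝ ℝ).hasFDerivAt.comp_hasDerivAt s h1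
    have h3 := h2.hasDerivWithinAt.clm_apply (hw' s hs)
    refine HasDerivWithinAt.congr_deriv h3 ?_
    have e1 := hA.genExpNeg_apply_of_mem hbs ⟨w s, hdom s hs⟩
    have e2 : A ⟨w s, hdom s hs⟩ = ev A (w s) := by rw [ev, dif_pos (hdom s hs)]
    rw [e2] at e1
    change genExpNeg A θ (b - s) (w s) + expNeg A θ (b - s) (w' s) = _
    rw [← heq s hs, map_add, add_comm]
    exact congrArg _ e1

/-- The part of a mild solution after time `s`. -/
lemma mild_restart {h v : ℝ → X} {a c : ℝ} (hh : ContinuousOn h (Icc a c))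
    (hv : ∀ t ∈ Icc a c, v t = expNeg A θ (t - a) (v a) +
      ∫ s in a..t, expNeg A θ (t - s) (h s)) {s t : ℝ} (has : a ≤ s) (hst : s ≤ t)
    (htc : t ≤ c) :
    v t = expNeg A θ (t - s) (v s) + ∫ r in s..t, expNeg A θ (t - r) (h r) := by
  have hh1 : ContinuousOn h (Icc a s) := hh.mono (Icc_subset_Icc_right (by linarith))
  have hh2 : ContinuousOn h (Icc s t) := hh.mono (Icc_subset_Icc has htc)
  have i1 := hA.intervalIntegrable_expNeg_apply has hst hh1
  have i1' := hA.intervalIntegrable_expNeg_apply has le_rfl hh1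
  have i2 := hA.intervalIntegrable_expNeg_apply hst le_rfl hh2
  rw [hv t ⟨by linarith, htc⟩, hv s ⟨has, by linarith⟩, map_add,
    ← intervalIntegral.integral_add_adjacent_intervals i1 i2, ← add_assoc]
  congr 2
  · rw [← mul_apply_eq_comp, ← hA.expNeg_add (by linarith) (by linarith)]
    congr 2; ring
  · rw [← ContinuousLinearMap.intervalIntegral_comp_comm _ i1']
    refine intervalIntegral.integral_congr fun r hr => ?_
    rw [uIcc_of_le has] at hr
    rw [← mul_apply_eq_comp, ← hA.expNeg_add (by linarith) (by linarith [hr.2])]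
    congr 2; ring

/-- After smoothing by `e^{-εA}`, a mild solution is right differentiable and satisfies the
differential equation. -/
lemma hasDerivWithinAt_smoothed {h v : ℝ → X} {a c : ℝ} (hh : ContinuousOn h (Icc a c))
    (hv : ∀ t ∈ Icc a c, v t = expNeg A θ (t - a) (v a) +
      ∫ s in a..t, expNeg A θ (t - s) (h s)) {ε : ℝ} (hε : 0 < ε) {s : ℝ} (hs : s ∈ Ioo a c) :
    HasDerivWithinAt (fun t => expNeg A θ ε (v t))
      (-genExpNeg A θ ε (v s) + expNeg A θ ε (h s)) (Ioi s) s := by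
  have hev : ∀ᶠ t in 𝓝[>] s, expNeg A θ ε (v t) = expNeg A θ (ε + (t - s)) (v s) +
      ∫ r in s..t, expNeg A θ (ε + (t - r)) (h r) := by
    filter_upwards [Ioo_mem_nhdsGT hs.2] with t ht
    rw [hA.mild_restart hh hv hs.1.le ht.1.le ht.2.le, map_add, ← mul_apply_eq_comp,
      ← hA.expNeg_add hε.le (by linarith [ht.1]), ← ContinuousLinearMap.intervalIntegral_comp_comm]
    · congr 1
      refine intervalIntegral.integral_congr fun r hr => ?_
      rw [uIcc_of_le ht.1.le] at hr
      rw [← mul_apply_eq_comp, ← hA.expNeg_add hε.le (by linarith [hr.2])]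
    · exact hA.intervalIntegrable_expNeg_apply ht.1.le le_rfl
        (hh.mono (Icc_subset_Icc hs.1.le ht.2.le))
  have h1 : HasDerivAt (fun t => expNeg A θ (ε + (t - s)) (v s)) (-genExpNeg A θ ε (v s)) s := by
    have h0 : HasDerivAt (fun t => ε + (t - s)) 1 s :=
      ((hasDerivAt_id s).sub_const s).const_add ε
    have hd : HasDerivAt (expNeg A θ) (-genExpNeg A θ ε) (ε + (s - s)) := by
      rw [sub_self, add_zero]; exact hA.hasDerivAt_expNeg hε
    have h2 := HasDerivAt.scomp s hd h0
    rw [one_smul] at h2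
    exact ((ContinuousLinearMap.apply ℂ X (v s)).restrictScalars ℝ).hasFDerivAt.comp_hasDerivAt s h2
  have h2 : HasDerivWithinAt (fun t => ∫ r in s..t, expNeg A θ (ε + (t - r)) (h r))
      (expNeg A θ ε (h s)) (Ioi s) s := by
    rw [hasDerivWithinAt_iff_isLittleO, Asymptotics.isLittleO_iff]
    intro η hη
    have hcont : ContinuousAt (fun p : ℝ × ℝ => expNeg A θ (ε + p.1) (h p.2)) (0, s) := by
      have c1 : ContinuousAt (fun p : ℝ × ℝ => expNeg A θ (ε + p.1)) (0, s) := by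
        refine ContinuousAt.comp (g := expNeg A θ) ?_ (by fun_prop)
        simpa using (hA.hasDerivAt_expNeg hε).continuousAt
      have c2 : ContinuousAt (fun p : ℝ × ℝ => h p.2) (0, s) :=
        ContinuousAt.comp (g := h) (hh.continuousAt (Icc_mem_nhds hs.1 hs.2)) continuousAt_snd
      exact c1.clm_apply c2
    obtain ⟨δ, hδ, hclose⟩ := Metric.continuousAt_iff.1 hcont η hη
    simp only [add_zero] at hclose
    filter_upwards [Ioo_mem_nhdsGT (show s < s + δ by linarith), Ioo_mem_nhdsGT hs.2] with t ht ht'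
    have hst : s ≤ t := ht.1.le
    have hint : IntervalIntegrable (fun r => expNeg A θ (ε + (t - r)) (h r)) volume s t := by
      refine ContinuousOn.intervalIntegrable ?_
      rw [uIcc_of_le hst]
      exact hA.continuousOn_expNeg_apply (by fun_prop) (fun r hr => by linarith [hr.2])
        (hh.mono (Icc_subset_Icc hs.1.le ht'.2.le))
    have e : (∫ r in s..t, expNeg A θ (ε + (t - r)) (h r)) -
        (∫ r in s..s, expNeg A θ (ε + (s - r)) (h r)) - (t - s) • expNeg A θ ε (h s) =
        ∫ r in s..t, (expNeg A θ (ε + (t - r)) (h r) - expNeg A θ ε (h s)) := by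
      rw [intervalIntegral.integral_same, sub_zero, intervalIntegral.integral_sub hint (by simp),
        intervalIntegral.integral_const]
    rw [e]
    refine intervalIntegral.norm_integral_le_of_norm_le_const fun r hr => ?_
    rw [uIoc_of_le hst] at hr
    have := @hclose (t - r, r) (by
      rw [Prod.dist_eq, max_lt_iff, Real.dist_eq, Real.dist_eq, abs_lt, abs_lt]
      refine ⟨⟨?_, ?_⟩, ?_, ?_⟩ <;> simp only <;> linarith [hr.1, hr.2, ht.2])
    rw [dist_eq_norm] at this
    exact this.le
  refine (h1.hasDerivWithinAt.add h2).congr_of_eventuallyEq hev ?_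
  simp

end IsSectorial

namespace Assumptions

variable {A : ℝ → X →ₗ.[ℂ] X} {θ M ω L₁ L₂ γ : ℝ} (hA : Assumptions A θ M ω L₁ L₂ γ)
include hA

omit hA [CompleteSpace X] in
lemma neg_one_mem : (-1 : ℝ) ∈ Icc (-1 : ℝ) 1 := ⟨le_rfl, by norm_num⟩

lemma continuousOn_solution {α : ℝ} {φ : X} {f v : ℝ → X} (hv : IsSolution A θ γ α φ f v) :
    ContinuousOn v (Icc (-1) 1) :=
  ((negPow (A (-1)) θ γ).continuous.comp_continuousOn hv.continuousOn).congr fun t ht =>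
    (hA.negPow_ev neg_one_mem (hv.mem_domain t ht)).symm

lemma continuousOn_relDiff_apply {t : ℝ} (ht : t ∈ Icc (-1 : ℝ) 1) {u : ℝ → X}
    (hu : ContinuousOn u (Icc (-1) 1)) :
    ContinuousOn (fun s => relDiff A θ γ t s (u s)) (Icc (-1) 1) :=
  (hA.continuousOn_relDiff ht).clm_apply hu

/-- Every classical or mild solution satisfies, on each interval `[a, b]`, the integral equation
belonging to `v' + A(b) v = [A(b) - A(t)] v + f`. -/
theorem mild_frozen {α : ℝ} {φ : X} {f v : ℝ → X} (hf : ContinuousOn f (Icc (-1) 1))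
    (hv : IsSolution A θ γ α φ f v) {a b : ℝ} (ha : a ∈ Icc (-1 : ℝ) 1) (hb : b ∈ Icc (-1 : ℝ) 1)
    (hab : a ≤ b) :
    v b = expNeg (A b) θ (b - a) (v a) + ∫ s in a..b, expNeg (A b) θ (b - s)
      (relDiff A θ γ b s (transOp A θ γ b (-1) (ev (fracPow (A (-1)) θ γ) (v s))) + f s) := by
  set u : ℝ → X := fun s => ev (fracPow (A (-1)) θ γ) (v s) with hu_def
  have h1 := neg_one_mem
  have hu : ContinuousOn u (Icc (-1) 1) := hv.continuousOn
  have hvc := hA.continuousOn_solution hv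
  have hNu : ∀ s ∈ Icc (-1 : ℝ) 1, negPow (A (-1)) θ γ (u s) = v s := fun s hs =>
    hA.negPow_ev h1 (hv.mem_domain s hs)
  have hsub : Icc a b ⊆ Icc (-1 : ℝ) 1 := Icc_subset_Icc ha.1 hb.2
  have hsub' : Ioo a b ⊆ Ioo (-1 : ℝ) 1 := Ioo_subset_Ioo ha.1 hb.2
  have hCu : ContinuousOn (fun s => transOp A θ γ b (-1) (u s)) (Icc (-1) 1) :=
    (transOp A θ γ b (-1)).continuous.comp_continuousOn hu
  have hS := hA.isSectorial hb
  rcases hv.equation with hode | hmild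
  · refine hS.variation_of_constants hab (w' := fun s => f s - ev (A s) (v s)) (hvc.mono hsub)
      (((hA.continuousOn_relDiff_apply hb hCu).add hf).mono hsub) ?_ ?_ ?_
    · intro s hs
      obtain ⟨hd, h⟩ := hode s (hsub' hs)
      rw [ev, dif_pos hd]
      exact h.hasDerivWithinAt
    · intro s hs
      obtain ⟨hd, -⟩ := hode s (hsub' hs)
      rwa [hA.domain_eq' hb (hsub (Ioo_subset_Icc_self hs))]
    · intro s hs
      have hs' := hsub (Ioo_subset_Icc_self hs)
      obtain ⟨hd, -⟩ := hode s (hsub' hs)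
      have hd' : v s ∈ (A b).domain := by rwa [hA.domain_eq' hb hs']
      rw [hA.relDiff_apply hb hs' (y := v s) (by rw [hA.negPow_transOp hb h1, hNu s hs']) hd']
      abel
  · have hS0 := hA.isSectorial h1
    set h : ℝ → X := fun s => relDiff A θ γ (-1) s (u s) + f s with hh_def
    have hh : ContinuousOn h (Icc (-1) 1) := (hA.continuousOn_relDiff_apply h1 hu).add hf
    have hv' : ∀ t ∈ Icc (-1 : ℝ) 1, v t = expNeg (A (-1)) θ (t - (-1)) (v (-1)) +
        ∫ s in (-1 : ℝ)..t, expNeg (A (-1)) θ (t - s) (h s) := by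
      intro t ht
      rw [sub_neg_eq_add]
      exact hmild t ht
    have hreg : ∀ ε : ℝ, 0 < ε → expNeg (A (-1)) θ ε (v b) =
        expNeg (A b) θ (b - a) (expNeg (A (-1)) θ ε (v a)) +
        ∫ s in a..b, expNeg (A b) θ (b - s)
          (relDiff A θ γ b (-1) (transOp A θ γ b (-1) (expNeg (A (-1)) θ ε (u s))) +
            expNeg (A (-1)) θ ε (h s)) := by
      intro ε hε
      refine hS.variation_of_constants hab (w := fun s => expNeg (A (-1)) θ ε (v s))
        (w' := fun s => -genExpNeg (A (-1)) θ ε (v s) + expNeg (A (-1)) θ ε (h s))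
        ((expNeg (A (-1)) θ ε).continuous.comp_continuousOn (hvc.mono hsub)) ?_ ?_ ?_ ?_
      · refine ContinuousOn.add ?_
          ((expNeg (A (-1)) θ ε).continuous.comp_continuousOn (hh.mono hsub))
        exact (relDiff A θ γ b (-1)).continuous.comp_continuousOn
          ((transOp A θ γ b (-1)).continuous.comp_continuousOn
            ((expNeg (A (-1)) θ ε).continuous.comp_continuousOn (hu.mono hsub)))
      · intro s hs
        exact hS0.hasDerivWithinAt_smoothed hh hv' hε (hsub' hs)
      · intro s hs
        rw [hA.domain_eq' hb h1]
        exact (hS0.exists_mem_domain_expNeg hε (v s)).1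
      · intro s hs
        have hs' := hsub (Ioo_subset_Icc_self hs)
        obtain ⟨hd, hd2⟩ := hS0.exists_mem_domain_expNeg hε (v s)
        have e0 : ev (A (-1)) (expNeg (A (-1)) θ ε (v s)) = genExpNeg (A (-1)) θ ε (v s) := by
          rw [ev, dif_pos hd, hd2]
        have e1 : negPow (A b) θ γ (transOp A θ γ b (-1) (expNeg (A (-1)) θ ε (u s))) =
            expNeg (A (-1)) θ ε (v s) := by
          rw [hA.negPow_transOp hb h1, ← mul_apply_eq_comp,
            ← (hS0.commute_expNeg_negPow hA.exponent_nonneg hε.le).eq, mul_apply_eq_comp,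
            hNu s hs']
        rw [hA.relDiff_apply hb h1 e1 (by rwa [hA.domain_eq' hb h1]), e0]
        abel
    -- letting `ε → 0`, by strong continuity and dominated convergence
    have hlimit : ∀ x : X, Tendsto (fun ε => expNeg (A (-1)) θ ε x) (𝓝[>] 0) (𝓝 x) :=
      hS0.tendsto_expNeg_apply
    have lim1 := hlimit (v b)
    have lim2 : Tendsto (fun ε => expNeg (A b) θ (b - a) (expNeg (A (-1)) θ ε (v a))) (𝓝[>] 0)
        (𝓝 (expNeg (A b) θ (b - a) (v a))) :=
      ((expNeg (A b) θ (b - a)).continuous.tendsto _).comp (hlimit (v a))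
    have lim3 : Tendsto (fun ε => ∫ s in a..b, expNeg (A b) θ (b - s)
          (relDiff A θ γ b (-1) (transOp A θ γ b (-1) (expNeg (A (-1)) θ ε (u s))) +
            expNeg (A (-1)) θ ε (h s))) (𝓝[>] 0)
        (𝓝 (∫ s in a..b, expNeg (A b) θ (b - s)
          (relDiff A θ γ b (-1) (transOp A θ γ b (-1) (u s)) + h s))) := by
      refine intervalIntegral.tendsto_integral_filter_of_dominated_convergence
        (fun s => ‖relDiff A θ γ b (-1)‖ * (‖transOp A θ γ b (-1)‖ * ‖u s‖) + ‖h s‖) ?_ ?_ ?_ ?_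
      · refine Eventually.of_forall fun ε => ?_
        refine (intervalIntegrable_iff.1
          (hS.intervalIntegrable_expNeg_apply hab le_rfl ?_)).aestronglyMeasurable
        refine ContinuousOn.add ?_
          ((expNeg (A (-1)) θ ε).continuous.comp_continuousOn (hh.mono hsub))
        exact (relDiff A θ γ b (-1)).continuous.comp_continuousOn
          ((transOp A θ γ b (-1)).continuous.comp_continuousOn
            ((expNeg (A (-1)) θ ε).continuous.comp_continuousOn (hu.mono hsub)))
      · filter_upwards [self_mem_nhdsWithin] with ε hε
        refine ae_of_all _ fun s hs => ?_
        rw [uIoc_of_le hab] at hs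
        have hε : 0 < ε := hε
        have hc : ∀ x : X, ‖expNeg (A (-1)) θ ε x‖ ≤ ‖x‖ := fun x =>
          ((expNeg (A (-1)) θ ε).le_opNorm x).trans
            (mul_le_of_le_one_left (norm_nonneg _) (hS0.norm_expNeg_le_one hε.le))
        refine ((expNeg (A b) θ (b - s)).le_opNorm _).trans ((mul_le_of_le_one_left (norm_nonneg _)
          (hS.norm_expNeg_le_one (by linarith [hs.2]))).trans ?_)
        refine (norm_add_le _ _).trans (add_le_add ?_ (hc _))
        refine ((relDiff A θ γ b (-1)).le_opNorm _).trans ?_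
        refine mul_le_mul_of_nonneg_left ?_ (norm_nonneg _)
        refine ((transOp A θ γ b (-1)).le_opNorm _).trans ?_
        exact mul_le_mul_of_nonneg_left (hc _) (norm_nonneg _)
      · refine ContinuousOn.intervalIntegrable ?_
        rw [uIcc_of_le hab]
        have := (hu.mono hsub).norm
        have := (hh.mono hsub).norm
        fun_prop
      · refine ae_of_all _ fun s hs => ?_
        refine ((expNeg (A b) θ (b - s)).continuous.tendsto _).comp (Tendsto.add ?_ (hlimit _))
        exact ((relDiff A θ γ b (-1)).continuous.tendsto _).comp
          (((transOp A θ γ b (-1)).continuous.tendsto _).comp (hlimit _))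
    have := tendsto_nhds_unique lim1 ((lim2.add lim3).congr' (by
      filter_upwards [self_mem_nhdsWithin] with ε hε
      exact (hreg ε hε).symm))
    rw [this]
    congr 1
    refine intervalIntegral.integral_congr fun s hs => ?_
    rw [uIcc_of_le hab] at hs
    have hs' := hsub hs
    -- `[A(b) - A(-1)] + [A(-1) - A(s)] = A(b) - A(s)`
    have e := congrArg (fun L : X →L[ℂ] X => L (transOp A θ γ b (-1) (u s)))
      (hA.relDiff_sub hb hs' h1)
    simp only [sub_apply, mul_apply_eq_comp] at e
    rw [hA.transOp_comp h1 hb h1, hA.transOp_self h1, sub_eq_iff_eq_add] at e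
    simp only [hh_def]
    rw [e]
    congr 1
    abel

end Assumptions
end Mild

/-! ### Smoothing of convolution integrals -/

section Smoothing

variable {X : Type*} [NormedAddCommGroup X] [NormedSpace ℂ X] [CompleteSpace X]

namespace IsSectorial

variable {A : X →ₗ.[ℂ] X} {θ M ω γ : ℝ} (hA : IsSectorial A θ M ω)
include hA

lemma intervalIntegrable_fracExp_apply (h0 : 0 ≤ γ) (h1 : γ < 1) {a b : ℝ} (hab : a ≤ b)
    {g : ℝ → X} (hg : ContinuousOn g (Icc a b)) :
    IntervalIntegrable (fun s => fracExp A θ γ (b - s) (g s)) volume a b := by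
  obtain ⟨C, hC⟩ := isCompact_Icc.exists_bound_of_continuousOn hg
  have hi : IntervalIntegrable (fun s => fracConst θ M γ * (b - s) ^ (-γ) * C) volume a b := by
    have h := (intervalIntegral.intervalIntegrable_rpow' (r := -γ) (a := 0) (b := b - a)
      (by linarith)).comp_sub_left b
    simp only [sub_zero, sub_sub_cancel] at h
    exact (h.symm.const_mul _).mul_const _
  rw [intervalIntegrable_iff_integrableOn_Ioo_of_le hab] at hi ⊢
  refine Integrable.mono' hi ?_
    ((ae_restrict_iff' measurableSet_Ioo).2 (ae_of_all _ fun s hs => ?_))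
  · refine ContinuousOn.aestronglyMeasurable ?_ measurableSet_Ioo
    refine ContinuousOn.clm_apply ?_ (hg.mono Ioo_subset_Icc_self)
    refine (hA.continuousOn_fracExp h0 h1).comp (by fun_prop) fun s hs => ?_
    simpa using hs.2
  · refine ((fracExp A θ γ (b - s)).le_opNorm _).trans ?_
    exact mul_le_mul (hA.norm_fracExp_le h0 h1 (by linarith [hs.2])) (hC s (Ioo_subset_Icc_self hs))
      (norm_nonneg _) (mul_nonneg (hA.fracConst_nonneg h1)
        (Real.rpow_nonneg (by linarith [hs.2]) _))

/-- A convolution with `e^{-(b-s)A}` lies in the domain of `A^γ`, since the singularity `(b-s)^{-γ}` of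
`A^γ e^{-(b-s)A}` is integrable. -/
lemma negPow_integral_fracExp (h0 : 0 ≤ γ) (h1 : γ < 1) {a b : ℝ} (hab : a ≤ b)
    {g : ℝ → X} (hg : ContinuousOn g (Icc a b)) :
    negPow A θ γ (∫ s in a..b, fracExp A θ γ (b - s) (g s)) =
      ∫ s in a..b, expNeg A θ (b - s) (g s) := by
  rw [← ContinuousLinearMap.intervalIntegral_comp_comm _
    (hA.intervalIntegrable_fracExp_apply h0 h1 hab hg)]
  refine intervalIntegral.integral_congr_ae ?_
  have hne : ∀ᵐ s : ℝ, s ≠ b := Measure.ae_ne volume b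
  filter_upwards [hne] with s hs hs'
  rw [uIoc_of_le hab] at hs'
  rw [← mul_apply_eq_comp, hA.negPow_mul_fracExp h0 h1 (sub_pos.2 (lt_of_le_of_ne hs'.2 hs))]

omit [CompleteSpace X] in
/-- A factor `g(s)` that vanishes to first order at the endpoint `b` improves the bound of the
convolution with the weakly singular kernel `A^γ e^{-(b-s)A}` to the order `2 - γ`. -/
lemma norm_integral_fracExp_le (h0 : 0 ≤ γ) (h1 : γ < 1) {a b : ℝ} (hab : a ≤ b)
    {g : ℝ → X} {C : ℝ} (hC : 0 ≤ C) (hg : ∀ s ∈ Icc a b, ‖g s‖ ≤ C * (b - s)) :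
    ‖∫ s in a..b, fracExp A θ γ (b - s) (g s)‖ ≤
      fracConst θ M γ * C * (b - a) ^ (2 - γ) := by
  have hc := hA.fracConst_nonneg (θ := θ) (M := M) h1
  have key : ∀ s ∈ uIoc a b, ‖fracExp A θ γ (b - s) (g s)‖ ≤
      fracConst θ M γ * C * (b - a) ^ (1 - γ) := by
    intro s hs
    rw [uIoc_of_le hab] at hs
    have hgs := hg s ⟨hs.1.le, hs.2⟩
    -- at `s = b` the kernel has a junk value, but `g` vanishes
    rcases hs.2.eq_or_lt with rfl | hsb
    · rw [sub_self, mul_zero] at hgs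
      rw [norm_le_zero_iff.1 hgs, map_zero, norm_zero]
      have : 0 ≤ s - a := by linarith
      positivity
    · have hr : 0 < b - s := sub_pos.2 hsb
      refine ((fracExp A θ γ (b - s)).le_opNorm _).trans ?_
      refine (mul_le_mul (hA.norm_fracExp_le h0 h1 hr) hgs (norm_nonneg _)
        (mul_nonneg hc (Real.rpow_nonneg hr.le _))).trans ?_
      have e : (b - s) ^ (-γ) * (b - s) = (b - s) ^ (1 - γ) := by
        rw [show 1 - γ = -γ + 1 by ring, Real.rpow_add_one hr.ne']
      have hm : (b - s) ^ (1 - γ) ≤ (b - a) ^ (1 - γ) :=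
        Real.rpow_le_rpow hr.le (by linarith [hs.1]) (by linarith)
      calc fracConst θ M γ * (b - s) ^ (-γ) * (C * (b - s))
          = fracConst θ M γ * C * ((b - s) ^ (-γ) * (b - s)) := by ring
        _ ≤ _ := by rw [e]; gcongr
  refine (intervalIntegral.norm_integral_le_of_norm_le_const key).trans (le_of_eq ?_)
  rw [abs_of_nonneg (sub_nonneg.2 hab), mul_assoc]
  congr 1
  rcases hab.eq_or_lt with rfl | h
  · rw [sub_self, mul_zero, Real.zero_rpow (by linarith)]
  · rw [← Real.rpow_add_one (sub_pos.2 h).ne']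
    congr 1; ring

end IsSectorial

/-- The convolution `∫_a^b A^γ(b) e^{-(b-s)A(b)} [A(b) - A(s)] A^{-γ}(b) u(s) ds`. -/
noncomputable def frozenConv (A : ℝ → X →ₗ.[ℂ] X) (θ γ a b : ℝ) (u : ℝ → X) : X :=
  ∫ s in a..b, fracExp (A b) θ γ (b - s) (relDiff A θ γ b s (u s))

namespace Assumptions

variable {A : ℝ → X →ₗ.[ℂ] X} {θ M ω L₁ L₂ γ : ℝ} (hA : Assumptions A θ M ω L₁ L₂ γ)
include hA

section

variable {a b : ℝ} (ha : a ∈ Icc (-1 : ℝ) 1) (hb : b ∈ Icc (-1 : ℝ) 1) (hab : a ≤ b)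
include ha hb hab

lemma intervalIntegrable_frozenConv {u : ℝ → X} (hu : ContinuousOn u (Icc (-1) 1)) :
    IntervalIntegrable (fun s => fracExp (A b) θ γ (b - s) (relDiff A θ γ b s (u s)))
      volume a b :=
  (hA.isSectorial hb).intervalIntegrable_fracExp_apply hA.exponent_nonneg hA.exponent_lt hab
    ((hA.continuousOn_relDiff_apply hb hu).mono (Icc_subset_Icc ha.1 hb.2))

lemma frozenConv_add {u w : ℝ → X} (hu : ContinuousOn u (Icc (-1) 1))
    (hw : ContinuousOn w (Icc (-1) 1)) :
    frozenConv A θ γ a b (fun s => u s + w s) =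
      frozenConv A θ γ a b u + frozenConv A θ γ a b w := by
  rw [frozenConv, frozenConv, frozenConv, ← intervalIntegral.integral_add
    (hA.intervalIntegrable_frozenConv ha hb hab hu)
    (hA.intervalIntegrable_frozenConv ha hb hab hw)]
  simp only [map_add]

lemma frozenConv_sub {u w : ℝ → X} (hu : ContinuousOn u (Icc (-1) 1))
    (hw : ContinuousOn w (Icc (-1) 1)) :
    frozenConv A θ γ a b (fun s => u s - w s) =
      frozenConv A θ γ a b u - frozenConv A θ γ a b w := by
  rw [frozenConv, frozenConv, frozenConv, ← intervalIntegral.integral_sub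
    (hA.intervalIntegrable_frozenConv ha hb hab hu)
    (hA.intervalIntegrable_frozenConv ha hb hab hw)]
  simp only [map_sub]

lemma frozenConv_sum {ι : Type*} (S : Finset ι) {u : ι → ℝ → X}
    (hu : ∀ j ∈ S, ContinuousOn (u j) (Icc (-1) 1)) :
    frozenConv A θ γ a b (fun s => ∑ j ∈ S, u j s) = ∑ j ∈ S, frozenConv A θ γ a b (u j) := by
  simp only [frozenConv]
  rw [← intervalIntegral.integral_finsetSum fun j hj =>
    hA.intervalIntegrable_frozenConv ha hb hab (hu j hj)]
  simp only [map_sum]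

lemma negPow_frozenConv {u : ℝ → X} (hu : ContinuousOn u (Icc (-1) 1)) :
    negPow (A b) θ γ (frozenConv A θ γ a b u) =
      ∫ s in a..b, expNeg (A b) θ (b - s) (relDiff A θ γ b s (u s)) :=
  (hA.isSectorial hb).negPow_integral_fracExp hA.exponent_nonneg hA.exponent_lt hab
    ((hA.continuousOn_relDiff_apply hb hu).mono (Icc_subset_Icc ha.1 hb.2))

lemma norm_frozenConv_le {u : ℝ → X} {C : ℝ} (hu : ∀ s ∈ Icc (-1 : ℝ) 1, ‖u s‖ ≤ C) :
    ‖frozenConv A θ γ a b u‖ ≤ fracConst θ M γ * (|L₁| * C) * (b - a) ^ (2 - γ) := by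
  have hC : 0 ≤ C := (norm_nonneg _).trans (hu b hb)
  refine (hA.isSectorial hb).norm_integral_fracExp_le hA.exponent_nonneg hA.exponent_lt hab
    (by positivity) fun s hs => ?_
  have hs' : s ∈ Icc (-1 : ℝ) 1 := ⟨ha.1.trans hs.1, hs.2.trans hb.2⟩
  refine ((relDiff A θ γ b s).le_opNorm _).trans ?_
  have h := hA.norm_relDiff_le hb hs'
  rw [abs_of_nonneg (sub_nonneg.2 hs.2)] at h
  refine (mul_le_mul h (hu s hs') (norm_nonneg _) ((norm_nonneg _).trans h)).trans (le_of_eq ?_)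
  ring

end
end Assumptions
end Smoothing

/-! ### The block matrices -/

section Blocks

variable {X : Type*} [NormedAddCommGroup X] [NormedSpace ℂ X] [CompleteSpace X]

variable {A : ℝ → X →ₗ.[ℂ] X} {θ M ω L₁ L₂ γ : ℝ} (hA : Assumptions A θ M ω L₁ L₂ γ)
variable {n : ℕ}

omit [CompleteSpace X] in
lemma blockOp_apply (a : Fin (n + 1) → Fin (n + 1) → X →L[ℂ] X) (y : Fin (n + 1) → X)
    (k : Fin (n + 1)) : blockOp a y k = ∑ j, a k j (y j) := by
  simp [blockOp]

omit [CompleteSpace X] in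
lemma matS_zero (α : ℝ) (y : Fin (n + 1) → X) :
    matS A θ γ α n y 0 = y 0 + (α : ℂ) •
      transOp A θ γ (node n 0) (node n (Fin.last n)) (y (Fin.last n)) := by
  rw [matS, blockOp_apply]
  simp only [Fin.cases_zero, add_apply, Finset.sum_add_distrib]
  congr 1
  · rw [Finset.sum_eq_single 0 (fun j _ hj => by simp [hj]) (by simp)]
    simp
  · rw [Finset.sum_eq_single (Fin.last n) (fun j _ hj => by simp [hj]) (by simp)]
    simp [sigmaZero, transOp]

omit [CompleteSpace X] in
lemma matS_succ (α : ℝ) (y : Fin (n + 1) → X) (i : Fin n) :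
    matS A θ γ α n y i.succ = y i.succ -
      expNeg (A (node n i.succ)) θ (node n i.succ - node n i.castSucc)
        (transOp A θ γ (node n i.succ) (node n i.castSucc) (y i.castSucc)) := by
  rw [matS, blockOp_apply]
  simp only [Fin.cases_succ, sub_apply, Finset.sum_sub_distrib]
  congr 1
  · rw [Finset.sum_eq_single i.succ (fun j _ hj => by simp [hj]) (by simp)]
    simp
  · rw [Finset.sum_eq_single i.castSucc (fun j _ hj => by simp [hj]) (by simp)]
    simp [sigma, transOp]

omit [CompleteSpace X] in
lemma matB_zero (y : Fin (n + 1) → X) : matB A θ γ n y 0 = 0 := by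
  rw [matB, blockOp_apply]
  simp

/-- The polynomial interpolating the values `A^γ(b) A^{-γ}(t_j) y_j` at the nodes `t_j`. -/
noncomputable def interpOp (A : ℝ → X →ₗ.[ℂ] X) (θ γ b : ℝ) (n : ℕ) (y : Fin (n + 1) → X) (s : ℝ) :
    X :=
  ∑ j, (lagr n j s : ℂ) • transOp A θ γ b (node n j) (y j)

omit [CompleteSpace X] in
lemma continuous_lagr_smul (j : Fin (n + 1)) (x : X) :
    Continuous fun s => (lagr n j s : ℂ) • x := by
  have := continuous_lagr n j
  fun_prop

omit [CompleteSpace X] in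
lemma continuous_interpOp (b : ℝ) (y : Fin (n + 1) → X) :
    Continuous (interpOp A θ γ b n y) := by
  unfold interpOp
  exact continuous_finsetSum _ fun j _ => continuous_lagr_smul j _

omit [CompleteSpace X] in
lemma norm_sum_lagr_smul_le (hn : 3 ≤ n) {s C : ℝ} (hs : s ∈ Icc (-1 : ℝ) 1)
    {w : Fin (n + 1) → X} (hw : ∀ j, ‖w j‖ ≤ C) :
    ‖∑ j, (lagr n j s : ℂ) • w j‖ ≤ 8 * Real.log n * C := by
  have hC : 0 ≤ C := (norm_nonneg _).trans (hw 0)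
  calc ‖∑ j, (lagr n j s : ℂ) • w j‖ ≤ ∑ j, |lagr n j s| * C := by
        refine norm_sum_le_of_le _ fun j _ => ?_
        rw [norm_smul, Complex.norm_real, Real.norm_eq_abs]
        gcongr
        exact hw j
    _ ≤ 8 * Real.log n * C := by
        rw [← Finset.sum_mul]
        gcongr
        exact sum_abs_lagr_le hn hs

namespace Assumptions

include hA

lemma coefAlpha_negPow (i : Fin n) (j : Fin (n + 1)) (x : X) :
    coefAlpha A θ γ n i j (negPow (A (node n j)) θ γ x) =
      negPow (A (node n i.succ)) θ γ (frozenConv A θ γ (node n i.castSucc) (node n i.succ)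
        fun s => (lagr n j s : ℂ) • transOp A θ γ (node n i.succ) (node n j) x) := by
  have hn : 0 < n := i.pos
  rw [hA.negPow_frozenConv (node_mem n _) (node_mem n _)
    (node_strictMono hn Fin.castSucc_lt_succ).le (continuous_lagr_smul j _).continuousOn, coefAlpha]
  refine intervalIntegral.integral_congr fun s _ => ?_
  simp only [map_smul]
  rw [hA.diffApply_negPow (node_mem n _) (node_mem n _)]

/-- The blocks of `B` are bounded operators. -/
lemma frozenConv_lagr_smul (hn : 3 ≤ n) (i : Fin n) (j : Fin (n + 1)) : ∃ R : X →L[ℂ] X, ∀ x,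
    R x = frozenConv A θ γ (node n i.castSucc) (node n i.succ)
        fun s => (lagr n j s : ℂ) • transOp A θ γ (node n i.succ) (node n j) x := by
  have hab : node n i.castSucc ≤ node n i.succ := (node_strictMono i.pos Fin.castSucc_lt_succ).le
  have hc := fun x : X => (continuous_lagr_smul (n := n) j x).continuousOn (s := Icc (-1 : ℝ) 1)
  refine ⟨LinearMap.mkContinuous
    { toFun := fun x => frozenConv A θ γ (node n i.castSucc) (node n i.succ)
        fun s => (lagr n j s : ℂ) • transOp A θ γ (node n i.succ) (node n j) x
      map_add' := fun x y => ?_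
      map_smul' := fun c x => ?_ }
    (fracConst θ M γ * (|L₁| * (8 * Real.log n * (1 + 2 * |L₂|))) *
      (node n i.succ - node n i.castSucc) ^ (2 - γ)) fun x => ?_, fun x => rfl⟩
  · rw [← hA.frozenConv_add (node_mem n _) (node_mem n _) hab (hc _) (hc _)]
    simp only [map_add, smul_add]
  · simp only [frozenConv, map_smul, RingHom.id_apply]
    rw [← intervalIntegral.integral_smul]
    simp only [smul_comm c]
  · refine (hA.norm_frozenConv_le (node_mem n _) (node_mem n _) hab
      (C := 8 * Real.log n * ((1 + 2 * |L₂|) * ‖x‖)) fun s hs => ?_).trans (le_of_eq (by ring))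
    rw [norm_smul, Complex.norm_real, Real.norm_eq_abs]
    refine mul_le_mul ?_ ((ContinuousLinearMap.le_opNorm _ _).trans ?_) (norm_nonneg _)
      (by have := one_le_log hn; positivity)
    · exact (Finset.single_le_sum (f := fun j => |lagr n j s|) (fun _ _ => abs_nonneg _)
        (Finset.mem_univ j)).trans (sum_abs_lagr_le hn hs)
    · gcongr
      exact hA.norm_transOp_le' (node_mem n _) (node_mem n _)

lemma matB_succ (hn : 3 ≤ n) (y : Fin (n + 1) → X) (i : Fin n) :
    matB A θ γ n y i.succ = frozenConv A θ γ (node n i.castSucc) (node n i.succ)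
      (interpOp A θ γ (node n i.succ) n y) := by
  have hab : node n i.castSucc ≤ node n i.succ := (node_strictMono i.pos Fin.castSucc_lt_succ).le
  rw [matB, blockOp_apply]
  unfold interpOp
  rw [hA.frozenConv_sum (node_mem n _) (node_mem n _) hab _
    fun j _ => (continuous_lagr_smul j _).continuousOn]
  refine Finset.sum_congr rfl fun j _ => ?_
  simp only [Fin.cases_succ]
  obtain ⟨R, hR⟩ := hA.frozenConv_lagr_smul hn i j
  rw [boundedOf_apply (R := R), hA.coefAlpha_negPow, hA.ev_negPow (node_mem n _)]
  intro x
  rw [hA.coefAlpha_negPow, hA.ev_negPow (node_mem n _), hR]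

/-- A bound `O(n^{γ-2})` for the convolutions over one step, which has length at most `π / n`. -/
lemma norm_frozenConv_step_le (i : Fin n) {u : ℝ → X} {C : ℝ}
    (hu : ∀ s ∈ Icc (-1 : ℝ) 1, ‖u s‖ ≤ C) :
    ‖frozenConv A θ γ (node n i.castSucc) (node n i.succ) u‖ ≤
      fracConst θ M γ * |L₁| * Real.pi ^ 2 * (n : ℝ) ^ (γ - 2) * C := by
  have hn : 0 < n := i.pos
  have hn' : (0 : ℝ) < n := Nat.cast_pos.2 hn
  have hab : node n i.castSucc ≤ node n i.succ := (node_strictMono hn Fin.castSucc_lt_succ).le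
  have hC : 0 ≤ C := (norm_nonneg _).trans (hu _ neg_one_mem)
  have hc : 0 ≤ fracConst θ M γ := (hA.isSectorial neg_one_mem).fracConst_nonneg hA.exponent_lt
  have h0 := hA.exponent_nonneg
  have h1 := hA.exponent_lt
  refine (hA.norm_frozenConv_le (node_mem n _) (node_mem n _) hab hu).trans ?_
  have hτ : (node n i.succ - node n i.castSucc) ^ (2 - γ) ≤
      Real.pi ^ 2 * (n : ℝ) ^ (γ - 2) := by
    refine (Real.rpow_le_rpow (sub_nonneg.2 hab) (node_step_le hn i) (by linarith)).trans ?_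
    rw [Real.div_rpow Real.pi_pos.le hn'.le, div_eq_mul_inv, ← Real.rpow_neg hn'.le, neg_sub]
    gcongr
    rw [← Real.rpow_natCast]
    exact Real.rpow_le_rpow_of_exponent_le (by linarith [Real.pi_gt_three])
      (by push_cast; linarith)
  calc _ ≤ fracConst θ M γ * (|L₁| * C) * (Real.pi ^ 2 * (n : ℝ) ^ (γ - 2)) := by gcongr
    _ = _ := by ring

lemma norm_matB_le (hn : 3 ≤ n) (y : Fin (n + 1) → X) :
    ‖matB A θ γ n y‖ ≤ fracConst θ M γ * |L₁| * Real.pi ^ 2 * (n : ℝ) ^ (γ - 2) *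
      (8 * Real.log n * ((1 + 2 * |L₂|) * ‖y‖)) := by
  have hc : 0 ≤ fracConst θ M γ := (hA.isSectorial neg_one_mem).fracConst_nonneg hA.exponent_lt
  have hl := one_le_log hn
  rw [pi_norm_le_iff_of_nonneg (by positivity)]
  intro k
  refine Fin.cases ?_ (fun i => ?_) k
  · rw [matB_zero, norm_zero]
    positivity
  · rw [hA.matB_succ hn]
    refine hA.norm_frozenConv_step_le i fun s hs => norm_sum_lagr_smul_le hn hs fun j => ?_
    refine (ContinuousLinearMap.le_opNorm _ _).trans ?_
    exact mul_le_mul (hA.norm_transOp_le' (node_mem n _) (node_mem n _)) (norm_le_pi_norm y j)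
      (norm_nonneg _) (by positivity)

end Assumptions
end Blocks

/-! ### Stability of the two-point recursion -/

section Stability

variable {X : Type*} [NormedAddCommGroup X] [NormedSpace ℂ X] [CompleteSpace X]

lemma exists_eq_apply_add {E : Type*} [NormedAddCommGroup E] [CompleteSpace E] {T : E → E} {q : ℝ}
    (hq : q < 1) (hT : ∀ x y, ‖T x - T y‖ ≤ q * ‖x - y‖) (g : E) : ∃ y, y = T y + g := by
  have hc : ContractingWith q.toNNReal (fun y => T y + g) := by
    refine ⟨by simpa [← NNReal.coe_lt_coe] using hq, LipschitzWith.of_dist_le_mul fun x y => ?_⟩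
    rw [dist_eq_norm, dist_eq_norm, add_sub_add_right_eq_sub]
    refine (hT x y).trans ?_
    gcongr
    exact Real.le_coe_toNNReal q
  exact ⟨_, (hc.fixedPoint_isFixedPt).symm⟩

namespace Assumptions

variable {A : ℝ → X →ₗ.[ℂ] X} {θ M ω L₁ L₂ γ : ℝ} (hA : Assumptions A θ M ω L₁ L₂ γ)
variable {n : ℕ}
include hA

lemma norm_sigma_apply_le (i : Fin n) (x : X) :
    ‖expNeg (A (node n i.succ)) θ (node n i.succ - node n i.castSucc)
      (transOp A θ γ (node n i.succ) (node n i.castSucc) x)‖ ≤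
      Real.exp (|L₂| * (node n i.succ - node n i.castSucc)) * ‖x‖ := by
  have hab : 0 ≤ node n i.succ - node n i.castSucc :=
    sub_nonneg.2 (node_strictMono i.pos Fin.castSucc_lt_succ).le
  refine (ContinuousLinearMap.le_opNorm _ _).trans ((mul_le_of_le_one_left (norm_nonneg _)
    ((hA.isSectorial (node_mem n _)).norm_expNeg_le_one hab)).trans ?_)
  refine (ContinuousLinearMap.le_opNorm _ _).trans ?_
  gcongr
  have h := hA.norm_transOp_le (node_mem n i.succ) (node_mem n i.castSucc)
  rw [abs_of_nonneg hab] at h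
  linarith [Real.add_one_le_exp (|L₂| * (node n i.succ - node n i.castSucc))]

/-- The discrete Gronwall estimate: the products of the factors `1 + |L₂| τ_k` stay bounded because
the step sizes `τ_k` add up to at most `2`. -/
lemma norm_apply_le_of_matS (hn : 0 < n) {α G : ℝ} {y : Fin (n + 1) → X}
    (hG : ∀ i : Fin n, ‖matS A θ γ α n y i.succ‖ ≤ G) (k : Fin (n + 1)) :
    ‖y k‖ ≤ Real.exp (2 * |L₂|) * (‖y 0‖ + n * G) := by
  have hG0 : 0 ≤ G := (norm_nonneg _).trans (hG ⟨0, hn⟩)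
  have key : ‖y k‖ ≤ Real.exp (|L₂| * (node n k + 1)) * (‖y 0‖ + (k : ℕ) * G) := by
    refine Fin.induction ?_ (fun i ih => ?_) k
    · rw [node_zero hn]
      simp
    · have hs := matS_succ (A := A) (θ := θ) (γ := γ) α y i
      have e : y i.succ = expNeg (A (node n i.succ)) θ (node n i.succ - node n i.castSucc)
          (transOp A θ γ (node n i.succ) (node n i.castSucc) (y i.castSucc)) +
            matS A θ γ α n y i.succ := by rw [hs]; abel
      rw [e]
      refine (norm_add_le _ _).trans
        ((add_le_add (hA.norm_sigma_apply_le i _) (hG i)).trans ?_)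
      have h1 : 1 ≤ Real.exp (|L₂| * (node n i.succ + 1)) :=
        Real.one_le_exp (mul_nonneg (abs_nonneg _) (by linarith [(node_mem n i.succ).1]))
      have h2 : Real.exp (|L₂| * (node n i.succ - node n i.castSucc)) * ‖y i.castSucc‖ ≤
          Real.exp (|L₂| * (node n i.succ + 1)) * (‖y 0‖ + (i : ℕ) * G) := by
        calc _ ≤ Real.exp (|L₂| * (node n i.succ - node n i.castSucc)) *
              (Real.exp (|L₂| * (node n i.castSucc + 1)) *
                (‖y 0‖ + ((i.castSucc : Fin (n + 1)) : ℕ) * G)) := by gcongr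
          _ = _ := by
              rw [← mul_assoc, ← Real.exp_add, Fin.val_castSucc]
              congr 2; ring
      rw [Fin.val_succ]
      push_cast
      nlinarith
  refine key.trans ?_
  have hk : ((k : ℕ) : ℝ) ≤ n := by exact_mod_cast Nat.lt_succ_iff.1 k.2
  have ht : |L₂| * (node n k + 1) ≤ 2 * |L₂| := by
    nlinarith [abs_nonneg L₂, (node_mem n k).2]
  gcongr

/-- The bound `‖S⁻¹‖ = O(n)`. Going once around the interval changes `y_0` by at most half of its norm
plus a multiple of the data, by the smallness of `α`. -/
lemma norm_le_matS (hn : 0 < n) {α : ℝ}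
    (hα : |α| * (1 + 2 * |L₂|) * Real.exp (2 * |L₂|) ≤ 1 / 2) (y : Fin (n + 1) → X) :
    ‖y‖ ≤ 2 * Real.exp (2 * |L₂|) * (n + 1) * ‖matS A θ γ α n y‖ := by
  set G := ‖matS A θ γ α n y‖ with hG
  have hG0 : 0 ≤ G := norm_nonneg _
  have hk := hA.norm_apply_le_of_matS hn (α := α) (y := y) (G := G)
    fun i => norm_le_pi_norm (matS A θ γ α n y) i.succ
  have h0 : ‖y 0‖ ≤ G + |α| * ((1 + 2 * |L₂|) * ‖y (Fin.last n)‖) := by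
    have e : y 0 = matS A θ γ α n y 0 - (α : ℂ) •
        transOp A θ γ (node n 0) (node n (Fin.last n)) (y (Fin.last n)) := by
      rw [matS_zero]; abel
    rw [e]
    refine (norm_sub_le _ _).trans (add_le_add (norm_le_pi_norm (matS A θ γ α n y) 0) ?_)
    rw [norm_smul, Complex.norm_real, Real.norm_eq_abs]
    gcongr
    refine (ContinuousLinearMap.le_opNorm _ _).trans ?_
    gcongr
    exact hA.norm_transOp_le' (node_mem n _) (node_mem n _)
  have h1 : |α| * ((1 + 2 * |L₂|) * ‖y (Fin.last n)‖) ≤ 1 / 2 * (‖y 0‖ + n * G) := by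
    calc _ ≤ |α| * ((1 + 2 * |L₂|) * (Real.exp (2 * |L₂|) * (‖y 0‖ + n * G))) := by
          gcongr
          exact hk _
      _ = |α| * (1 + 2 * |L₂|) * Real.exp (2 * |L₂|) * (‖y 0‖ + n * G) := by ring
      _ ≤ _ := by gcongr
  rw [pi_norm_le_iff_of_nonneg (by positivity)]
  intro k
  refine (hk k).trans ?_
  have h2 : ‖y 0‖ + n * G ≤ 2 * (n + 1) * G := by linarith
  calc _ ≤ Real.exp (2 * |L₂|) * (2 * (n + 1) * G) := by gcongr
    _ = _ := by ring

lemma isInvertible_of_surjective_matS (hn : 0 < n) {α : ℝ}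
    (hα : |α| * (1 + 2 * |L₂|) * Real.exp (2 * |L₂|) ≤ 1 / 2)
    (hs : Function.Surjective (matS A θ γ α n)) : (matS A θ γ α n).IsInvertible := by
  have hi : Function.Injective (matS A θ γ α n) := by
    rw [injective_iff_map_eq_zero]
    intro y hy
    have h := hA.norm_le_matS hn hα y
    rwa [hy, norm_zero, mul_zero, norm_le_zero_iff] at h
  exact ⟨ContinuousLinearEquiv.ofBijective _ (LinearMap.ker_eq_bot.2 hi)
    (LinearMap.range_eq_top.2 hs), ContinuousLinearEquiv.coe_ofBijective _ _ _⟩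

omit hA [CompleteSpace X] in
/-- For `α = 0` the system is solved by forward recursion. -/
lemma surjective_matS_zero : Function.Surjective (matS A θ γ 0 n) := by
  intro g
  refine ⟨Fin.induction (motive := fun _ => X) (g 0) fun i x => g i.succ +
    expNeg (A (node n i.succ)) θ (node n i.succ - node n i.castSucc)
      (transOp A θ γ (node n i.succ) (node n i.castSucc) x), funext fun k => ?_⟩
  refine Fin.cases ?_ (fun i => ?_) k
  · rw [matS_zero]
    simp
  · rw [matS_succ, Fin.induction_succ]
    abel

/-- The corner entry `α σ_0` is a perturbation of the lower triangular matrix with `α = 0` of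
relative size at most `1 / 2`. -/
theorem isInvertible_matS (hn : 0 < n) {α : ℝ}
    (hα : |α| * (1 + 2 * |L₂|) * Real.exp (2 * |L₂|) ≤ 1 / 2) :
    (matS A θ γ α n).IsInvertible := by
  refine hA.isInvertible_of_surjective_matS hn hα fun g => ?_
  have h0 := hA.isInvertible_of_surjective_matS hn (α := 0) (by simp) surjective_matS_zero
  set T : (Fin (n + 1) → X) →L[ℂ] (Fin (n + 1) → X) :=
    (matS A θ γ 0 n).inverse.comp (matS A θ γ 0 n - matS A θ γ α n) with hT
  have hST : ∀ y, matS A θ γ 0 n (T y) = matS A θ γ 0 n y - matS A θ γ α n y := fun y => by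
    rw [hT, ContinuousLinearMap.comp_apply, h0.self_apply_inverse, sub_apply]
  have hTn : ∀ y, ‖T y‖ ≤ 1 / 2 * ‖y‖ := fun y => by
    have hz : T y 0 = -((α : ℂ) •
        transOp A θ γ (node n 0) (node n (Fin.last n)) (y (Fin.last n))) := by
      have h := congrFun (hST y) 0
      rw [Pi.sub_apply, matS_zero, matS_zero, matS_zero] at h
      simpa using h
    have hs : ∀ i : Fin n, ‖matS A θ γ 0 n (T y) i.succ‖ ≤ 0 := fun i => by
      rw [hST, Pi.sub_apply, matS_succ, matS_succ, sub_self, norm_zero]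
    rw [pi_norm_le_iff_of_nonneg (by positivity)]
    intro k
    refine (hA.norm_apply_le_of_matS hn hs k).trans ?_
    rw [mul_zero, add_zero, hz, norm_neg, norm_smul, Complex.norm_real, Real.norm_eq_abs]
    have h1 : ‖transOp A θ γ (node n 0) (node n (Fin.last n)) (y (Fin.last n))‖ ≤
        (1 + 2 * |L₂|) * ‖y‖ := by
      refine (ContinuousLinearMap.le_opNorm _ _).trans ?_
      exact mul_le_mul (hA.norm_transOp_le' (node_mem n _) (node_mem n _)) (norm_le_pi_norm y _)
        (norm_nonneg _) (by positivity)
    calc _ ≤ Real.exp (2 * |L₂|) * (|α| * ((1 + 2 * |L₂|) * ‖y‖)) := by gcongr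
      _ = |α| * (1 + 2 * |L₂|) * Real.exp (2 * |L₂|) * ‖y‖ := by ring
      _ ≤ _ := by gcongr
  obtain ⟨y, hy⟩ := exists_eq_apply_add (T := T) (q := 1 / 2) (by norm_num)
    (fun x y => by rw [← map_sub]; exact hTn _) ((matS A θ γ 0 n).inverse g)
  refine ⟨y, ?_⟩
  have h := congrArg (matS A θ γ 0 n) hy
  rw [map_add, hST, h0.self_apply_inverse] at h
  have : matS A θ γ α n y = g := by
    have h' : matS A θ γ 0 n y + matS A θ γ α n y = matS A θ γ 0 n y + g := by
      nth_rewrite 1 [h]; abel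
    exact add_left_cancel h'
  exact this

end Assumptions
end Stability

/-! ### The discrete system -/

section System

variable {X : Type*} [NormedAddCommGroup X] [NormedSpace ℂ X] [CompleteSpace X]

namespace Assumptions

variable {A : ℝ → X →ₗ.[ℂ] X} {θ M ω L₁ L₂ γ : ℝ} (hA : Assumptions A θ M ω L₁ L₂ γ)
variable {n : ℕ}
include hA

lemma weighted_negPow (w : Fin (n + 1) → X) :
    weighted A θ γ n (fun k => negPow (A (node n k)) θ γ (w k)) = w :=
  funext fun k => hA.ev_negPow (node_mem n k) (w k)

lemma negPow_rhs_zero {φ : X} (f : ℝ → X) (hφ : φ ∈ (fracPow (A (node n 0)) θ γ).domain) :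
    negPow (A (node n 0)) θ γ (rhs A θ γ n φ f 0) = φ :=
  hA.negPow_ev (node_mem n 0) hφ

lemma negPow_rhs_succ (φ : X) {f : ℝ → X} (hf : ContinuousOn f (Icc (-1) 1)) (i : Fin n) :
    negPow (A (node n i.succ)) θ γ (rhs A θ γ n φ f i.succ) = coefPhi A θ n f i := by
  refine hA.negPow_ev (node_mem n i.succ) (mem_fracPow_domain.2 ⟨∫ s in
    (node n i.castSucc)..(node n i.succ), fracExp (A (node n i.succ)) θ γ (node n i.succ - s) (f s),
    ?_⟩)
  exact (hA.isSectorial (node_mem n _)).negPow_integral_fracExp hA.exponent_nonneg hA.exponent_lt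
    (node_strictMono i.pos Fin.castSucc_lt_succ).le
    (hf.mono (Icc_subset_Icc (node_mem n _).1 (node_mem n _).2))

lemma negPow_matS_zero (α : ℝ) (w : Fin (n + 1) → X) :
    negPow (A (node n 0)) θ γ (matS A θ γ α n w 0) = negPow (A (node n 0)) θ γ (w 0) +
      (α : ℂ) • negPow (A (node n (Fin.last n))) θ γ (w (Fin.last n)) := by
  rw [matS_zero, map_add, map_smul, hA.negPow_transOp (node_mem n _) (node_mem n _)]

lemma negPow_matS_succ (α : ℝ) (w : Fin (n + 1) → X) (i : Fin n) :
    negPow (A (node n i.succ)) θ γ (matS A θ γ α n w i.succ) =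
      negPow (A (node n i.succ)) θ γ (w i.succ) -
        expNeg (A (node n i.succ)) θ (node n i.succ - node n i.castSucc)
          (negPow (A (node n i.castSucc)) θ γ (w i.castSucc)) := by
  have hc := (hA.isSectorial (node_mem n i.succ)).commute_expNeg_negPow hA.exponent_nonneg
    (sub_nonneg.2 (node_strictMono i.pos (Fin.castSucc_lt_succ (i := i))).le)
  rw [matS_succ, map_sub, ← mul_apply_eq_comp, ← hc.eq, mul_apply_eq_comp,
    hA.negPow_transOp (node_mem n _) (node_mem n _)]

lemma negPow_matB_succ (hn : 3 ≤ n) (w : Fin (n + 1) → X) (i : Fin n) :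
    negPow (A (node n i.succ)) θ γ (matB A θ γ n w i.succ) =
      ∑ j, coefAlpha A θ γ n i j (negPow (A (node n j)) θ γ (w j)) := by
  have hab : node n i.castSucc ≤ node n i.succ := (node_strictMono i.pos Fin.castSucc_lt_succ).le
  rw [hA.matB_succ hn]
  unfold interpOp
  rw [hA.frozenConv_sum (node_mem n _) (node_mem n _) hab _
    fun j _ => (continuous_lagr_smul j _).continuousOn, map_sum]
  exact Finset.sum_congr rfl fun j _ => (hA.coefAlpha_negPow i j (w j)).symm

/-- In the variables `w_k = A_k^γ x_k` the discrete system is `S w = B w + φ`. -/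
lemma isDiscreteSolution_negPow_iff (hn : 3 ≤ n) {α : ℝ} {φ : X} {f : ℝ → X}
    (hφ : φ ∈ (fracPow (A (node n 0)) θ γ).domain) (hf : ContinuousOn f (Icc (-1) 1))
    (w : Fin (n + 1) → X) :
    IsDiscreteSolution A θ γ α n φ f (fun k => negPow (A (node n k)) θ γ (w k)) ↔
      matS A θ γ α n w = matB A θ γ n w + rhs A θ γ n φ f := by
  constructor
  · intro h
    refine funext fun k => hA.injective (node_mem n k) ?_
    rw [Pi.add_apply, map_add]
    refine Fin.cases ?_ (fun i => ?_) k
    · rw [hA.negPow_matS_zero, matB_zero, map_zero, zero_add, hA.negPow_rhs_zero f hφ]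
      exact h.two_point
    · rw [hA.negPow_matS_succ, hA.negPow_matB_succ hn, hA.negPow_rhs_succ φ hf, h.step i]
      abel
  · intro h
    have hk := fun k => congrArg (negPow (A (node n k)) θ γ) (congrFun h k)
    simp only [Pi.add_apply, map_add] at hk
    refine ⟨fun k => negPow_mem_fracPow_domain _, ?_, fun i => ?_⟩
    · have h0 := hk 0
      rwa [hA.negPow_matS_zero, matB_zero, map_zero, zero_add, hA.negPow_rhs_zero f hφ] at h0
    · have hi := hk i.succ
      rw [hA.negPow_matS_succ, hA.negPow_matB_succ hn, hA.negPow_rhs_succ φ hf,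
        sub_eq_iff_eq_add] at hi
      rw [hi]
      abel

lemma eq_negPow_weighted {α : ℝ} {φ : X} {f : ℝ → X} {x : Fin (n + 1) → X}
    (hx : IsDiscreteSolution A θ γ α n φ f x) :
    x = fun k => negPow (A (node n k)) θ γ (weighted A θ γ n x k) :=
  funext fun k => (hA.negPow_ev (node_mem n k) (hx.mem_domain k)).symm

lemma matS_weighted (hn : 3 ≤ n) {α : ℝ} {φ : X} {f : ℝ → X} {x : Fin (n + 1) → X}
    (hφ : φ ∈ (fracPow (A (node n 0)) θ γ).domain) (hf : ContinuousOn f (Icc (-1) 1))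
    (hx : IsDiscreteSolution A θ γ α n φ f x) :
    matS A θ γ α n (weighted A θ γ n x) =
      matB A θ γ n (weighted A θ γ n x) + rhs A θ γ n φ f :=
  (hA.isDiscreteSolution_negPow_iff hn hφ hf _).1 (hA.eq_negPow_weighted hx ▸ hx)

end Assumptions
end System

/-! ### The error equation -/

section Error

variable {X : Type*} [NormedAddCommGroup X] [NormedSpace ℂ X]

lemma le_mul_bestApprox {n : ℕ} {u : ℝ → X} {C r : ℝ} (hC : 0 ≤ C)
    (h : ∀ (p : Fin (n + 1) → X) (E : ℝ), (∀ s ∈ Icc (-1 : ℝ) 1,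
      ‖u s - ∑ i : Fin (n + 1), ((s ^ (i : ℕ) : ℝ) : ℂ) • p i‖ ≤ E) → r ≤ C * E)
    (hu : ContinuousOn u (Icc (-1) 1)) : r ≤ C * bestApprox n u := by
  rw [bestApprox, Real.mul_iInf_of_nonneg hC]
  refine le_ciInf fun p => h p _ fun s hs => ?_
  have hc : ContinuousOn (fun s : ℝ => u s - ∑ i : Fin (n + 1), ((s ^ (i : ℕ) : ℝ) : ℂ) • p i)
      (Icc (-1) 1) := hu.sub (by fun_prop)
  obtain ⟨K, hK⟩ := isCompact_Icc.exists_bound_of_continuousOn hc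
  exact le_ciSup (f := fun t : Icc (-1 : ℝ) 1 =>
    ‖u t - ∑ i : Fin (n + 1), (((t : ℝ) ^ (i : ℕ) : ℝ) : ℂ) • p i‖)
    ⟨K, by rintro _ ⟨t, rfl⟩; exact hK t t.2⟩ ⟨s, hs⟩

lemma bestApprox_nonneg (n : ℕ) (u : ℝ → X) : 0 ≤ bestApprox n u :=
  Real.iInf_nonneg fun _ => Real.iSup_nonneg fun _ => norm_nonneg _

/-- Interpolation reproduces polynomials of degree at most `n`, hence is quasi-optimal with the
Lebesgue constant as a factor. -/
lemma norm_sub_interp_le {n : ℕ} (hn : 3 ≤ n) {u : ℝ → X} {p : Fin (n + 1) → X} {E : ℝ}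
    (hE : ∀ s ∈ Icc (-1 : ℝ) 1,
      ‖u s - ∑ i : Fin (n + 1), ((s ^ (i : ℕ) : ℝ) : ℂ) • p i‖ ≤ E)
    {s : ℝ} (hs : s ∈ Icc (-1 : ℝ) 1) :
    ‖u s - ∑ j, (lagr n j s : ℂ) • u (node n j)‖ ≤ 9 * Real.log n * E := by
  have hE0 : 0 ≤ E := (norm_nonneg _).trans (hE s hs)
  have e : u s - ∑ j, (lagr n j s : ℂ) • u (node n j) =
      (u s - ∑ i : Fin (n + 1), ((s ^ (i : ℕ) : ℝ) : ℂ) • p i) -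
        ∑ j, (lagr n j s : ℂ) • (u (node n j) -
          ∑ i : Fin (n + 1), (((node n j) ^ (i : ℕ) : ℝ) : ℂ) • p i) := by
    simp only [smul_sub, Finset.sum_sub_distrib]
    rw [sum_lagr_smul_eq (by lia) p s]
    abel
  rw [e]
  refine (norm_sub_le _ _).trans ((add_le_add (hE s hs)
    (norm_sum_lagr_smul_le hn hs fun j => hE _ (node_mem n j))).trans ?_)
  nlinarith [one_le_log hn]

namespace Assumptions

variable [CompleteSpace X]
variable {A : ℝ → X →ₗ.[ℂ] X} {θ M ω L₁ L₂ γ : ℝ} (hA : Assumptions A θ M ω L₁ L₂ γ)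
variable {n : ℕ}
include hA

/-- The weighted error `z` at the nodes satisfies `S z = B z + ψ`, where the residual `ψ` is
the frozen convolution of the interpolation error of `A_0^γ v`. -/
lemma exists_residual (hn : 3 ≤ n) {α : ℝ} {φ : X} {f v : ℝ → X} {x : Fin (n + 1) → X}
    (hf : ContinuousOn f (Icc (-1) 1)) (hv : IsSolution A θ γ α φ f v)
    (hx : IsDiscreteSolution A θ γ α n φ f x) :
    ∃ ψ : Fin (n + 1) → X,
      matS A θ γ α n (weighted A θ γ n fun k => v (node n k) - x k) =
        matB A θ γ n (weighted A θ γ n fun k => v (node n k) - x k) + ψ ∧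
      ‖ψ‖ ≤ fracConst θ M γ * |L₁| * Real.pi ^ 2 * (n : ℝ) ^ (γ - 2) * ((1 + 2 * |L₂|) *
        (9 * Real.log n)) * bestApprox n fun t => ev (fracPow (A (-1)) θ γ) (v t) := by
  have hn0 : 0 < n := by lia
  have h1 := neg_one_mem
  have hl := one_le_log hn
  have hc : 0 ≤ fracConst θ M γ := (hA.isSectorial h1).fracConst_nonneg hA.exponent_lt
  set u : ℝ → X := fun t => ev (fracPow (A (-1)) θ γ) (v t) with hu_def
  have hu : ContinuousOn u (Icc (-1) 1) := hv.continuousOn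
  set w : Fin (n + 1) → X := fun k => transOp A θ γ (node n k) (-1) (u (node n k)) with hw
  have hNw : ∀ k, negPow (A (node n k)) θ γ (w k) = v (node n k) := fun k => by
    rw [hw, hA.negPow_transOp (node_mem n k) h1]
    exact hA.negPow_ev h1 (hv.mem_domain _ (node_mem n k))
  have hz : weighted A θ γ n (fun k => v (node n k) - x k) = w - weighted A θ γ n x := by
    rw [← hA.weighted_negPow (w - weighted A θ γ n x)]
    refine congrArg _ (funext fun k => ?_)
    rw [Pi.sub_apply, map_sub, hNw]
    exact congrArg _ (congrFun (hA.eq_negPow_weighted hx) k)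
  have hφ : φ ∈ (fracPow (A (node n 0)) θ γ).domain := by
    rw [← hx.two_point]
    exact Submodule.add_mem _ (hx.mem_domain 0) (Submodule.smul_mem _ _
      (hA.mem_fracPow_domain_of (node_mem n _) (node_mem n _) (hx.mem_domain _)))
  refine ⟨matS A θ γ α n w - matB A θ γ n w - rhs A θ γ n φ f, ?_, ?_⟩
  · rw [hz, map_sub, map_sub, hA.matS_weighted hn hφ hf hx]
    abel
  · refine le_mul_bestApprox (by positivity) (fun p E hE => ?_) hu
    have hE0 : 0 ≤ E := (norm_nonneg _).trans (hE _ h1)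
    rw [pi_norm_le_iff_of_nonneg (by positivity)]
    intro k
    refine Fin.cases ?_ (fun i => ?_) k
    · have : (matS A θ γ α n w - matB A θ γ n w - rhs A θ γ n φ f) 0 = 0 := by
        refine hA.injective (node_mem n 0) ?_
        rw [Pi.sub_apply, Pi.sub_apply, matB_zero, sub_zero, map_sub, hA.negPow_matS_zero,
          hA.negPow_rhs_zero f hφ, hNw, hNw, node_zero hn0, node_last, hv.two_point, sub_self,
          map_zero]
      rw [this, norm_zero]
      positivity
    · have ha := node_mem n i.castSucc
      have hb := node_mem n i.succ
      have hab : node n i.castSucc ≤ node n i.succ :=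
        (node_strictMono i.pos Fin.castSucc_lt_succ).le
      have hcu : ContinuousOn (fun s => transOp A θ γ (node n i.succ) (-1) (u s)) (Icc (-1) 1) :=
        (ContinuousLinearMap.continuous _).comp_continuousOn hu
      have hci := (continuous_interpOp (A := A) (θ := θ) (γ := γ) (node n i.succ) w).continuousOn
        (s := Icc (-1 : ℝ) 1)
      have hcf : ContinuousOn (fun s => relDiff A θ γ (node n i.succ) s
          (transOp A θ γ (node n i.succ) (-1) (u s))) (Icc (-1) 1) :=
        hA.continuousOn_relDiff_apply hb hcu
      have hsub : Icc (node n i.castSucc) (node n i.succ) ⊆ Icc (-1 : ℝ) 1 :=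
        Icc_subset_Icc ha.1 hb.2
      have e : (matS A θ γ α n w - matB A θ γ n w - rhs A θ γ n φ f) i.succ =
          frozenConv A θ γ (node n i.castSucc) (node n i.succ) (fun s =>
            transOp A θ γ (node n i.succ) (-1) (u s) - interpOp A θ γ (node n i.succ) n w s) := by
        rw [hA.frozenConv_sub ha hb hab hcu hci, Pi.sub_apply, Pi.sub_apply, hA.matB_succ hn,
          sub_right_comm]
        congr 1
        refine hA.injective hb ?_
        have hm := hA.mild_frozen hf hv ha hb hab
        simp only [map_add] at hm
        rw [map_sub, hA.negPow_matS_succ, hNw, hNw, hA.negPow_rhs_succ φ hf,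
          hA.negPow_frozenConv ha hb hab hcu, hm, intervalIntegral.integral_add
          ((hA.isSectorial hb).intervalIntegrable_expNeg_apply hab le_rfl (hcf.mono hsub))
          ((hA.isSectorial hb).intervalIntegrable_expNeg_apply hab le_rfl (hf.mono hsub)), coefPhi]
        abel
      rw [e]
      refine (hA.norm_frozenConv_step_le i (C := (1 + 2 * |L₂|) * (9 * Real.log n * E))
        fun s hs => ?_).trans (le_of_eq (by ring))
      have e2 : transOp A θ γ (node n i.succ) (-1) (u s) - interpOp A θ γ (node n i.succ) n w s =
          transOp A θ γ (node n i.succ) (-1) (u s - ∑ j, (lagr n j s : ℂ) • u (node n j)) := by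
        simp only [map_sub, map_sum, map_smul, interpOp, hw]
        congr 1
        exact Finset.sum_congr rfl fun j _ => by
          rw [hA.transOp_comp hb (node_mem n j) h1]
      rw [e2]
      refine (ContinuousLinearMap.le_opNorm _ _).trans ?_
      exact mul_le_mul (hA.norm_transOp_le' hb h1) (norm_sub_interp_le hn hE hs)
        (norm_nonneg _) (by positivity)

end Assumptions
end Error

/-! ### The contraction -/

section Contraction

variable {X : Type*} [NormedAddCommGroup X] [NormedSpace ℂ X] [CompleteSpace X]

/-- The constant `c` in the estimates of order `n^{γ-1} ln n`; the summand `1` makes it positive. -/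
noncomputable def errorConst (θ M L₁ L₂ γ : ℝ) : ℝ :=
  72 * Real.exp (2 * |L₂|) * (fracConst θ M γ * |L₁| * Real.pi ^ 2 * (1 + 2 * |L₂|)) + 1

lemma eventually_mul_rpow_mul_log_le {C γ : ℝ} (hγ : γ < 1) :
    ∀ᶠ n : ℕ in atTop, C * (n : ℝ) ^ (γ - 1) * Real.log n ≤ 1 / 2 := by
  have h := (isLittleO_log_rpow_atTop (r := 1 - γ) (by linarith)).tendsto_div_nhds_zero
  have h2 := (h.comp tendsto_natCast_atTop_atTop).const_mul C
  rw [mul_zero] at h2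
  filter_upwards [h2.eventually_le_const (show (0 : ℝ) < 1 / 2 by norm_num)] with n hn
  refine le_of_eq_of_le ?_ hn
  rw [← neg_sub 1 γ, Real.rpow_neg (Nat.cast_nonneg n)]
  simp only [Function.comp_apply]
  ring

lemma norm_iterate_sub_le {E : Type*} [SeminormedAddCommGroup E] {F : E → E} {q : ℝ} (hq : 0 ≤ q)
    (hF : ∀ x y, ‖F x - F y‖ ≤ q * ‖x - y‖) {x : E} (hx : F x = x) (y : E) (k : ℕ) :
    ‖F^[k] y - x‖ ≤ q ^ k * ‖y - x‖ := by
  induction k with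
  | zero => simp
  | succ k ih =>
    rw [Function.iterate_succ_apply', pow_succ']
    calc ‖F (F^[k] y) - x‖ = ‖F (F^[k] y) - F x‖ := by rw [hx]
      _ ≤ q * ‖F^[k] y - x‖ := hF _ _
      _ ≤ q * (q ^ k * ‖y - x‖) := by gcongr
      _ = _ := by ring

namespace Assumptions

variable {A : ℝ → X →ₗ.[ℂ] X} {θ M ω L₁ L₂ γ : ℝ} (hA : Assumptions A θ M ω L₁ L₂ γ)
variable {n : ℕ}
include hA

omit [CompleteSpace X] in
lemma errorConst_pos : 0 < errorConst θ M L₁ L₂ γ := by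
  have hc : 0 ≤ fracConst θ M γ := (hA.isSectorial neg_one_mem).fracConst_nonneg hA.exponent_lt
  rw [errorConst]
  positivity

/-- The factor `n + 1` in the bound of `S⁻¹` is absorbed by the order `n^{γ-2} ln n` of `g`. -/
lemma norm_inverse_matS_le (hn : 3 ≤ n) {α : ℝ}
    (hα : |α| * (1 + 2 * |L₂|) * Real.exp (2 * |L₂|) ≤ 1 / 2) {g : Fin (n + 1) → X} {C : ℝ}
    (hC : 0 ≤ C)
    (hg : ‖g‖ ≤ fracConst θ M γ * |L₁| * Real.pi ^ 2 * (n : ℝ) ^ (γ - 2) * ((1 + 2 * |L₂|) *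
        (9 * Real.log n)) * C) :
    2 * ‖(matS A θ γ α n).inverse g‖ ≤
      errorConst θ M L₁ L₂ γ * (n : ℝ) ^ (γ - 1) * Real.log n * C := by
  have hn0 : 0 < n := by lia
  have hn' : (1 : ℝ) ≤ n := by exact_mod_cast hn0
  have hl := one_le_log hn
  have hc : 0 ≤ fracConst θ M γ := (hA.isSectorial neg_one_mem).fracConst_nonneg hA.exponent_lt
  have h := hA.norm_le_matS hn0 hα ((matS A θ γ α n).inverse g)
  rw [(hA.isInvertible_matS hn0 hα).self_apply_inverse] at h
  have hp : (n : ℝ) * (n : ℝ) ^ (γ - 2) = (n : ℝ) ^ (γ - 1) := by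
    rw [mul_comm, ← Real.rpow_add_one (by positivity)]
    congr 1; ring
  set F := fracConst θ M γ * |L₁| * Real.pi ^ 2 with hF
  have hF0 : 0 ≤ F := by positivity
  calc 2 * ‖(matS A θ γ α n).inverse g‖
      ≤ 2 * (2 * Real.exp (2 * |L₂|) * (n + n) *
          (F * (n : ℝ) ^ (γ - 2) * ((1 + 2 * |L₂|) * (9 * Real.log n)) * C)) := by
        gcongr
        exact h.trans (by gcongr)
    _ = 72 * Real.exp (2 * |L₂|) * (F * (1 + 2 * |L₂|)) * (n * (n : ℝ) ^ (γ - 2)) *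
          Real.log n * C := by ring
    _ ≤ _ := by
        rw [hp, errorConst]
        gcongr
        linarith

/-- The operator `S⁻¹ B` is a contraction with a factor of order `n^{γ-1} ln n`. -/
lemma norm_inverse_matS_matB_le (hn : 3 ≤ n) {α : ℝ}
    (hα : |α| * (1 + 2 * |L₂|) * Real.exp (2 * |L₂|) ≤ 1 / 2) (y : Fin (n + 1) → X) :
    ‖(matS A θ γ α n).inverse (matB A θ γ n y)‖ ≤
      errorConst θ M L₁ L₂ γ * (n : ℝ) ^ (γ - 1) * Real.log n * ‖y‖ := by
  have hl := one_le_log hn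
  have hc : 0 ≤ fracConst θ M γ := (hA.isSectorial neg_one_mem).fracConst_nonneg hA.exponent_lt
  refine le_trans ?_ (hA.norm_inverse_matS_le hn hα (g := matB A θ γ n y) (norm_nonneg y) ?_)
  · linarith [norm_nonneg ((matS A θ γ α n).inverse (matB A θ γ n y))]
  · refine (hA.norm_matB_le hn y).trans ?_
    rw [mul_assoc _ _ ‖y‖]
    refine mul_le_mul_of_nonneg_left ?_ (by positivity)
    have : 0 ≤ (1 + 2 * |L₂|) * Real.log n * ‖y‖ := by positivity
    linarith

end Assumptions
end Contraction
end NonlocalCGL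

open NonlocalCGL Filter in
theorem theorem1 {X : Type*} [NormedAddCommGroup X] [NormedSpace ℂ X] [CompleteSpace X]
    (A : ℝ → X →ₗ.[ℂ] X) (θ M ω L₁ L₂ γ : ℝ)
    (hA : NonlocalCGL.Assumptions A θ M ω L₁ L₂ γ) :
    ∃ α₀ : ℝ, 0 < α₀ ∧ ∃ c : ℝ, 0 < c ∧ ∃ N : ℕ,
      ∀ α : ℝ, |α| ≤ α₀ → ∀ n : ℕ, N ≤ n →
        -- the error estimate at the nodes
        (∀ (φ : X) (f v : ℝ → X) (x : Fin (n + 1) → X),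
          ContinuousOn f (Set.Icc (-1) 1) →
          NonlocalCGL.IsSolution A θ γ α φ f v →
          NonlocalCGL.IsDiscreteSolution A θ γ α n φ f x →
          ‖NonlocalCGL.weighted A θ γ n (fun k => v (NonlocalCGL.node n k) - x k)‖ ≤
            c * (n : ℝ) ^ (γ - 1) * Real.log n *
              NonlocalCGL.bestApprox n
                (fun t => NonlocalCGL.ev (NonlocalCGL.fracPow (A (-1)) θ γ) (v t))) ∧
        -- the fixed-point form of the discrete system and the fixed-point iteration
        (NonlocalCGL.matS A θ γ α n).IsInvertible ∧
        ∃ q : ℝ, 0 ≤ q ∧ q ≤ c * (n : ℝ) ^ (γ - 1) * Real.log n ∧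
          c * (n : ℝ) ^ (γ - 1) * Real.log n < 1 ∧
          ∀ (φ : X) (f : ℝ → X),
            φ ∈ (NonlocalCGL.fracPow (A (-1)) θ γ).domain →
            ContinuousOn f (Set.Icc (-1) 1) →
            (∀ y : Fin (n + 1) → X,
              NonlocalCGL.matS A θ γ α n y =
                  NonlocalCGL.matB A θ γ n y + NonlocalCGL.rhs A θ γ n φ f ↔
                y = (NonlocalCGL.matS A θ γ α n).inverse (NonlocalCGL.matB A θ γ n y) +
                  (NonlocalCGL.matS A θ γ α n).inverse (NonlocalCGL.rhs A θ γ n φ f)) ∧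
            ∃ x : Fin (n + 1) → X,
              NonlocalCGL.IsDiscreteSolution A θ γ α n φ f x ∧
              (∀ x' : Fin (n + 1) → X,
                NonlocalCGL.IsDiscreteSolution A θ γ α n φ f x' → x' = x) ∧
              NonlocalCGL.matS A θ γ α n (NonlocalCGL.weighted A θ γ n x) =
                NonlocalCGL.matB A θ γ n (NonlocalCGL.weighted A θ γ n x) +
                  NonlocalCGL.rhs A θ γ n φ f ∧
              ∀ (y : Fin (n + 1) → X) (k : ℕ),
                ‖(fun y => (NonlocalCGL.matS A θ γ α n).inverse (NonlocalCGL.matB A θ γ n y) +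
                    (NonlocalCGL.matS A θ γ α n).inverse (NonlocalCGL.rhs A θ γ n φ f))^[k] y -
                  NonlocalCGL.weighted A θ γ n x‖ ≤
                q ^ k * ‖y - NonlocalCGL.weighted A θ γ n x‖ := by
  have hcpos := hA.errorConst_pos
  -- the largest `α₀` admitted by the stability estimate for `S`
  refine ⟨1 / (2 * ((1 + 2 * |L₂|) * Real.exp (2 * |L₂|))), by positivity,
    errorConst θ M L₁ L₂ γ, hcpos, ?_⟩
  obtain ⟨N, hN⟩ := eventually_atTop.1
    (eventually_mul_rpow_mul_log_le (C := errorConst θ M L₁ L₂ γ) hA.exponent_lt)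
  -- `n ≥ N` makes the contraction factor at most `1 / 2`
  refine ⟨max 3 N, fun α hα n hn => ?_⟩
  have hn3 : 3 ≤ n := (le_max_left _ _).trans hn
  have hn0 : 0 < n := by lia
  have hq := hN n ((le_max_right _ _).trans hn)
  have hl := one_le_log hn3
  have hα' : |α| * (1 + 2 * |L₂|) * Real.exp (2 * |L₂|) ≤ 1 / 2 := by
    rw [le_div_iff₀ (by positivity)] at hα
    linarith
  have hS := hA.isInvertible_matS hn0 hα'
  have hB := fun y => hA.norm_inverse_matS_matB_le hn3 hα' y
  have hform : ∀ r y : Fin (n + 1) → X, matS A θ γ α n y = matB A θ γ n y + r ↔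
      y = (matS A θ γ α n).inverse (matB A θ γ n y) + (matS A θ γ α n).inverse r := by
    intro r y
    rw [← map_add, eq_comm (a := y), hS.inverse_apply_eq, eq_comm]
  refine ⟨fun φ f v x hf hv hx => ?_, hS, errorConst θ M L₁ L₂ γ * (n : ℝ) ^ (γ - 1) * Real.log n,
    by positivity, le_rfl, by linarith, fun φ f hφ hf => ⟨hform _, ?_⟩⟩
  · obtain ⟨ψ, hψ, hψn⟩ := hA.exists_residual hn3 hf hv hx
    set z := weighted A θ γ n fun k => v (node n k) - x k
    have e := (hform ψ z).1 hψ
    have h1 := hB z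
    have h2 := hA.norm_inverse_matS_le hn3 hα' (bestApprox_nonneg n _) hψn
    have h3 : ‖z‖ ≤ ‖(matS A θ γ α n).inverse (matB A θ γ n z)‖ +
        ‖(matS A θ γ α n).inverse ψ‖ := by
      nth_rewrite 1 [e]
      exact norm_add_le _ _
    have h4 : errorConst θ M L₁ L₂ γ * (n : ℝ) ^ (γ - 1) * Real.log n * ‖z‖ ≤ 1 / 2 * ‖z‖ := by
      gcongr
    linarith
  · have hφ' : φ ∈ (fracPow (A (node n 0)) θ γ).domain := by rwa [node_zero hn0]
    set r := rhs A θ γ n φ f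
    have hlip : ∀ x y : Fin (n + 1) → X,
        ‖(matS A θ γ α n).inverse (matB A θ γ n x) - (matS A θ γ α n).inverse (matB A θ γ n y)‖ ≤
          errorConst θ M L₁ L₂ γ * (n : ℝ) ^ (γ - 1) * Real.log n * ‖x - y‖ := fun x y => by
      rw [← map_sub, ← map_sub]
      exact hB _
    obtain ⟨w, hw⟩ := exists_eq_apply_add
      (T := fun y => (matS A θ γ α n).inverse (matB A θ γ n y)) (by linarith) hlip
      ((matS A θ γ α n).inverse r)
    have hww := hA.weighted_negPow w
    refine ⟨fun k => negPow (A (node n k)) θ γ (w k),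
      (hA.isDiscreteSolution_negPow_iff hn3 hφ' hf w).2 ((hform r w).2 hw), fun x' hx' => ?_, ?_,
      fun y k => ?_⟩
    -- two solutions give two fixed points of a contraction
    · have h1 := (hform r _).1 (hA.matS_weighted hn3 hφ' hf hx')
      have h2 := hlip (weighted A θ γ n x') w
      rw [← add_sub_add_right_eq_sub _ _ ((matS A θ γ α n).inverse r), ← h1, ← hw] at h2
      have h3 : ‖weighted A θ γ n x' - w‖ ≤ 1 / 2 * ‖weighted A θ γ n x' - w‖ :=
        h2.trans (by gcongr)
      have h4 : weighted A θ γ n x' = w := by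
        rw [← sub_eq_zero, ← norm_le_zero_iff]
        linarith
      rw [hA.eq_negPow_weighted hx', h4]
    · rw [hww]
      exact (hform r w).2 hw
    · rw [hww]
      refine norm_iterate_sub_le (by positivity) (fun x y => ?_) hw.symm y k
      rw [add_sub_add_right_eq_sub]
      exact hlip x y
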